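/- Let $\ell,r\ge 1$, $\omega=(\omega_1,\dots,\omega_\ell)\in\mathbb C^\ell$. Let $\mathscr H_{\ell,r}$ be the degenerate cyclotomic Hecke algebra: the unital associative $\mathbb C$-algebra generated by $s_1,\dots,s_{r-1},x_1,\dots,x_r$ with relations $s_i^2=1$; $x_ix_j=x_jx_i$; $s_is_j=s_js_i$ if $|i-j|>1$; $s_is_{i+1}s_i=s_{i+1}s_is_{i+1}$; $s_ix_j=x_js_i$ if $j\ne i,i+1$; $x_is_i-s_ix_{i+1}=-1$; $s_ix_i-x_{i+1}s_i=-1$; and $(x_1-\omega_1)\cdots(x_1-\omega_\ell)=0$. Let the symmetric group $\mathfrak S_r$ act on $\{1,\dots,r\}$ from the right, and map $\mathfrak S_r$ to $\mathscr H_{\ell,r}$ by $(i,i+1)\mapsto s_i$. Let $\Lambda_{\ell,r}$ be the set of $\ell$-partitions $\lambda=(\lambda^{(1)},\dots,\lambda^{(\ell)})$ of $r$, partially ordered by dominance: $\lambda\trianglerighteq\mu$ if $\sum_{t<s}|\lambda^{(t)}|+\sum_{j=1}^k\lambda^{(s)}_j\ge\sum_{t<s}|\mu^{(t)}|+\sum_{j=1}^k\mu^{(s)}_j$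 for all $1\le s\le\ell$, $k\ge0$. Let $\mathrm{Std}(\lambda)$ be the set of standard $\lambda$-tableaux, i.e. the bijective fillings of the Young diagram of $\lambda$ by $1,\dots,r$ that increase along rows and down columns in each component. Let $\mathfrak t^\lambda$ be the $\lambda$-tableau with $1,\dots,r$ entered in order from left to right along the rows of $\lambda^{(1)}$, then of $\lambda^{(2)}$, and so on, and for $\mathfrak t\in\mathrm{Std}(\lambda)$ let $d(\mathfrak t)\in\mathfrak S_r$ be the permutation with $\mathfrak t^\lambda d(\mathfrak t)=\mathfrak t$. Let $\mathfrak S_{\lambda^{(i)}}\subseteq\mathfrak S_r$ be the row stabilizer of the $i$th component of $\mathfrak t^\lambda$ (fixing the entries of the other components), and put $x^0_{\lambda^{(i)}}=y^1_{\lambda^{(i)}}=\sum_{w\in\mathfrak S_{\lambda^{(i)}}}w$ and $x^1_{\lambda^{(i)}}=y^0_{\lambda^{(i)}}=\sum_{w\in\mathfrak S_{\lambda^{(i)}}}(-1)^{l(w)}w$, where $l$ is the length function. For $\underline c\in\{0,1\}^\ell$ let $x^{\underline c}_\lambda=x^{c_1}_{\lambda^{(1)}}\cdots x^{c_\ell}_{\lambda^{(\ell)}}$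 and $y^{\underline c}_\lambda=y^{c_1}_{\lambda^{(1)}}\cdots y^{c_\ell}_{\lambda^{(\ell)}}$. With $a_i=|\lambda^{(1)}|+\dots+|\lambda^{(i)}|$ and $u\in\mathbb C^\ell$ let $$\pi_{[\lambda]}(u)=\prod_{i=1}^{\ell-1}\prod_{k=1}^{a_i}(x_k-u_{i+1}),\qquad \tilde\pi_{[\lambda]}(u)=\prod_{i=1}^{\ell-1}\prod_{k=1}^{a_i}(x_k-u_{\ell-i}).$$ For $\mathfrak s,\mathfrak t\in\mathrm{Std}(\lambda)$ and $\xi\in\mathfrak S_\ell$, with $\omega^\xi=(\omega_{(1)\xi},\dots,\omega_{(\ell)\xi})$ and $0^\ell=(0,\dots,0)$, put $$m^{\underline c}_{\mathfrak s,\mathfrak t}=d(\mathfrak s)^{-1}\pi_{[\lambda]}(\omega)\,x^{\underline c}_\lambda\, d(\mathfrak t),\qquad n^{\underline c}_{\mathfrak s,\mathfrak t}=d(\mathfrak s)^{-1}\tilde\pi_{[\lambda]}(\omega)\,y^{\underline c}_\lambda\, d(\mathfrak t),$$ $$m^{\xi}_{\mathfrak s,\mathfrak t}=d(\mathfrak s)^{-1}\pi_{[\lambda]}(\omega^\xi)\,x^{0^\ell}_\lambda\,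 d(\mathfrak t),\qquad n^{\xi}_{\mathfrak s,\mathfrak t}=d(\mathfrak s)^{-1}\tilde\pi_{[\lambda]}(\omega^\xi)\,y^{0^\ell}_\lambda\, d(\mathfrak t),$$ all elements of $\mathscr H_{\ell,r}$ (defined by $\omega$). Then there is a unique $\mathbb C$-algebra anti-automorphism $*$ of $\mathscr H_{\ell,r}$ fixing $s_1,\dots,s_{r-1}$ and $x_1$, and for all $\underline c\in\{0,1\}^\ell$ and $\xi\in\mathfrak S_\ell$ each of the four families (a) $\{m^{\underline c}_{\mathfrak s,\mathfrak t}\}$, (b) $\{n^{\underline c}_{\mathfrak s,\mathfrak t}\}$, (c) $\{m^{\xi}_{\mathfrak s,\mathfrak t}\}$, (d) $\{n^{\xi}_{\mathfrak s,\mathfrak t}\}$, indexed by $\lambda\in\Lambda_{\ell,r}$ and $\mathfrak s,\mathfrak t\in\mathrm{Std}(\lambda)$, is a cellular basis of $\mathscr H_{\ell,r}$ in the sense of Graham and Lehrer with respect to $*$. That is, writing $C_{\mathfrak s,\mathfrak t}$ for its members: the family is a $\mathbb C$-basis; $*$ is an involution with $C_{\mathfrak s,\mathfrak t}^*=C_{\mathfrak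 t,\mathfrak s}$; and for all $\lambda\in\Lambda_{\ell,r}$ and $a\in\mathscr H_{\ell,r}$ there are scalars $r_a(\mathfrak s',\mathfrak s)\in\mathbb C$ ($\mathfrak s,\mathfrak s'\in\mathrm{Std}(\lambda)$) such that, for all $\mathfrak s,\mathfrak t\in\mathrm{Std}(\lambda)$, $$aC_{\mathfrak s,\mathfrak t}\equiv\sum_{\mathfrak s'\in\mathrm{Std}(\lambda)}r_a(\mathfrak s',\mathfrak s)\,C_{\mathfrak s',\mathfrak t}$$ modulo the span of all $C_{\mathfrak u,\mathfrak v}$ with $\mathfrak u,\mathfrak v\in\mathrm{Std}(\mu)$, $\mu\triangleright\lambda$ (that is, $\mu\trianglerighteq\lambda$ and $\mu\neq\lambda$). -/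

import Mathlib

open scoped BigOperators
open MulOpposite

noncomputable section

/-! ### Cellular bases (Graham–Lehrer) -/

/-- `C` is a cellular basis of the `R`-algebra `A` with cell datum `(Λ, M, C, σ)`:
`Λ` is a poset, each `M lam` is finite, the elements `C lam S T` form an `R`-basis of `A`,
`σ` is an anti-involution of `A` interchanging `C lam S T` and `C lam T S`, and
`a * C lam S T ≡ ∑ S', r S' S • C lam S' T` modulo the span of the elements `C mu U V` with
`mu < lam`, where the coefficients `r` do not depend on `T`. -/
structure IsCellularBasis (R : Type*) [CommRing R] {A : Type*} [Ring A] [Algebra R A]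
    {Λ : Type*} [PartialOrder Λ] (M : Λ → Type*) [∀ lam, Fintype (M lam)]
    (C : ∀ lam : Λ, M lam → M lam → A) (σ : A ≃ₐ[R] Aᵐᵒᵖ) : Prop where
  linearIndependent :
    LinearIndependent R (fun p : Σ lam : Λ, M lam × M lam => C p.1 p.2.1 p.2.2)
  span_eq_top :
    Submodule.span R (Set.range fun p : Σ lam : Λ, M lam × M lam => C p.1 p.2.1 p.2.2) = ⊤
  involutive : ∀ a : A, unop (σ (unop (σ a))) = a
  anti_basis : ∀ (lam : Λ) (S T : M lam), unop (σ (C lam S T)) = C lam T S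
  mul_basis : ∀ (lam : Λ) (a : A), ∃ r : M lam → M lam → R, ∀ S T : M lam,
    a * C lam S T - ∑ S' : M lam, r S' S • C lam S' T ∈
      Submodule.span R {b : A | ∃ mu : Λ, mu < lam ∧ ∃ U V : M mu, b = C mu U V}

/-! ### Multipartitions, dominance, standard tableaux -/

/-- `ℓ`-partitions of `r`; the parts of the `i`-th component are the row lengths of `comp i`. -/
@[ext] structure Multipartition (ℓ r : ℕ) where
  comp : Fin ℓ → YoungDiagram
  sum_card : ∑ i, (comp i).card = r

namespace Multipartition

variable {ℓ r : ℕ}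

/-- `|λ⁽¹⁾| + ⋯ + |λ⁽ⁱ⁾|`, the number of boxes in the first `i` components
(all components `t` with 0-based index `t < i`). -/
def size (lam : Multipartition ℓ r) (i : ℕ) : ℕ :=
  ∑ t : Fin ℓ with t.val < i, (lam.comp t).card

/-- The partial sums compared in the dominance order. -/
def partialSum (lam : Multipartition ℓ r) (s : Fin ℓ) (k : ℕ) : ℕ :=
  lam.size s + ∑ j ∈ Finset.range k, (lam.comp s).rowLen j

lemma ext_of_partialSum {lam mu : Multipartition ℓ r}
    (h : ∀ s k, lam.partialSum s k = mu.partialSum s k) : lam = mu := by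
  ext1
  funext s
  have h0 := h s 0
  simp only [partialSum, Finset.range_zero, Finset.sum_empty, add_zero] at h0
  have hrow : ∀ k, (lam.comp s).rowLen k = (mu.comp s).rowLen k := by
    intro k
    have h1 := h s k
    have h2 := h s (k + 1)
    simp only [partialSum, Finset.sum_range_succ] at h1 h2
    omega
  apply SetLike.ext
  rintro ⟨i, j⟩
  rw [YoungDiagram.mem_iff_lt_rowLen, YoungDiagram.mem_iff_lt_rowLen, hrow]

/-- The dominance order: `mu ≤ lam` means that `lam` dominates `mu`. -/
instance : PartialOrder (Multipartition ℓ r) where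
  le mu lam := ∀ s k, mu.partialSum s k ≤ lam.partialSum s k
  le_refl _ _ _ := le_rfl
  le_trans _ _ _ h₁ h₂ s k := (h₁ s k).trans (h₂ s k)
  le_antisymm _ _ h₁ h₂ := ext_of_partialSum fun s k => le_antisymm (h₁ s k) (h₂ s k)

/-- The boxes of the Young diagram of `lam`. -/
structure Box (lam : Multipartition ℓ r) where
  comp : Fin ℓ
  row : ℕ
  col : ℕ
  mem : (row, col) ∈ lam.comp comp

/-- The triple (component, row, column) of a box, lexicographically ordered. -/
def Box.key {lam : Multipartition ℓ r} (b : Box lam) : Fin ℓ ×ₗ (ℕ ×ₗ ℕ) :=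
  toLex (b.comp, toLex (b.row, b.col))

lemma Box.key_injective {lam : Multipartition ℓ r} :
    Function.Injective (Box.key : Box lam → _) := by
  rintro ⟨i, a, b, h⟩ ⟨i', a', b', h'⟩ e
  have e1 : (i, toLex (a, b)) = (i', toLex (a', b')) := toLex.injective e
  have e2 : i = i' := congrArg Prod.fst e1
  have e3 : (a, b) = (a', b') := toLex.injective (congrArg Prod.snd e1)
  simp only [Prod.mk.injEq] at e3
  obtain ⟨rfl, rfl⟩ := e3
  subst e2
  rfl

/-- Reading order on boxes: along the rows, from the top row to the bottom row of the first
component, then of the second component, and so on. -/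
instance (lam : Multipartition ℓ r) : LinearOrder (Box lam) :=
  LinearOrder.lift' Box.key Box.key_injective

/-- Boxes, grouped by components. -/
def boxEquiv (lam : Multipartition ℓ r) : Box lam ≃ Σ i : Fin ℓ, {c // c ∈ (lam.comp i).cells} where
  toFun b := ⟨b.comp, (b.row, b.col), (YoungDiagram.mem_cells _).2 b.mem⟩
  invFun p := ⟨p.1, p.2.1.1, p.2.1.2, (YoungDiagram.mem_cells _).1 p.2.2⟩
  left_inv _ := rfl
  right_inv _ := rfl

instance (lam : Multipartition ℓ r) : Fintype (Box lam) := Fintype.ofEquiv _ lam.boxEquiv.symm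

lemma card_box (lam : Multipartition ℓ r) : Fintype.card (Box lam) = r := by
  rw [Fintype.card_congr lam.boxEquiv, Fintype.card_sigma]
  simpa [YoungDiagram.card] using lam.sum_card

/-- A `lam`-tableau: a bijective filling of the boxes by the `r` numbers (here `0, …, r - 1`). -/
abbrev Tableau (lam : Multipartition ℓ r) : Type := Box lam ≃ Fin r

/-- A tableau is standard if in every component its entries increase along the rows and
down the columns. -/
def Tableau.IsStandard {lam : Multipartition ℓ r} (t : Tableau lam) : Prop :=
  (∀ b b' : Box lam, b.comp = b'.comp → b.row = b'.row → b.col < b'.col → t b < t b') ∧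
  (∀ b b' : Box lam, b.comp = b'.comp → b.col = b'.col → b.row < b'.row → t b < t b')

/-- The standard `lam`-tableaux. -/
def Std (lam : Multipartition ℓ r) : Type := {t : Tableau lam // t.IsStandard}

instance (lam : Multipartition ℓ r) : Finite lam.Std :=
  inferInstanceAs (Finite {t : Tableau lam // t.IsStandard})

instance (lam : Multipartition ℓ r) : Fintype lam.Std := Fintype.ofFinite _

/-- The tableau `t^λ`, whose entries increase in reading order. -/
def initialTableau (lam : Multipartition ℓ r) : Tableau lam :=
  (Fintype.orderIsoFinOfCardEq (Box lam) lam.card_box).symm.toEquiv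

/-- The row stabilizer of the `i`-th subtableau of `t^λ`: the permutations that fix all numbers
outside this subtableau and map every number in it to a number in the same row of it. -/
def rowStabilizer (lam : Multipartition ℓ r) (i : Fin ℓ) : Set (Equiv.Perm (Fin r)) :=
  {w | ∀ b b' : Box lam, w (lam.initialTableau b) = lam.initialTableau b' →
    (b.comp = i → b'.comp = i ∧ b'.row = b.row) ∧ (b.comp ≠ i → b' = b)}

end Multipartition

/-! ### The symmetric group, acting on the right

Permutations act on the right on `{0, …, r - 1}`, so that the product `v w` means
"first `v`, then `w`"; this is the multiplication of `(Equiv.Perm (Fin r))ᵐᵒᵖ`. -/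

/-- The symmetric group with its right action. -/
abbrev RightPerm (r : ℕ) : Type := (Equiv.Perm (Fin r))ᵐᵒᵖ

/-- The simple transposition `(i, i + 1)`. -/
def simpleTransposition {r : ℕ} (i : Fin (r - 1)) : RightPerm r :=
  op (Equiv.swap ⟨i, by omega⟩ ⟨i + 1, by omega⟩)

/-- The permutation `d(t)` with `t^λ d(t) = t`. -/
def Multipartition.Std.d {ℓ r : ℕ} {lam : Multipartition ℓ r} (t : lam.Std) : RightPerm r :=
  op (lam.initialTableau.symm.trans t.1)

/-! ### Degenerate affine and cyclotomic Hecke algebras -/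

/-- The generators `s_1, …, s_{r-1}` and `x_1, …, x_r` (with indices shifted to start at `0`). -/
inductive HeckeGen (r : ℕ) : Type
  | s (i : Fin (r - 1)) : HeckeGen r
  | x (j : Fin r) : HeckeGen r

namespace DegAffineHecke

/-- The generator `s_i` of the free algebra. -/
abbrev fs {r : ℕ} (i : Fin (r - 1)) : FreeAlgebra ℂ (HeckeGen r) := FreeAlgebra.ι ℂ (.s i)

/-- The generator `x_j` of the free algebra. -/
abbrev fx {r : ℕ} (j : Fin r) : FreeAlgebra ℂ (HeckeGen r) := FreeAlgebra.ι ℂ (.x j)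

/-- The defining relations of the degenerate affine Hecke algebra. -/
inductive Rel (r : ℕ) : FreeAlgebra ℂ (HeckeGen r) → FreeAlgebra ℂ (HeckeGen r) → Prop
  | s_sq (i : Fin (r - 1)) : Rel r (fs i * fs i) 1
  | x_comm (i j : Fin r) : Rel r (fx i * fx j) (fx j * fx i)
  | s_comm (i j : Fin (r - 1)) (h : i.val + 1 < j.val ∨ j.val + 1 < i.val) :
      Rel r (fs i * fs j) (fs j * fs i)
  | s_x_comm (i : Fin (r - 1)) (j : Fin r) (h : j.val ≠ i.val) (h' : j.val ≠ i.val + 1) :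
      Rel r (fs i * fx j) (fx j * fs i)
  | x_s (i : Fin (r - 1)) :
      Rel r (fx ⟨i, by omega⟩ * fs i - fs i * fx ⟨i + 1, by omega⟩) (-1)
  | s_x (i : Fin (r - 1)) :
      Rel r (fs i * fx ⟨i, by omega⟩ - fx ⟨i + 1, by omega⟩ * fs i) (-1)
  | braid (i j : Fin (r - 1)) (h : j.val = i.val + 1) :
      Rel r (fs i * fs j * fs i) (fs j * fs i * fs j)

end DegAffineHecke

/-- The degenerate affine Hecke algebra over `ℂ`. -/
abbrev DegAffineHecke (r : ℕ) : Type := RingQuot (DegAffineHecke.Rel r)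

namespace DegAffineHecke

def s {r : ℕ} (i : Fin (r - 1)) : DegAffineHecke r := RingQuot.mkAlgHom ℂ (Rel r) (fs i)

def x {r : ℕ} (j : Fin r) : DegAffineHecke r := RingQuot.mkAlgHom ℂ (Rel r) (fx j)

end DegAffineHecke

/-- The relation `f(x_1) = 0`, where `f(x_1) = (x_1 - ω_1) ⋯ (x_1 - ω_ℓ)`. -/
inductive DegCycHecke.Rel {ℓ : ℕ} (r : ℕ) [NeZero r] (ω : Fin ℓ → ℂ) :
    DegAffineHecke r → DegAffineHecke r → Prop
  | cyc : DegCycHecke.Rel r ω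
      (List.ofFn fun i : Fin ℓ =>
        DegAffineHecke.x (0 : Fin r) - algebraMap ℂ (DegAffineHecke r) (ω i)).prod 0

/-- The degenerate cyclotomic Hecke algebra: the quotient of the degenerate affine Hecke algebra
by the two-sided ideal generated by `f(x_1)`. -/
abbrev DegCycHecke {ℓ : ℕ} (r : ℕ) [NeZero r] (ω : Fin ℓ → ℂ) : Type :=
  RingQuot (DegCycHecke.Rel r ω)

/-! ### The group homomorphism from the symmetric group

A sequence of elements of a monoid satisfying the Coxeter relations of the symmetric group
determines a homomorphism from the symmetric group. -/

namespace CoxeterA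

/-- The Coxeter relations for `s 0, …, s (n - 1)`. -/
structure Relations {M : Type*} [Monoid M] (n : ℕ) (s : ℕ → M) : Prop where
  sq : ∀ i, i < n → s i * s i = 1
  braid : ∀ i, i + 1 < n → s i * s (i + 1) * s i = s (i + 1) * s i * s (i + 1)
  comm : ∀ i j, i + 1 < j → j < n → s i * s j = s j * s i

/-- The product `s (p - 1) * ⋯ * s 0`. -/
def desc {M : Type*} [Monoid M] (s : ℕ → M) : ℕ → M
  | 0 => 1
  | p + 1 => s p * desc s p

section
variable {M : Type*} [Monoid M] {n : ℕ} {s : ℕ → M}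

lemma mul_desc_gt (h : Relations n s) {i : ℕ} (hi : i < n) :
    ∀ p, p < i → s i * desc s p = desc s p * s i
  | 0, _ => by simp [desc]
  | p + 1, hp => by
    rw [desc, ← mul_assoc, ← h.comm p i hp hi, mul_assoc, mul_desc_gt h hi p (by omega), mul_assoc]

lemma mul_desc_lt (h : Relations n s) {i : ℕ} :
    ∀ p, p ≤ n → i + 1 < p → s i * desc s p = desc s p * s (i + 1)
  | 0, _, hp => by omega
  | p + 1, hpn, hp => by
    rcases Nat.lt_or_ge (i + 1) p with h1 | h1
    · rw [desc, ← mul_assoc, h.comm i p h1 (by omega), mul_assoc,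
        mul_desc_lt h p (by omega) h1, mul_assoc]
    · obtain rfl : p = i + 1 := by omega
      rw [desc, desc, ← mul_assoc, ← mul_assoc, h.braid i (by omega)]
      rw [mul_assoc, mul_desc_gt h (i := i + 1) (by omega) i (by omega)]
      simp only [mul_assoc]

lemma mul_desc_pred (h : Relations n s) {i : ℕ} (hi : i < n) :
    s i * desc s (i + 1) = desc s i := by
  rw [desc, ← mul_assoc, h.sq i hi, one_mul]

end

/-- The simple transpositions in `Equiv.Perm (Fin (n + 1))`. -/
def simple (n i : ℕ) : Equiv.Perm (Fin (n + 1)) :=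
  if h : i < n then Equiv.swap ⟨i, by omega⟩ ⟨i + 1, by omega⟩ else 1

lemma simple_relations (n : ℕ) : Relations n (simple n) where
  sq i hi := by simp [simple, hi]
  braid i hi := by
    have h0 : i < n := by omega
    simp only [simple, hi, h0, dif_pos]
    have key : ∀ a b c : Fin (n + 1), a ≠ b → a ≠ c → b ≠ c →
        Equiv.swap a b * Equiv.swap b c * Equiv.swap a b =
          Equiv.swap b c * Equiv.swap a b * Equiv.swap b c := by
      intro a b c hab hac hbc
      have h2 := Equiv.swap_mul_swap_mul_swap hbc.symm hac.symm
      rw [Equiv.swap_comm b a, Equiv.swap_comm c b] at h2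
      rw [Equiv.swap_mul_swap_mul_swap hab hac, h2, Equiv.swap_comm]
    exact key _ _ _ (by simp) (by simp; omega) (by simp)
  comm i j hij hj := by
    have h0 : i < n := by omega
    simp only [simple, hj, h0, dif_pos]
    apply (Equiv.Perm.Disjoint.commute _).eq
    intro x
    by_cases hx : x.val = i ∨ x.val = i + 1
    · right
      apply Equiv.swap_apply_of_ne_of_ne <;> simp only [ne_eq, Fin.ext_iff] <;> omega
    · left
      apply Equiv.swap_apply_of_ne_of_ne <;> simp only [ne_eq, Fin.ext_iff] <;> omega

/-- Extension of a permutation of `{0, …, n - 1}` to `{0, …, n}`, shifted by one, fixing `0`. -/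
def emb {n : ℕ} (e : Equiv.Perm (Fin n)) : Equiv.Perm (Fin (n + 1)) :=
  Equiv.Perm.decomposeFin.symm (0, e)

lemma emb_zero {n : ℕ} (e : Equiv.Perm (Fin n)) : emb e 0 = 0 := by simp [emb]

lemma emb_succ {n : ℕ} (e : Equiv.Perm (Fin n)) (x : Fin n) : emb e x.succ = (e x).succ := by
  simp [emb]

lemma emb_mul {n : ℕ} (e f : Equiv.Perm (Fin n)) : emb (e * f) = emb e * emb f := by
  ext x
  refine Fin.cases ?_ (fun x => ?_) x <;> simp [emb_zero, emb_succ]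

lemma emb_simple {n i : ℕ} (hi : i < n) : emb (simple n i) = simple (n + 1) (i + 1) := by
  ext x
  refine Fin.cases ?_ (fun x => ?_) x
  · simp [emb_zero, simple, hi, Equiv.swap_apply_def, Fin.ext_iff]
  · simp only [emb_succ, simple, hi, dif_pos, Nat.add_lt_add_iff_right, Equiv.swap_apply_def,
      Fin.ext_iff, Fin.val_succ]
    split_ifs <;> simp_all

/-- The inverse of `emb` on permutations fixing `0`. -/
def rest {n : ℕ} (w : Equiv.Perm (Fin (n + 1))) : Equiv.Perm (Fin n) :=
  (Equiv.Perm.decomposeFin w).2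

lemma rest_emb {n : ℕ} (e : Equiv.Perm (Fin n)) : rest (emb e) = e := by simp [rest, emb]

lemma emb_rest {n : ℕ} {w : Equiv.Perm (Fin (n + 1))} (hw : w 0 = 0) : emb (rest w) = w := by
  have h1 : Equiv.Perm.decomposeFin.symm (Equiv.Perm.decomposeFin w) = w :=
    Equiv.symm_apply_apply _ _
  have h2 : (Equiv.Perm.decomposeFin w).1 = w 0 := by
    conv_rhs => rw [← h1]
    rw [← Prod.mk.eta (p := Equiv.Perm.decomposeFin w), Equiv.Perm.decomposeFin_symm_apply_zero]
  rw [hw] at h2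
  rw [emb, rest, ← h2, Prod.mk.eta, h1]

lemma desc_simple_zero {n : ℕ} : ∀ p, (hp : p < n + 1) → desc (simple n) p 0 = ⟨p, hp⟩
  | 0, _ => by simp [desc]
  | p + 1, hp => by
    rw [desc, Equiv.Perm.mul_apply, desc_simple_zero p (by omega), simple, dif_pos (by omega)]
    simp

theorem exists_hom {M : Type*} [Monoid M] : ∀ (n : ℕ) (s : ℕ → M), Relations n s →
    ∃ φ : Equiv.Perm (Fin (n + 1)) →* M, ∀ i, i < n → φ (simple n i) = s i
  | 0, _, _ => ⟨1, fun i hi => by omega⟩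
  | n + 1, s, h => by
    obtain ⟨ψ, hψ⟩ := exists_hom n (fun i => s (i + 1))
      ⟨fun i hi => h.sq _ (by omega), fun i hi => h.braid _ (by omega),
        fun i j hij hj => h.comm _ _ (by omega) (by omega)⟩
    set t := simple (n + 1) with ht
    have hr : Relations (n + 1) t := simple_relations (n + 1)
    let F : Equiv.Perm (Fin (n + 2)) → M := fun w =>
      desc s (w 0) * ψ (rest ((desc t (w 0))⁻¹ * w))
    have hF : ∀ p, p < n + 2 → ∀ e, F (desc t p * emb e) = desc s p * ψ e := by
      intro p hp e
      have h0 : (desc t p * emb e) 0 = ⟨p, hp⟩ := by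
        rw [Equiv.Perm.mul_apply, emb_zero, desc_simple_zero p hp]
      simp only [F, h0]
      rw [inv_mul_cancel_left, rest_emb]
    have hdec : ∀ w : Equiv.Perm (Fin (n + 2)), ∃ p, p < n + 2 ∧ ∃ e, w = desc t p * emb e := by
      intro w
      refine ⟨w 0, (w 0).2, rest ((desc t (w 0))⁻¹ * w), ?_⟩
      rw [emb_rest, mul_inv_cancel_left]
      rw [Equiv.Perm.mul_apply, Equiv.Perm.inv_eq_iff_eq, desc_simple_zero _ (w 0).2]
    have hstep : ∀ i, i < n + 1 → ∀ w, F (t i * w) = s i * F w := by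
      intro i hi w
      obtain ⟨p, hp, e, rfl⟩ := hdec w
      rw [hF p hp e, ← mul_assoc, ← mul_assoc]
      rcases lt_trichotomy i p with hip | rfl | hip
      · rcases Nat.lt_or_ge (i + 1) p with h1 | h1
        · rw [mul_desc_lt hr p (by omega) h1, mul_desc_lt h p (by omega) h1, mul_assoc, mul_assoc,
            ht, ← emb_simple (by omega), ← emb_mul, ← ht, hF p hp, map_mul, hψ i (by omega)]
        · obtain rfl : p = i + 1 := by omega
          rw [mul_desc_pred hr hi, mul_desc_pred h hi, hF i (by omega)]
      · exact hF (i + 1) (by omega) e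
      · obtain ⟨j, rfl⟩ : ∃ j, i = j + 1 := ⟨i - 1, by omega⟩
        rw [mul_desc_gt hr hi p hip, mul_desc_gt h hi p hip, mul_assoc, mul_assoc,
            ht, ← emb_simple (by omega), ← emb_mul, ← ht, hF p hp, map_mul, hψ j (by omega)]
    have hone : F 1 = 1 := by
      have h1 := hF 0 (by omega) 1
      have h2 : emb (1 : Equiv.Perm (Fin (n + 1))) = 1 := by
        ext x
        refine Fin.cases ?_ (fun x => ?_) x <;> simp [emb_zero, emb_succ]
      simpa [desc, h2] using h1
    have hmul : ∀ v w, F (v * w) = F v * F w := by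
      intro v
      have hv : v ∈ Submonoid.closure
          (Set.range fun i : Fin (n + 1) => Equiv.swap i.castSucc i.succ) := by
        rw [Equiv.Perm.mclosure_swap_castSucc_succ]
        trivial
      induction hv using Submonoid.closure_induction with
      | mem x hx =>
        obtain ⟨i, rfl⟩ := hx
        have hti : Equiv.swap i.castSucc i.succ = t i := by
          rw [ht, simple, dif_pos i.2]
          rfl
        intro w
        have h1 := hstep i i.2 1
        rw [mul_one, hone, mul_one] at h1
        simp only [hti]
        rw [hstep i i.2, h1]
      | one => intro w; rw [one_mul, hone, one_mul]
      | mul x y _ _ hx hy => intro w; rw [mul_assoc x y w, hx (y * w), hy w, hx y, mul_assoc (F x)]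
    refine ⟨⟨⟨F, hone⟩, hmul⟩, fun i hi => ?_⟩
    have h1 := hstep i hi 1
    rw [mul_one, hone, mul_one] at h1
    exact h1

end CoxeterA

namespace DegCycHecke

variable {ℓ r : ℕ} [NeZero r] (ω : Fin ℓ → ℂ)

/-- The image of `s_i` in the cyclotomic quotient. -/
def s (i : Fin (r - 1)) : DegCycHecke r ω :=
  RingQuot.mkAlgHom ℂ (Rel r ω) (DegAffineHecke.s i)

/-- The image of `x_j` in the cyclotomic quotient. -/
def x (j : Fin r) : DegCycHecke r ω :=
  RingQuot.mkAlgHom ℂ (Rel r ω) (DegAffineHecke.x j)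

/-- The natural map from the free algebra. -/
def ofFree : FreeAlgebra ℂ (HeckeGen r) →ₐ[ℂ] DegCycHecke r ω :=
  (RingQuot.mkAlgHom ℂ (Rel r ω)).comp (RingQuot.mkAlgHom ℂ (DegAffineHecke.Rel r))

lemma ofFree_rel {a b : FreeAlgebra ℂ (HeckeGen r)} (h : DegAffineHecke.Rel r a b) :
    ofFree ω a = ofFree ω b :=
  congrArg (RingQuot.mkAlgHom ℂ (Rel r ω)) (RingQuot.mkAlgHom_rel ℂ h)

lemma ofFree_fs (i : Fin (r - 1)) : ofFree ω (DegAffineHecke.fs i) = s ω i := rfl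

/-- The inclusion of the symmetric group exists: this is the Coxeter presentation. -/
theorem exists_permHom : ∃ φ : RightPerm r →* DegCycHecke r ω,
    ∀ i : Fin (r - 1), φ (simpleTransposition i) = s ω i := by
  obtain ⟨n, rfl⟩ : ∃ n, r = n + 1 := ⟨r - 1, by have := NeZero.pos r; omega⟩
  let S : ℕ → DegCycHecke (n + 1) ω := fun i => if h : i < n then s ω ⟨i, h⟩ else 1
  have hS : CoxeterA.Relations n S := by
    constructor
    · intro i hi
      simp only [S, hi, dif_pos]
      simpa only [map_mul, map_one, ofFree_fs] using
        ofFree_rel ω (DegAffineHecke.Rel.s_sq (r := n + 1) ⟨i, hi⟩)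
    · intro i hi
      have h0 : i < n := by omega
      simp only [S, hi, h0, dif_pos]
      simpa only [map_mul, ofFree_fs] using
        ofFree_rel ω (DegAffineHecke.Rel.braid (r := n + 1) ⟨i, h0⟩ ⟨i + 1, hi⟩ rfl)
    · intro i j hij hj
      have h0 : i < n := by omega
      simp only [S, hj, h0, dif_pos]
      simpa only [map_mul, ofFree_fs] using
        ofFree_rel ω (DegAffineHecke.Rel.s_comm (r := n + 1) ⟨i, h0⟩ ⟨j, hj⟩ (Or.inl hij))
  obtain ⟨φ, hφ⟩ := CoxeterA.exists_hom n S hS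
  refine ⟨φ.comp (MulEquiv.inv' (Equiv.Perm (Fin (n + 1)))).symm.toMonoidHom, fun i => ?_⟩
  have hi : i.val < n := i.2
  have h1 := hφ i hi
  simp only [S, hi, dif_pos, CoxeterA.simple] at h1
  refine Eq.trans ?_ h1
  simp [simpleTransposition]

/-- The homomorphism from the symmetric group to the cyclotomic Hecke algebra which sends the
simple transposition `(i, i + 1)` to `s_i`; it is unique, as these generate the group. -/
def perm : RightPerm r →* DegCycHecke r ω := (exists_permHom ω).choose

lemma perm_simpleTransposition (i : Fin (r - 1)) : perm ω (simpleTransposition i) = s ω i :=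
  (exists_permHom ω).choose_spec i

/-- The product `(x_1 - u) ⋯ (x_a - u)`. -/
def piFactor (a : ℕ) (u : ℂ) : DegCycHecke r ω :=
  (((List.finRange r).filter fun k => k.val < a).map fun k =>
    x ω k - algebraMap ℂ (DegCycHecke r ω) u).prod

/-- `π_[λ]` formed with the parameters `u`: with `a_i = |λ⁽¹⁾| + ⋯ + |λ⁽ⁱ⁾|`, the product over
`i = 1, …, ℓ - 1` of `(x_1 - u_{i+1}) ⋯ (x_{a_i} - u_{i+1})`. In 0-based indexing `u_{i+1}` is `u i`,
and the factor for `i = 0` is empty because `a_0 = 0`. -/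
def piElt (u : Fin ℓ → ℂ) (lam : Multipartition ℓ r) : DegCycHecke r ω :=
  (List.ofFn fun i : Fin ℓ => piFactor ω (lam.size i) (u i)).prod

/-- `π̃_[λ]` formed with the parameters `u`: the product over `i = 1, …, ℓ - 1` of
`(x_1 - u_{ℓ-i}) ⋯ (x_{a_i} - u_{ℓ-i})`. In 0-based indexing `u_{ℓ-i}` is `u i.rev`. -/
def piTildeElt (u : Fin ℓ → ℂ) (lam : Multipartition ℓ r) : DegCycHecke r ω :=
  (List.ofFn fun i : Fin ℓ => piFactor ω (lam.size i) (u i.rev)).prod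

open Classical in
/-- The sum of the row stabilizer of the `i`-th subtableau of `t^λ`. -/
def xComp (lam : Multipartition ℓ r) (i : Fin ℓ) : DegCycHecke r ω :=
  ∑ w : Equiv.Perm (Fin r) with w ∈ lam.rowStabilizer i, perm ω (op w)

open Classical in
/-- The signed sum of the row stabilizer of the `i`-th subtableau of `t^λ`. -/
def yComp (lam : Multipartition ℓ r) (i : Fin ℓ) : DegCycHecke r ω :=
  ∑ w : Equiv.Perm (Fin r) with w ∈ lam.rowStabilizer i,
    ((Equiv.Perm.sign w : ℤ) : ℂ) • perm ω (op w)

/-- `x_λ^c`: the product over the components, symmetrizing where `c i = 0` and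
antisymmetrizing where `c i = 1`. -/
def xElt (c : Fin ℓ → Fin 2) (lam : Multipartition ℓ r) : DegCycHecke r ω :=
  (List.ofFn fun i : Fin ℓ => if c i = 0 then xComp ω lam i else yComp ω lam i).prod

/-- `y_λ^c`: the product over the components, antisymmetrizing where `c i = 0` and
symmetrizing where `c i = 1`. -/
def yElt (c : Fin ℓ → Fin 2) (lam : Multipartition ℓ r) : DegCycHecke r ω :=
  (List.ofFn fun i : Fin ℓ => if c i = 0 then yComp ω lam i else xComp ω lam i).prod

/-- `d(s)⁻¹ π_[λ] x_λ^c d(t)`, with the parameters `u` in `π_[λ]`. -/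
def mElt (u : Fin ℓ → ℂ) (c : Fin ℓ → Fin 2) (lam : Multipartition ℓ r) (s t : lam.Std) :
    DegCycHecke r ω :=
  perm ω s.d⁻¹ * (piElt ω u lam * xElt ω c lam) * perm ω t.d

/-- `d(s)⁻¹ π̃_[λ] y_λ^c d(t)`, with the parameters `u` in `π̃_[λ]`. -/
def nElt (u : Fin ℓ → ℂ) (c : Fin ℓ → Fin 2) (lam : Multipartition ℓ r) (s t : lam.Std) :
    DegCycHecke r ω :=
  perm ω s.d⁻¹ * (piTildeElt ω u lam * yElt ω c lam) * perm ω t.d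

/-- `m^c_{s,t}`. -/
def mC (c : Fin ℓ → Fin 2) (lam : Multipartition ℓ r) (s t : lam.Std) : DegCycHecke r ω :=
  mElt ω ω c lam s t

/-- `n^c_{s,t}`. -/
def nC (c : Fin ℓ → Fin 2) (lam : Multipartition ℓ r) (s t : lam.Std) : DegCycHecke r ω :=
  nElt ω ω c lam s t

/-- `m^ξ_{s,t}`: `m_{s,t}` formed with `ω_{(i)ξ}` in place of `ω_i`, in the same algebra. -/
def mXi (ξ : Equiv.Perm (Fin ℓ)) (lam : Multipartition ℓ r) (s t : lam.Std) : DegCycHecke r ω :=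
  mElt ω (fun i => ω (ξ i)) 0 lam s t

/-- `n^ξ_{s,t}`: `n_{s,t}` formed with `ω_{(i)ξ}` in place of `ω_i`, in the same algebra. -/
def nXi (ξ : Equiv.Perm (Fin ℓ)) (lam : Multipartition ℓ r) (s t : lam.Std) : DegCycHecke r ω :=
  nElt ω (fun i => ω (ξ i)) 0 lam s t

/-- `σ` is an anti-automorphism fixing `s_1, …, s_{r-1}` and `x_1`. -/
def FixesGenerators (σ : DegCycHecke r ω ≃ₐ[ℂ] (DegCycHecke r ω)ᵐᵒᵖ) : Prop :=
  (∀ i : Fin (r - 1), σ (s ω i) = op (s ω i)) ∧ σ (x ω 0) = op (x ω 0)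

/-- The family `C` is a cellular basis indexed by pairs of standard tableaux. The multiplication
rule holds modulo strictly more dominant shapes, so the poset of cells is the set of
multipartitions with the opposite of the dominance order. -/
def IsTableauCellularBasis
    (C : ∀ lam : Multipartition ℓ r, lam.Std → lam.Std → DegCycHecke r ω)
    (σ : DegCycHecke r ω ≃ₐ[ℂ] (DegCycHecke r ω)ᵐᵒᵖ) : Prop :=
  IsCellularBasis ℂ (Λ := (Multipartition ℓ r)ᵒᵈ)
    (fun lam => (OrderDual.ofDual lam).Std) (fun lam => C (OrderDual.ofDual lam)) σ

end DegCycHecke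

end

/-! All four families are instances of one family $d(s)^{-1}\pi_{[\lambda]}(u)\,x^c_\lambda\,d(t)$
with $u=\omega\circ\xi$: replacing $x$ by $y$ complements $c$, and $\tilde\pi$ is $\pi$ with its
parameters in reverse order (`nElt_eq`). The order of the parameters is harmless because the
cyclotomic relation is symmetric in $\omega$ (`cyclotomic_perm`). Symmetrizers and antisymmetrizers
are treated together by letting a permutation $w$ act as a sign times $w$, the sign being taken on
the components where $c\ne 0$ (`tw`); then $x^c_\lambda$ is one sum over the whole row stabilizer
(`xElt_eq_stabSum`).

Spanning and the multiplication rule. Put $m_\lambda=\pi_{[\lambda]}x^c_\lambda$ and let $I_\lambda$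
be the two-sided ideal generated by the $m_\mu$ with $\mu\triangleright\lambda$ (`higher`). The core
is that modulo $I_\lambda$ the right ideal $m_\lambda\mathscr H$ is spanned by the $m_\lambda d(t)$
with $t$ standard (`mBase_mul_mem`). For $m_\lambda w$ this is straightening (`mBase_mul_pm_mem`):
rows are sorted at the cost of a sign, and a descent in a column is removed by a Garnir relation. By
inclusion–exclusion a Garnir sum is a combination of sums that factor through stabilizers of
strictly more dominant row structures, so it vanishes modulo $I_\lambda$. For $m_\lambda x_k$,
Jucys–Murphy elements replace $x_k$ by $x_a$, with $a$ the first entry of a component; then $x_a-u$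
either completes the cyclotomic polynomial, which is zero, or turns $\pi_{[\lambda]}$ into
$\pi_{[\mu]}$, where $\mu$ arises by moving $a$ to the preceding component
(`xElt_mul_pm_mul_piElt_mem`).

The relations are invariant under reversing products, so the anti-involution exists, and it carries
the statement to left ideals. Induction from the dominant shapes downwards then puts every
$am_\lambda b$ into the span of the elements of shape $\trianglerighteq\lambda$
(`mul_mBase_mul_mem`). Since 1 has the form $am_\mu b$ for a suitable $\mu$, the family spans.

Independence is a count: the number of pairs of standard tableaux of equal shape is at most $\ell^r
r!$, and the dimension is at least $\ell^r r!$. The first bound holds because on $\ell$-partitions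
the operators of adding and removing a box have commutator $\ell$ (`sum_addable_sum_removable`,
`card_std_sq_le`). For the second, the algebra acts on functions on words whose letters carry a
level in $\{0,\dots,\ell-1\}$ and a label. There the conjugates $y_i$ of $x_1$ satisfy
$[y_i,y_j]=(i\,j)(y_i-y_j)$ (`y_commutator`), and the submodule generated by one word of top level
contains $\ell^r r!$ independent vectors (`pow_mul_factorial_le_finrank`). -/

/-! ### Sums over stabilizers of labellings -/

section StabSum

set_option linter.unusedSectionVars false

open Equiv

variable {α β γ A : Type*} [Fintype α] [DecidableEq α] [Ring A] [Algebra ℂ A]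

/-- The permutation `w` preserves the labelling `L`. -/
def Preserves (L : α → β) (w : Perm α) : Prop := ∀ k, L (w k) = L k

/-- `ρ` turns products of `κ`-preserving permutations into products in the opposite order,
that is, it is multiplicative for permutations acting on the right. -/
structure IsRightHomOn (κ : α → γ) (ρ : Perm α → A) : Prop where
  one : ρ 1 = 1
  mul : ∀ v w : Perm α, Preserves κ v → Preserves κ w → ρ v * ρ w = ρ (w * v)

open Classical in
/-- The sum of `ρ w` over all permutations `w` that preserve the labelling `L`. -/
noncomputable def stabSum (ρ : Perm α → A) (L : α → β) : A :=
  ∑ w : Perm α with Preserves L w, ρ w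

lemma Preserves.inv {L : α → β} {w : Perm α} (h : Preserves L w) : Preserves L w⁻¹ := by
  intro k
  have := h (w⁻¹ k)
  simpa using this.symm

lemma Preserves.mul {L : α → β} {v w : Perm α} (h : Preserves L v) (h' : Preserves L w) :
    Preserves L (v * w) := by
  intro k
  rw [Perm.mul_apply, h, h']

lemma Preserves.one {L : α → β} : Preserves L 1 := fun _ => rfl

/-- Since $\rho$ reverses products, right multiplication by $\rho(h)$ is left translation of the
index by $h$, which permutes the summands. -/
lemma IsRightHomOn.sum_mul {κ : α → γ} {ρ : Perm α → A} (hρ : IsRightHomOn κ ρ)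
    {q : Perm α → Prop} [DecidablePred q] (hq : ∀ g, q g → Preserves κ g) {h : Perm α} (hh : Preserves κ h)
    (hinv : ∀ g, q (h * g) ↔ q g) :
    (∑ g : Perm α with q g, ρ g) * ρ h = ∑ g : Perm α with q g, ρ g := by
  rw [Finset.sum_mul]
  refine Finset.sum_bij' (fun g _ => h * g) (fun g _ => h⁻¹ * g) ?_ ?_ ?_ ?_ ?_
  · intro g hg
    simpa [hinv] using hg
  · intro g hg
    have := hinv (h⁻¹ * g)
    rw [mul_inv_cancel_left] at this
    simpa [← this] using hg
  · intro g _; simp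
  · intro g _; simp
  · intro g hg
    exact hρ.mul _ _ (hq g (by simpa using hg)) hh

lemma IsRightHomOn.mul_sum {κ : α → γ} {ρ : Perm α → A} (hρ : IsRightHomOn κ ρ)
    {q : Perm α → Prop} [DecidablePred q] (hq : ∀ g, q g → Preserves κ g) {h : Perm α} (hh : Preserves κ h)
    (hinv : ∀ g, q (g * h) ↔ q g) :
    ρ h * (∑ g : Perm α with q g, ρ g) = ∑ g : Perm α with q g, ρ g := by
  rw [Finset.mul_sum]
  refine Finset.sum_bij' (fun g _ => g * h) (fun g _ => g * h⁻¹) ?_ ?_ ?_ ?_ ?_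
  · intro g hg
    simpa [hinv] using hg
  · intro g hg
    have := hinv (g * h⁻¹)
    rw [inv_mul_cancel_right] at this
    simpa [← this] using hg
  · intro g _; simp
  · intro g _; simp
  · intro g hg
    exact hρ.mul _ _ hh (hq g (by simpa using hg))

lemma IsRightHomOn.stabSum_mul {κ : α → γ} {ρ : Perm α → A} (hρ : IsRightHomOn κ ρ)
    {L : α → β} (hL : ∀ g : Perm α, Preserves L g → Preserves κ g) {h : Perm α} (hh : Preserves L h) :
    stabSum ρ L * ρ h = stabSum ρ L := by
  classical
  refine hρ.sum_mul hL (hL h hh) fun g => ⟨fun e => ?_, fun e => Preserves.mul hh e⟩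
  have := Preserves.mul (hh.inv) e
  rwa [inv_mul_cancel_left] at this

open Classical in
/-- The number of permutations preserving a labelling. -/
noncomputable def stabCard (L : α → β) : ℕ :=
  Finset.card {w : Perm α | Preserves L w}

lemma stabCard_ne_zero (L : α → β) : (stabCard L : ℂ) ≠ 0 := by
  classical
  rw [Nat.cast_ne_zero, stabCard, Finset.card_ne_zero]
  exact ⟨1, by simpa using Preserves.one⟩

/-- It is used in divided form: as the stabilizer order is invertible in ℂ, an invariant sum lies in
the left ideal generated by `stabSum ρ L`. -/
lemma IsRightHomOn.sum_mul_stabSum {κ : α → γ} {ρ : Perm α → A} (hρ : IsRightHomOn κ ρ)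
    {q : Perm α → Prop} [DecidablePred q] (hq : ∀ g, q g → Preserves κ g) {L : α → β}
    (hL : ∀ g : Perm α, Preserves L g → Preserves κ g)
    (hinv : ∀ h : Perm α, Preserves L h → ∀ g, q g → q (h * g)) :
    (∑ g : Perm α with q g, ρ g) * stabSum ρ L =
      (stabCard L : ℂ) • ∑ g : Perm α with q g, ρ g := by
  rw [stabSum, Finset.mul_sum]
  rw [Finset.sum_congr rfl (g := fun _ => ∑ g : Perm α with q g, ρ g)]
  · rw [Finset.sum_const, stabCard, ← Nat.cast_smul_eq_nsmul ℂ]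
  · intro h hh
    have hh : Preserves L h := by simpa using hh
    refine hρ.sum_mul hq (hL h hh) fun g => ⟨fun e => ?_, hinv h hh g⟩
    have := hinv _ (hh.inv) _ e
    rwa [inv_mul_cancel_left] at this

lemma IsRightHomOn.stabSum_mul_sum {κ : α → γ} {ρ : Perm α → A} (hρ : IsRightHomOn κ ρ)
    {q : Perm α → Prop} [DecidablePred q] (hq : ∀ g, q g → Preserves κ g) {L : α → β}
    (hL : ∀ g : Perm α, Preserves L g → Preserves κ g)
    (hinv : ∀ h : Perm α, Preserves L h → ∀ g, q g → q (g * h)) :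
    stabSum ρ L * (∑ g : Perm α with q g, ρ g) =
      (stabCard L : ℂ) • ∑ g : Perm α with q g, ρ g := by
  rw [stabSum, Finset.sum_mul]
  rw [Finset.sum_congr rfl (g := fun _ => ∑ g : Perm α with q g, ρ g)]
  · rw [Finset.sum_const, stabCard, ← Nat.cast_smul_eq_nsmul ℂ]
  · intro h hh
    have hh : Preserves L h := by simpa using hh
    refine hρ.mul_sum hq (hL h hh) fun g => ⟨fun e => ?_, hinv h hh g⟩
    have := hinv _ (hh.inv) _ e
    rwa [mul_inv_cancel_right] at this

/-- The stabilizer of `L ∘ v` is the conjugate $v^{-1}\,\mathrm{Stab}(L)\,v$, and $\rho$ reverses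
the order of the factors. -/
lemma IsRightHomOn.stabSum_comp {κ : α → γ} {ρ : Perm α → A} (hρ : IsRightHomOn κ ρ)
    {L : α → β} (hL : ∀ g : Perm α, Preserves L g → Preserves κ g) {v : Perm α} (hv : Preserves κ v) :
    stabSum ρ (L ∘ v) = ρ v * stabSum ρ L * ρ v⁻¹ := by
  classical
  rw [stabSum, stabSum, Finset.mul_sum, Finset.sum_mul]
  symm
  refine Finset.sum_bij' (fun g _ => v⁻¹ * g * v) (fun g _ => v * g * v⁻¹) ?_ ?_ ?_ ?_ ?_
  · intro g hg
    simp only [Finset.mem_filter, Finset.mem_univ, true_and] at hg ⊢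
    intro k
    simpa using hg (v k)
  · intro g hg
    simp only [Finset.mem_filter, Finset.mem_univ, true_and] at hg ⊢
    intro k
    simpa using hg (v⁻¹ k)
  · intro g _; group
  · intro g _; group
  · intro g hg
    have hg := hL g (by simpa using hg)
    rw [hρ.mul _ _ hv hg, hρ.mul _ _ (Preserves.mul hg hv) (hv.inv), mul_assoc]

/-- The labelling in which the labels `P` and `Q` are both replaced by `P`. -/
noncomputable def mergeLabel [DecidableEq β] (L : α → β) (P Q : β) : α → β :=
  fun k => if L k = Q then P else L k

/-- The labelling in which the set of points labelled `P` or `Q` is divided anew, into `D` and its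
complement. -/
noncomputable def splitLabel [DecidableEq β] (L : α → β) (P Q : β) (D : Finset α) : α → β :=
  fun k => if k ∈ D then Q else mergeLabel L P Q k

/-! ### Garnir sums and inclusion–exclusion. -/

section Garnir

variable [DecidableEq β] {L : α → β} {P Q : β} {κ : α → γ} {ρ : Perm α → A}

lemma mergeLabel_ne (hPQ : P ≠ Q) (k : α) : mergeLabel L P Q k ≠ Q := by
  unfold mergeLabel
  split_ifs with h
  · exact hPQ
  · exact h

lemma splitLabel_eq_iff (hPQ : P ≠ Q) {D : Finset α} {k : α} :
    splitLabel L P Q D k = Q ↔ k ∈ D := by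
  unfold splitLabel
  split_ifs with h
  · simp [h]
  · simp [h, mergeLabel_ne hPQ]

/-- The merged label is a function of the split label: `D` lies in the merged block, so reading `Q`
as `P` recovers it. -/
lemma mergeLabel_comp_of_splitLabel (hPQ : P ≠ Q) {D : Finset α}
    (hD : ∀ k ∈ D, mergeLabel L P Q k = P) {h : Perm α}
    (hh : Preserves (splitLabel L P Q D) h) :
    Preserves (mergeLabel L P Q) h := by
  have key : ∀ k, mergeLabel L P Q k =
      if splitLabel L P Q D k = Q then P else splitLabel L P Q D k := by
    intro k
    rw [if_congr (splitLabel_eq_iff hPQ) rfl rfl]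
    by_cases hk : k ∈ D
    · simp [hk, hD]
    · simp [hk, splitLabel]
  intro k
  rw [key, key k, hh]

lemma mergeLabel_comp (h : Perm α) (hh : Preserves L h) :
    Preserves (mergeLabel L P Q) h := by
  intro k
  simp [mergeLabel, hh k]

open Classical in
/-- The sum over all redistributions for which the points in `D` get label `Q`. -/
noncomputable def redistSum (ρ : Perm α → A) (L : α → β) (P Q : β) (D : Finset α) : A :=
  ∑ g : Perm α with Preserves (mergeLabel L P Q) g ∧ ∀ k ∈ D, L (g⁻¹ k) = Q, ρ g

/-- The stabilizer of the split labelling maps `D` to itself and keeps the merged blocks, so left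
translation by it respects both conditions on `g`. Hence `redistSum` factors through the stabilizer
sum of a different pair of rows. -/
lemma redistSum_mul_stabSum (hPQ : P ≠ Q) (hρ : IsRightHomOn κ ρ)
    (hκ : ∀ g : Perm α, Preserves (mergeLabel L P Q) g → Preserves κ g)
    {D : Finset α} (hD : ∀ k ∈ D, mergeLabel L P Q k = P) :
    redistSum ρ L P Q D * stabSum ρ (splitLabel L P Q D) =
      (stabCard (splitLabel L P Q D) : ℂ) • redistSum ρ L P Q D := by
  classical
  refine hρ.sum_mul_stabSum
    (q := fun g => Preserves (mergeLabel L P Q) g ∧ ∀ k ∈ D, L (g⁻¹ k) = Q)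
    (fun g hg => hκ g hg.1)
    (fun g hg => hκ g (mergeLabel_comp_of_splitLabel hPQ hD hg)) fun h hh g hg => ⟨?_, ?_⟩
  · exact Preserves.mul (mergeLabel_comp_of_splitLabel hPQ hD hh) hg.1
  · intro k hk
    rw [mul_inv_rev, Perm.mul_apply]
    apply hg.2
    rw [← splitLabel_eq_iff (L := L) hPQ, hh.inv, splitLabel_eq_iff hPQ]
    exact hk

open Classical in
/-- The Garnir sum of all redistributions that keep the labels of the points in `F`. -/
noncomputable def garnirSum (ρ : Perm α → A) (L : α → β) (P Q : β) (F : Finset α) : A :=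
  ∑ g : Perm α with Preserves (mergeLabel L P Q) g ∧ ∀ k ∈ F, (L (g⁻¹ k) = Q ↔ L k = Q), ρ g

/-- Inclusion–exclusion: the condition that a point of `F` outside row `Q` stays outside is traded
for signed conditions that the points of a subset `D` enter row `Q`. Every resulting set of
prescribed `Q`-points is contained in `F`, which is what makes it small. -/
lemma garnirSum_eq_sum_redistSum (F : Finset α) :
    garnirSum ρ L P Q F =
      ∑ D ∈ (F.filter fun k => L k ≠ Q).powerset,
        ((-1 : ℂ) ^ D.card) • redistSum ρ L P Q ((F.filter fun k => L k = Q) ∪ D) := by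
  classical
  rw [garnirSum]
  simp only [redistSum, Finset.sum_filter, Finset.smul_sum]
  rw [Finset.sum_comm]
  refine Finset.sum_congr rfl fun g _ => ?_
  by_cases hM : Preserves (mergeLabel L P Q) g
  swap
  · simp [hM]
  by_cases hB : ∀ k ∈ F, L k = Q → L (g⁻¹ k) = Q
  swap
  · rw [if_neg (fun h => hB fun k hk hkQ => (h.2 k hk).2 hkQ), Finset.sum_eq_zero]
    intro D _
    rw [if_neg, smul_zero]
    exact fun h => hB fun k hk hkQ => h.2 k (by simp [hk, hkQ])
  have hset : ∀ D ∈ (F.filter fun k => L k ≠ Q).powerset,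
      ((-1 : ℂ) ^ D.card • if Preserves (mergeLabel L P Q) g ∧
        ∀ k ∈ (F.filter fun k => L k = Q) ∪ D, L (g⁻¹ k) = Q then ρ g else 0) =
      if D ⊆ F.filter (fun k => L k ≠ Q ∧ L (g⁻¹ k) = Q) then (-1 : ℂ) ^ D.card • ρ g else 0 := by
    intro D hD
    rw [Finset.mem_powerset] at hD
    have : (Preserves (mergeLabel L P Q) g ∧
        ∀ k ∈ (F.filter fun k => L k = Q) ∪ D, L (g⁻¹ k) = Q) ↔
        D ⊆ F.filter (fun k => L k ≠ Q ∧ L (g⁻¹ k) = Q) := by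
      constructor
      · intro h k hk
        have := hD hk
        simp only [Finset.mem_filter] at this ⊢
        exact ⟨this.1, this.2, h.2 k (by simp [hk])⟩
      · refine fun h => ⟨hM, fun k hk => ?_⟩
        rcases Finset.mem_union.1 hk with hk | hk
        · simp only [Finset.mem_filter] at hk
          exact hB k hk.1 hk.2
        · exact (Finset.mem_filter.1 (h hk)).2.2
    rw [smul_ite, smul_zero, if_congr this rfl rfl]
  rw [Finset.sum_congr rfl hset, ← Finset.sum_filter]
  have hfil : ((F.filter fun k => L k ≠ Q).powerset.filter
      fun D => D ⊆ F.filter (fun k => L k ≠ Q ∧ L (g⁻¹ k) = Q)) =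
      (F.filter (fun k => L k ≠ Q ∧ L (g⁻¹ k) = Q)).powerset := by
    ext D
    simp only [Finset.mem_filter, Finset.mem_powerset, and_iff_right_iff_imp]
    refine fun h => h.trans fun k hk => ?_
    simp only [Finset.mem_filter] at hk ⊢
    exact ⟨hk.1, hk.2.1⟩
  rw [hfil, ← Finset.sum_smul]
  have hsum : ∑ D ∈ (F.filter (fun k => L k ≠ Q ∧ L (g⁻¹ k) = Q)).powerset, (-1 : ℂ) ^ D.card =
      if F.filter (fun k => L k ≠ Q ∧ L (g⁻¹ k) = Q) = ∅ then 1 else 0 := by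
    have := Finset.sum_powerset_neg_one_pow_card
      (x := F.filter (fun k => L k ≠ Q ∧ L (g⁻¹ k) = Q))
    exact_mod_cast congrArg (Int.cast : ℤ → ℂ) this
  rw [hsum]
  have hiff : (Preserves (mergeLabel L P Q) g ∧ ∀ k ∈ F, (L (g⁻¹ k) = Q ↔ L k = Q)) ↔
      F.filter (fun k => L k ≠ Q ∧ L (g⁻¹ k) = Q) = ∅ := by
    rw [Finset.filter_eq_empty_iff]
    constructor
    · rintro ⟨-, h⟩ k hk ⟨h1, h2⟩
      exact h1 ((h k hk).1 h2)
    · refine fun h => ⟨hM, fun k hk => ⟨fun h2 => ?_, hB k hk⟩⟩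
      by_contra h1
      exact h hk ⟨h1, h2⟩
  rw [if_congr hiff rfl rfl, ite_smul, one_smul, zero_smul]

/-- For `h` preserving `L`, the labellings $L\circ(gh)^{-1}$ and $L\circ g^{-1}$ coincide, so right
translation by `h` respects the Garnir condition. -/
lemma stabSum_mul_garnirSum (hρ : IsRightHomOn κ ρ)
    (hκ : ∀ g : Perm α, Preserves (mergeLabel L P Q) g → Preserves κ g) (F : Finset α) :
    stabSum ρ L * garnirSum ρ L P Q F = (stabCard L : ℂ) • garnirSum ρ L P Q F := by
  classical
  refine hρ.stabSum_mul_sum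
    (q := fun g => Preserves (mergeLabel L P Q) g ∧ ∀ k ∈ F, (L (g⁻¹ k) = Q ↔ L k = Q))
    (fun g hg => hκ g hg.1) (fun g hg => hκ g (mergeLabel_comp g hg))
    fun h hh g hg => ⟨hg.1.mul (mergeLabel_comp h hh), fun k hk => ?_⟩
  rw [mul_inv_rev, Perm.mul_apply, hh.inv]
  exact hg.2 k hk

end Garnir

end StabSum

/-! ### Labelling positions by rows of a multipartition -/

namespace Multipartition

variable {ℓ r : ℕ}

/-- The component and the row that contain the number `k` in the initial tableau. -/
def label (lam : Multipartition ℓ r) (k : Fin r) : Fin ℓ × ℕ :=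
  ((lam.initialTableau.symm k).comp, (lam.initialTableau.symm k).row)

@[simp] lemma label_initialTableau (lam : Multipartition ℓ r) (b : Box lam) :
    lam.label (lam.initialTableau b) = (b.comp, b.row) := by simp [label]

lemma Box.lt_iff {lam : Multipartition ℓ r} {b b' : Box lam} :
    b < b' ↔ b.comp < b'.comp ∨ b.comp = b'.comp ∧
      (b.row < b'.row ∨ b.row = b'.row ∧ b.col < b'.col) := by
  have : b < b' ↔ b.key < b'.key := Iff.rfl
  rw [this, Box.key, Box.key, Prod.Lex.toLex_lt_toLex, Prod.Lex.toLex_lt_toLex]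

lemma initialTableau_lt_iff (lam : Multipartition ℓ r) {b b' : Box lam} :
    lam.initialTableau b < lam.initialTableau b' ↔ b < b' :=
  (Fintype.orderIsoFinOfCardEq (Box lam) lam.card_box).symm.lt_iff_lt

lemma label_fst_mono (lam : Multipartition ℓ r) : Monotone fun k => (lam.label k).1 := by
  intro k k' h
  obtain ⟨b, rfl⟩ := lam.initialTableau.surjective k
  obtain ⟨b', rfl⟩ := lam.initialTableau.surjective k'
  simp only [label_initialTableau]
  by_contra hlt
  have : b' < b := Box.lt_iff.2 (Or.inl (not_le.1 hlt))
  exact absurd h (not_le.2 (lam.initialTableau_lt_iff.2 this))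

lemma card_label_eq (lam : Multipartition ℓ r) (s : Fin ℓ) (i : ℕ) :
    Finset.card {k | lam.label k = (s, i)} = (lam.comp s).rowLen i := by
  have hb : ∀ j, j < (lam.comp s).rowLen i → (i, j) ∈ lam.comp s :=
    fun j hj => YoungDiagram.mem_iff_lt_rowLen.2 hj
  rw [← Finset.card_fin ((lam.comp s).rowLen i)]
  symm
  refine Finset.card_bij (fun j _ => lam.initialTableau ⟨s, i, j, hb j j.2⟩) ?_ ?_ ?_
  · intro j _; simp
  · intro j _ j' _ h
    have := lam.initialTableau.injective h
    simpa [Fin.ext_iff] using this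
  · intro k hk
    obtain ⟨⟨s', i', j, hm⟩, rfl⟩ := lam.initialTableau.surjective k
    simp only [Finset.mem_filter, Finset.mem_univ, label_initialTableau, true_and,
      Prod.mk.injEq] at hk
    obtain ⟨rfl, rfl⟩ := hk
    exact ⟨⟨j, YoungDiagram.mem_iff_lt_rowLen.1 hm⟩, Finset.mem_univ _, rfl⟩

lemma card_label_fst_eq (lam : Multipartition ℓ r) (s : Fin ℓ) :
    Finset.card {k | (lam.label k).1 = s} = (lam.comp s).card := by
  rw [YoungDiagram.card]
  symm
  refine Finset.card_bij (fun c hc => lam.initialTableau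
    ⟨s, c.1, c.2, (YoungDiagram.mem_cells _).1 hc⟩) ?_ ?_ ?_
  · intro c hc; simp
  · intro c hc c' hc' h
    have := lam.initialTableau.injective h
    simp only [Box.mk.injEq, true_and] at this
    exact Prod.ext this.1 this.2
  · intro k hk
    obtain ⟨⟨s', i', j, hm⟩, rfl⟩ := lam.initialTableau.surjective k
    simp only [Finset.mem_filter, Finset.mem_univ, label_initialTableau, true_and] at hk
    subst hk
    exact ⟨(i', j), (YoungDiagram.mem_cells _).2 hm, rfl⟩

lemma card_label_fst_lt (lam : Multipartition ℓ r) (i : ℕ) :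
    Finset.card {k | (lam.label k).1.val < i} = lam.size i := by
  rw [size, Finset.card_eq_sum_card_fiberwise (f := fun k => (lam.label k).1)
    (t := {t : Fin ℓ | t.val < i}) (fun k hk => by simpa using hk)]
  refine Finset.sum_congr rfl fun t ht => ?_
  rw [← card_label_fst_eq]
  congr 1
  ext k
  simp only [Finset.mem_filter, Finset.mem_univ, true_and, and_iff_right_iff_imp] at ht ⊢
  rintro rfl
  exact ht

end Multipartition

lemma Fin.iff_lt_card_of_isLowerSet {r : ℕ} (q : Fin r → Prop) [DecidablePred q]
    (hq : ∀ k k' : Fin r, k ≤ k' → q k' → q k) (k : Fin r) :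
    q k ↔ k.val < Finset.card {k | q k} := by
  constructor
  · intro h
    have : Finset.Iic k ⊆ ({k | q k} : Finset (Fin r)) := by
      intro k' hk'
      simpa using hq k' k (by simpa using hk') h
    have := Finset.card_le_card this
    rw [Fin.card_Iic] at this
    omega
  · intro h
    by_contra hk
    have : ({k | q k} : Finset (Fin r)) ⊆ Finset.Iio k := by
      intro k' hk'
      simp only [Finset.mem_filter, Finset.mem_univ, true_and] at hk'
      rw [Finset.mem_Iio]
      by_contra hle
      exact hk (hq k k' (not_lt.1 hle) hk')
    have := Finset.card_le_card this
    rw [Fin.card_Iio] at this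
    omega

namespace Multipartition

variable {ℓ r : ℕ}

/-- The initial tableau fills the components in order, so the first `i` components occupy an initial
segment. This identifies the range of the factors of `piElt` with a condition on labels. -/
lemma label_fst_lt_iff (lam : Multipartition ℓ r) (k : Fin r) (i : ℕ) :
    (lam.label k).1.val < i ↔ k.val < lam.size i := by
  rw [← card_label_fst_lt]
  exact Fin.iff_lt_card_of_isLowerSet (fun k => (lam.label k).1.val < i)
    (fun k k' h h' => lt_of_le_of_lt (lam.label_fst_mono h) h') k

/-- The number of points whose label lies in a component before `s` or in one of the first `n` rows
of the component `s`. -/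
def labelCount (L : Fin r → Fin ℓ × ℕ) (s : Fin ℓ) (n : ℕ) : ℕ :=
  Finset.card {k | (L k).1 < s ∨ (L k).1 = s ∧ (L k).2 < n}

lemma labelCount_eq (L : Fin r → Fin ℓ × ℕ) (s : Fin ℓ) (n : ℕ) :
    labelCount L s n = Finset.card {k | (L k).1.val < s.val} +
      ∑ j ∈ Finset.range n, Finset.card {k | L k = (s, j)} := by
  have h1 : ∑ j ∈ Finset.range n, Finset.card {k | L k = (s, j)} =
      Finset.card {k | (L k).1 = s ∧ (L k).2 < n} := by
    rw [Finset.card_eq_sum_card_fiberwise (f := fun k => (L k).2) (t := Finset.range n)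
      (fun k hk => by simpa using (Finset.mem_filter.1 hk).2.2)]
    refine Finset.sum_congr rfl fun j hj => ?_
    congr 1
    ext k
    simp only [Finset.mem_filter, Finset.mem_univ, true_and, Prod.ext_iff]
    rw [Finset.mem_range] at hj
    constructor
    · rintro ⟨h, h'⟩; exact ⟨⟨h, h' ▸ hj⟩, h'⟩
    · rintro ⟨⟨h, -⟩, h'⟩; exact ⟨h, h'⟩
  rw [h1, labelCount, Finset.filter_or, Finset.card_union_of_disjoint]
  · rfl
  · rw [Finset.disjoint_left]
    intro k hk hk'
    simp only [Finset.mem_filter, Finset.mem_univ, true_and] at hk hk'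
    exact absurd hk'.1 hk.ne

/-- Dominance becomes a statement about counting labels, which makes sense also for labellings whose
rows are not sorted by length. -/
lemma labelCount_label (lam : Multipartition ℓ r) (s : Fin ℓ) (n : ℕ) :
    labelCount lam.label s n = lam.partialSum s n := by
  rw [labelCount_eq, partialSum, card_label_fst_lt]
  simp only [card_label_eq]

lemma labelCount_comp (L : Fin r → Fin ℓ × ℕ) (v : Equiv.Perm (Fin r)) (s : Fin ℓ) (n : ℕ) :
    labelCount (L ∘ v) s n = labelCount L s n := by
  refine Finset.card_bij (fun k _ => v k) ?_ (fun _ _ _ _ h => v.injective h) ?_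
  · intro k hk; simpa using hk
  · intro k hk
    exact ⟨v.symm k, by simpa using hk, by simp⟩

lemma exists_of_antitone (L : Fin r → Fin ℓ × ℕ) (hL : Monotone fun k => (L k).1)
    (hanti : ∀ s i, Finset.card {k | L k = (s, i + 1)} ≤ Finset.card {k | L k = (s, i)}) :
    ∃ (mu : Multipartition ℓ r) (v : Equiv.Perm (Fin r)),
      (∀ k, mu.label (v k) = L k) ∧ (∀ k, (mu.label k).1 = (L k).1) := by
  set n : Fin ℓ → ℕ → ℕ := fun s i => Finset.card {k | L k = (s, i)} with hn
  have hanti' : ∀ s, Antitone (n s) := fun s => antitone_nat_of_succ_le (hanti s)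
  -- One more than the sum of all row indices: a crude bound beyond which all rows are empty.
  set B : ℕ := ∑ k, (L k).2 + 1 with hB
  have hrow : ∀ s i, 0 < n s i → i < B := by
    intro s i h
    obtain ⟨k, hk⟩ := Finset.card_pos.1 h
    simp only [Finset.mem_filter, Finset.mem_univ, true_and] at hk
    have := Finset.single_le_sum (f := fun k => (L k).2) (fun _ _ => Nat.zero_le _)
      (Finset.mem_univ k)
    simp only [hk] at this
    omega
  have hle : ∀ s i, n s i ≤ r := fun s i => (Finset.card_le_univ _).trans (by simp)
  let comp : Fin ℓ → YoungDiagram := fun s =>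
    ⟨((Finset.range B) ×ˢ (Finset.range r)).filter fun c => c.2 < n s c.1, by
      rintro ⟨i, j⟩ ⟨i', j'⟩ ⟨h1, h2⟩ h
      simp only [Finset.coe_filter, Finset.mem_product, Finset.mem_range, Set.mem_ofPred_eq] at h ⊢
      simp only at h1 h2
      have := hanti' s h1
      refine ⟨⟨by omega, by omega⟩, by omega⟩⟩
  have hmem : ∀ s i j, (i, j) ∈ comp s ↔ j < n s i := by
    intro s i j
    rw [← YoungDiagram.mem_cells]
    simp only [comp, Finset.mem_filter, Finset.mem_product, Finset.mem_range,
      and_iff_right_iff_imp]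
    intro h
    have h1 := hrow s i (by omega)
    have h2 := hle s i
    omega
  have hlen : ∀ s i, (comp s).rowLen i = n s i := by
    intro s i
    have h : ∀ j, j < (comp s).rowLen i ↔ j < n s i := fun j => by
      rw [← YoungDiagram.mem_iff_lt_rowLen, hmem]
    have h1 := h (n s i)
    have h2 := h ((comp s).rowLen i)
    omega
  have hcard : ∀ s, (comp s).card = Finset.card {k | (L k).1 = s} := by
    intro s
    rw [YoungDiagram.card, Finset.card_eq_sum_card_fiberwise (f := Prod.fst)
        (t := Finset.range B) (fun c hc => by
          have := (Finset.mem_filter.1 hc).1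
          exact Finset.mem_coe.2 (Finset.mem_product.1 this).1),
      Finset.card_eq_sum_card_fiberwise (s := {k | (L k).1 = s}) (f := fun k => (L k).2)
        (t := Finset.range B) (fun k hk => by
          simp only [Finset.coe_filter, Finset.mem_univ, true_and, Set.mem_ofPred_eq] at hk
          refine Finset.mem_coe.2 (Finset.mem_range.2 (hrow s _ (Finset.card_pos.2 ⟨k, ?_⟩)))
          simp [← hk])]
    refine Finset.sum_congr rfl fun i hi => ?_
    have h1 : Finset.filter (fun c : ℕ × ℕ => c.1 = i) (comp s).cells =
        (comp s).row i := rfl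
    rw [h1, ← YoungDiagram.rowLen_eq_card, hlen]
    simp only [hn]
    congr 1
    ext k
    simp [Prod.ext_iff]
  let mu : Multipartition ℓ r := ⟨comp, by
    simp only [hcard]
    rw [← Finset.card_eq_sum_card_fiberwise (fun _ _ => Finset.mem_coe.2 (Finset.mem_univ _))]
    simp⟩
  have hfib : ∀ p : Fin ℓ × ℕ, Nonempty ({k // L k = p} ≃ {k // mu.label k = p}) := by
    rintro ⟨s, i⟩
    rw [← Fintype.card_eq, Fintype.card_subtype, Fintype.card_subtype, mu.card_label_eq]
    exact (hlen s i).symm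
  refine ⟨mu, Equiv.ofFiberEquiv fun p => (hfib p).some, fun k => Equiv.ofFiberEquiv_map _ k, ?_⟩
  intro k
  -- Both component functions are monotone with fibres of equal size, so they cut out the same
  -- initial segments.
  have key : ∀ i, (mu.label k).1.val < i ↔ (L k).1.val < i := by
    intro i
    rw [label_fst_lt_iff, Fin.iff_lt_card_of_isLowerSet (fun k => (L k).1.val < i)
      (fun k k' h h' => lt_of_le_of_lt (hL h) h')]
    have : mu.size i = Finset.card {k | (L k).1.val < i} := by
      rw [size, Finset.card_eq_sum_card_fiberwise (f := fun k => (L k).1)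
        (t := {t : Fin ℓ | t.val < i}) (fun k hk => by simpa using hk)]
      refine Finset.sum_congr rfl fun t ht => ?_
      change (comp t).card = _
      rw [hcard]
      congr 1
      ext k
      simp only [Finset.mem_filter, Finset.mem_univ, true_and] at ht ⊢
      constructor
      · rintro rfl; exact ⟨ht, rfl⟩
      · exact fun h => h.2
    rw [this]
  apply Fin.ext
  have h1 := key (mu.label k).1.val
  have h2 := key (L k).1.val
  omega

/-- Every labelling is, up to a permutation, the labelling by the rows of a multipartition, and this
multipartition is at least as dominant as the (unsorted) labelling. -/
theorem exists_shape (L : Fin r → Fin ℓ × ℕ) (hL : Monotone fun k => (L k).1) :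
    ∃ (mu : Multipartition ℓ r) (v : Equiv.Perm (Fin r)),
      (∀ k, (mu.label k).1 = (L k).1) ∧ (∀ k, (mu.label (v k)).1 = (L k).1) ∧
      (∀ k k', L k = L k' ↔ mu.label (v k) = mu.label (v k')) ∧
      ∀ s n, labelCount L s n ≤ mu.partialSum s n := by
  induction hN : ∑ k, (L k).2 using Nat.strong_induction_on generalizing L with
  | _ N ih =>
  by_cases hanti : ∀ s i, Finset.card {k | L k = (s, i + 1)} ≤ Finset.card {k | L k = (s, i)}
  · obtain ⟨mu, v, h1, h2⟩ := exists_of_antitone L hL hanti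
    refine ⟨mu, v, h2, fun k => by rw [h1], fun k k' => by rw [h1, h1], fun s n => ?_⟩
    rw [← labelCount_label, ← labelCount_comp mu.label v]
    exact le_of_eq (congrArg (labelCount · s n) (funext fun k => (h1 k).symm))
  push Not at hanti
  obtain ⟨s, i, hlt⟩ := hanti
  -- Row `i + 1` is longer than row `i`, so the two row names are exchanged. The partition into rows
  -- does not change.
  set e : Equiv.Perm (Fin ℓ × ℕ) := Equiv.swap (s, i) (s, i + 1) with he
  have hfst : ∀ p, (e p).1 = p.1 := by
    intro p
    rw [he, Equiv.swap_apply_def]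
    split_ifs with h h <;> simp [h]
  have hsnd : ∀ p, (e p).2 + (if p = (s, i + 1) then 1 else 0) =
      p.2 + (if p = (s, i) then 1 else 0) := by
    intro p
    rw [he, Equiv.swap_apply_def]
    split_ifs with h h' h' <;> simp_all
  -- The longer row receives the smaller index, so the sum of the row indices drops; this is the
  -- induction parameter.
  have hsum : ∑ k, (e (L k)).2 < N := by
    have := Finset.sum_congr rfl fun k (_ : k ∈ Finset.univ) => hsnd (L k)
    rw [Finset.sum_add_distrib, Finset.sum_add_distrib, ← Finset.card_filter,
      ← Finset.card_filter] at this
    omega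
  obtain ⟨mu, v, h1, h2, h3, h4⟩ := ih _ hsum (fun k => e (L k))
    (fun k k' h => by simpa only [hfst] using hL h) rfl
  refine ⟨mu, v, fun k => by rw [h1, hfst], fun k => by rw [h2, hfst],
    fun k k' => by rw [← h3, e.injective.eq_iff], fun s' n => le_trans ?_ (h4 s' n)⟩
  -- Exchanging the two rows affects a partial count only when it stops exactly between them, at `s'
  -- = s` and `n = i + 1`; there row `i` is replaced by the longer row `i + 1`.
  have hpt : ∀ k, (if (L k).1 < s' ∨ (L k).1 = s' ∧ (L k).2 < n then 1 else 0) +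
      (if L k = (s, i + 1) then (if s' = s ∧ n = i + 1 then 1 else 0) else 0) =
      (if (e (L k)).1 < s' ∨ (e (L k)).1 = s' ∧ (e (L k)).2 < n then 1 else 0) +
      (if L k = (s, i) then (if s' = s ∧ n = i + 1 then 1 else 0) else 0) := by
    intro k
    generalize L k = p
    obtain ⟨a, b⟩ := p
    rw [he, Equiv.swap_apply_def]
    by_cases h : (a, b) = (s, i)
    · simp only [h, if_true]
      simp only [Prod.mk.injEq] at h
      obtain ⟨rfl, rfl⟩ := h
      by_cases hs : s' = a
      · subst hs
        by_cases hn : n = b + 1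
        · simp [hn]
        · simp [hn]
          split_ifs <;> omega
      · have hs' : ¬ a = s' := fun h => hs h.symm
        simp [hs, hs']
    by_cases h' : (a, b) = (s, i + 1)
    · simp only [h', if_true]
      simp only [Prod.mk.injEq] at h'
      obtain ⟨rfl, rfl⟩ := h'
      by_cases hs : s' = a
      · subst hs
        by_cases hn : n = i + 1
        · simp [hn]
        · simp [hn]
          split_ifs <;> omega
      · have hs' : ¬ a = s' := fun h => hs h.symm
        simp [hs, hs']
    · simp only [h, h', if_false]
  generalize (if s' = s ∧ n = i + 1 then 1 else 0) = c at hpt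
  have := Finset.sum_congr rfl fun k (_ : k ∈ Finset.univ) => hpt k
  rw [Finset.sum_add_distrib, Finset.sum_add_distrib, ← Finset.card_filter,
    ← Finset.card_filter, ← Finset.sum_filter, ← Finset.sum_filter, Finset.sum_const,
    Finset.sum_const, smul_eq_mul, smul_eq_mul] at this
  have hc := Nat.mul_le_mul_right c hlt.le
  unfold labelCount
  beta_reduce
  omega

end Multipartition

/-! ### Permutations preserving a labelling -/

lemma Finite.induction_on_gt {α : Type*} [Finite α] (M : α → ℤ) {p : α → Prop}
    (h : ∀ a, (∀ b, M a < M b → p b) → p a) (a : α) : p a := by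
  have hwf : WellFounded fun b a : α => M a < M b := by
    have : IsTrans α fun b a : α => M a < M b := ⟨fun _ _ _ h h' => h'.trans h⟩
    have : Std.Irrefl fun b a : α => M a < M b := ⟨fun _ h => lt_irrefl _ h⟩
    exact Finite.wellFounded_of_trans_of_irrefl _
  exact hwf.induction a h

namespace Equiv.Perm

variable {r : ℕ}

/-- Only the terms at `i` and `j` change. With `f` increasing, undoing an inversion of `w` increases
the sum; this measure drives the sorting arguments below. -/
lemma sum_mul_swap (f : Fin r → ℤ) (w : Perm (Fin r)) {i j : Fin r} (hij : i ≠ j) :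
    ∑ k, f k * ((w * swap i j) k : ℕ) =
      ∑ k, f k * (w k : ℕ) + (f j - f i) * ((w i : ℕ) - (w j : ℕ)) := by
  have h1 : ∑ k, f k * ((w * swap i j) k : ℕ) = ∑ k, f (swap i j k) * (w k : ℕ) := by
    rw [← Equiv.sum_comp (swap i j)]
    simp
  rw [h1, ← sub_eq_iff_eq_add', ← Finset.sum_sub_distrib,
    Finset.sum_eq_add (a := i) (b := j) hij ?_ (by simp) (by simp)]
  · simp only [swap_apply_left, swap_apply_right]
    ring
  · rintro k - ⟨h, h'⟩
    rw [swap_apply_of_ne_of_ne h h', sub_self]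

/-- The simple transposition `(i, i + 1)`. -/
def adj (i : Fin (r - 1)) : Perm (Fin r) := swap ⟨i, by omega⟩ ⟨i + 1, by omega⟩

lemma adj_mul_self (i : Fin (r - 1)) : adj i * adj i = 1 := by simp [adj]

lemma adj_inv (i : Fin (r - 1)) : (adj i)⁻¹ = adj i := by simp [adj]

lemma eq_one_of_forall_adj_lt (w : Perm (Fin r))
    (h : ∀ i : Fin (r - 1), w ⟨i, by omega⟩ < w ⟨i + 1, by omega⟩) : w = 1 := by
  have hmono : StrictMono w := by
    cases r with
    | zero => exact fun a => a.elim0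
    | succ n =>
      rw [Fin.strictMono_iff_lt_succ]
      exact fun i => h i
  have h2 : hmono.orderIsoOfSurjective w w.surjective = OrderIso.refl (Fin r) :=
    Subsingleton.elim _ _
  exact Equiv.ext fun k => congrArg (fun e : Fin r ≃o Fin r => e k) h2

/-- A permutation preserving a monotone labelling is a product of simple transpositions that preserve
it. -/
lemma induction_on_preserves {γ : Type*} [PartialOrder γ] {κ : Fin r → γ} (hκ : Monotone κ)
    {p : Perm (Fin r) → Prop} (h1 : p 1)
    (hs : ∀ (i : Fin (r - 1)) (w : Perm (Fin r)), κ ⟨i, by omega⟩ = κ ⟨i + 1, by omega⟩ →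
      Preserves κ w → p w → p (w * adj i)) (w : Perm (Fin r)) (hw : Preserves κ w) : p w := by
  revert hw
  refine Finite.induction_on_gt
    (fun w : Perm (Fin r) => ∑ k : Fin r, ((k : ℕ) : ℤ) * ((w k : ℕ) : ℤ))
    (p := fun w => Preserves κ w → p w) (fun w ih hw => ?_) w
  by_cases h : ∀ i : Fin (r - 1), w ⟨i, by omega⟩ < w ⟨i + 1, by omega⟩
  · rw [eq_one_of_forall_adj_lt w h]
    exact h1
  push Not at h
  obtain ⟨i, hi⟩ := h
  have hne : (⟨i, by omega⟩ : Fin r) ≠ ⟨i + 1, by omega⟩ := by simp [Fin.ext_iff]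
  have hlt : w ⟨i + 1, by omega⟩ < w ⟨i, by omega⟩ :=
    lt_of_le_of_ne hi fun e => hne (w.injective e).symm
  -- A descent cannot straddle two blocks: `w` preserves the blocks and these are intervals in
  -- increasing order.
  have hκi : κ ⟨i, by omega⟩ = κ ⟨i + 1, by omega⟩ := by
    refine le_antisymm (hκ (by simp [Fin.le_def])) ?_
    rw [← hw ⟨i, _⟩, ← hw ⟨i + 1, _⟩]
    exact hκ hi
  have hadj : Preserves κ (adj i) := by
    intro k
    rw [adj, swap_apply_def]
    split_ifs with e e
    · rw [e, hκi]
    · rw [e, hκi]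
    · rfl
  have := hs i (w * adj i) hκi (hw.mul hadj) (ih _ ?_ (hw.mul hadj))
  · rwa [mul_assoc, adj_mul_self, mul_one] at this
  · rw [adj, sum_mul_swap (fun k : Fin r => ((k : ℕ) : ℤ)) w hne]
    have : (0 : ℤ) < (w ⟨i, by omega⟩ : ℕ) - (w ⟨i + 1, by omega⟩ : ℕ) := by
      have := Fin.lt_def.1 hlt
      omega
    simpa using this

lemma induction_on_adj {p : Perm (Fin r) → Prop} (h1 : p 1)
    (hs : ∀ (i : Fin (r - 1)) (w : Perm (Fin r)), p w → p (w * adj i)) (w : Perm (Fin r)) : p w :=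
  induction_on_preserves (κ := fun _ => (0 : ℕ)) monotone_const h1 (fun i w _ _ h => hs i w h) w
    fun _ => rfl

/-! ### Signs of permutations on a union of blocks. -/

section Restrict

set_option linter.unusedSectionVars false

variable {α : Type*} [Fintype α] [DecidableEq α]

open Classical in
/-- The permutation that agrees with `w` on the `w`-stable set `p` and fixes all other points
(the identity if `p` is not stable). -/
noncomputable def restrict (p : α → Prop) (w : Perm α) : Perm α :=
  if h : Preserves p w then ofSubtype (w.subtypePerm (p := p) fun k => (h k).to_iff) else 1

open Classical in
lemma restrict_apply {p : α → Prop} {w : Perm α} (h : Preserves p w) (k : α) :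
    restrict p w k = if p k then w k else k := by
  rw [restrict, dif_pos h]
  split_ifs with hk
  · rw [ofSubtype_apply_of_mem _ hk]
    rfl
  · exact ofSubtype_apply_of_not_mem _ hk

lemma restrict_mul {p : α → Prop} {v w : Perm α} (hv : Preserves p v) (hw : Preserves p w) :
    restrict p (v * w) = restrict p v * restrict p w := by
  ext k
  rw [restrict_apply (hv.mul hw), mul_apply, mul_apply, restrict_apply hw]
  by_cases hk : p k
  · rw [if_pos hk, if_pos hk, restrict_apply hv, if_pos ((hw k).symm ▸ hk)]
  · rw [if_neg hk, if_neg hk, restrict_apply hv, if_neg hk]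

lemma restrict_one (p : α → Prop) : restrict p (1 : Perm α) = 1 := by
  ext k
  rw [restrict_apply Preserves.one]
  split_ifs <;> rfl

/-- The sign of the restriction of `w` to the stable set `p`, as a complex number. -/
noncomputable def blockSign (p : α → Prop) (w : Perm α) : ℂ := ((sign (restrict p w) : ℤ) : ℂ)

lemma blockSign_mul {p : α → Prop} {v w : Perm α} (hv : Preserves p v) (hw : Preserves p w) :
    blockSign p (v * w) = blockSign p v * blockSign p w := by
  simp [blockSign, restrict_mul hv hw]

lemma blockSign_one (p : α → Prop) : blockSign p (1 : Perm α) = 1 := by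
  simp [blockSign, restrict_one]

lemma blockSign_mul_self (p : α → Prop) (w : Perm α) : blockSign p w * blockSign p w = 1 := by
  rw [blockSign, ← Int.cast_mul, ← Units.val_mul, Int.units_mul_self]
  simp

lemma blockSign_ne_zero (p : α → Prop) (w : Perm α) : blockSign p w ≠ 0 :=
  fun h => by simpa [h] using blockSign_mul_self p w

lemma blockSign_inv {p : α → Prop} {w : Perm α} (hw : Preserves p w) :
    blockSign p w⁻¹ = blockSign p w := by
  have h1 : blockSign p w * blockSign p w⁻¹ = 1 := by
    rw [← blockSign_mul hw hw.inv, mul_inv_cancel, blockSign_one]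
  exact mul_left_cancel₀ (blockSign_ne_zero p w) (h1.trans (blockSign_mul_self p w).symm)

end Restrict

end Equiv.Perm

section

/-! ### Algebras satisfying the relations of the degenerate cyclotomic Hecke algebra -/

open Equiv Equiv.Perm

/-- Elements `x k` and `pm w` of an algebra `A` that generate it and satisfy the relations of the
degenerate cyclotomic Hecke algebra; `pm` is multiplicative for permutations acting on the right. -/
structure CycHeckeData {ℓ r : ℕ} [NeZero r] (ω : Fin ℓ → ℂ) (A : Type*) [Ring A] [Algebra ℂ A] where
  x : Fin r → A
  pm : Perm (Fin r) → A
  pm_one : pm 1 = 1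
  pm_mul : ∀ v w, pm v * pm w = pm (w * v)
  x_comm : ∀ i j, x i * x j = x j * x i
  adj_x_comm : ∀ (i : Fin (r - 1)) (j : Fin r), j.val ≠ i.val → j.val ≠ i.val + 1 →
    pm (adj i) * x j = x j * pm (adj i)
  adj_mul_x : ∀ i : Fin (r - 1),
    pm (adj i) * x ⟨i, by omega⟩ = x ⟨i + 1, by omega⟩ * pm (adj i) - 1
  cyclotomic : (List.ofFn fun i : Fin ℓ => x 0 - algebraMap ℂ A (ω i)).prod = 0
  generate : ∀ S : Subalgebra ℂ A, (∀ w, pm w ∈ S) → (∀ k, x k ∈ S) → S = ⊤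

namespace CycHeckeData

variable {ℓ r : ℕ} [NeZero r] {ω : Fin ℓ → ℂ} {A : Type*} [Ring A] [Algebra ℂ A]
  (D : CycHeckeData (r := r) ω A)

/-- The image of the simple transposition `(i, i + 1)`. -/
def s (i : Fin (r - 1)) : A := D.pm (adj i)

lemma pm_mul_adj (i : Fin (r - 1)) (w : Perm (Fin r)) : D.pm (w * adj i) = D.s i * D.pm w := by
  rw [s, pm_mul]

lemma pm_mul_pm_inv (w : Perm (Fin r)) : D.pm w * D.pm w⁻¹ = 1 := by simp [pm_mul, pm_one]

lemma pm_inv_mul_pm (w : Perm (Fin r)) : D.pm w⁻¹ * D.pm w = 1 := by simp [pm_mul, pm_one]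

lemma s_mul_self (i : Fin (r - 1)) : D.s i * D.s i = 1 := by
  rw [s, pm_mul, adj_mul_self, pm_one]

lemma s_mul_x (i : Fin (r - 1)) :
    D.s i * D.x ⟨i, by omega⟩ = D.x ⟨i + 1, by omega⟩ * D.s i - 1 := D.adj_mul_x i

lemma x_succ (i : Fin (r - 1)) :
    D.x ⟨i + 1, by omega⟩ = D.s i * D.x ⟨i, by omega⟩ * D.s i + D.s i := by
  rw [s_mul_x, sub_mul, mul_assoc, s_mul_self, mul_one, one_mul, sub_add_cancel]

lemma s_mul_x_succ (i : Fin (r - 1)) :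
    D.s i * D.x ⟨i + 1, by omega⟩ = D.x ⟨i, by omega⟩ * D.s i + 1 := by
  rw [x_succ, mul_add, ← mul_assoc, ← mul_assoc, s_mul_self, one_mul]

lemma x_mem_of_subalgebra (S : Subalgebra ℂ A) (hs : ∀ i, D.s i ∈ S)
    (hx : D.x 0 ∈ S) (k : Fin r) : D.x k ∈ S := by
  obtain ⟨k, hk⟩ := k
  induction k with
  | zero => exact hx
  | succ k ih =>
    have h := D.x_succ (⟨k, by omega⟩ : Fin (r - 1))
    simp only at h
    rw [h]
    exact S.add_mem (S.mul_mem (S.mul_mem (hs _) (ih _)) (hs _)) (hs _)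

lemma eq_top_of_generators_mem (S : Subalgebra ℂ A) (hs : ∀ i, D.s i ∈ S)
    (hx : D.x 0 ∈ S) : S = ⊤ := by
  refine D.generate S (fun w => ?_) (D.x_mem_of_subalgebra S hs hx)
  induction w using induction_on_adj with
  | h1 => rw [pm_one]; exact S.one_mem
  | hs i w ih => rw [pm_mul_adj]; exact S.mul_mem (hs i) ih

/-- A subspace that is stable under right multiplication by the generators is a right ideal. -/
lemma mul_mem_of_generators (N : Submodule ℂ A)
    (hs : ∀ a ∈ N, ∀ i, a * D.s i ∈ N) (hx : ∀ a ∈ N, a * D.x 0 ∈ N)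
    {a : A} (ha : a ∈ N) (b : A) : a * b ∈ N := by
  let S : Subalgebra ℂ A :=
    { carrier := {b | ∀ a ∈ N, a * b ∈ N}
      mul_mem' := fun {b c} hb hc a ha => by rw [← mul_assoc]; exact hc _ (hb _ ha)
      add_mem' := fun {b c} hb hc a ha => by rw [mul_add]; exact N.add_mem (hb _ ha) (hc _ ha)
      algebraMap_mem' := fun c a ha => by
        rw [← Algebra.commutes, ← Algebra.smul_def]; exact N.smul_mem c ha }
  have hS : S = ⊤ := D.eq_top_of_generators_mem S (fun i a ha => hs a ha i) hx
  have : b ∈ S := hS ▸ Algebra.mem_top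
  exact this a ha

lemma x_sub_comm (j j' : Fin r) (a b : ℂ) :
    Commute (D.x j - algebraMap ℂ A a) (D.x j' - algebraMap ℂ A b) :=
  Commute.sub_left (Commute.sub_right (show Commute _ _ from D.x_comm j j')
    (Algebra.commutes b _).symm) (Algebra.commutes a _)

/-! #### Anti-homomorphisms fixing the generators -/

section Anti

lemma involutive_of_fixes (σ : A →ₐ[ℂ] Aᵐᵒᵖ) (hs : ∀ i, σ (D.s i) = op (D.s i))
    (hx : σ (D.x 0) = op (D.x 0)) (a : A) : unop (σ (unop (σ a))) = a := by
  let S : Subalgebra ℂ A :=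
    { carrier := {a | unop (σ (unop (σ a))) = a}
      mul_mem' := fun {b c} hb hc => by
        simp only [Set.mem_ofPred_eq, map_mul, unop_mul] at *
        rw [hb, hc]
      add_mem' := fun {b c} hb hc => by
        simp only [Set.mem_ofPred_eq, map_add, unop_add] at *
        rw [hb, hc]
      algebraMap_mem' := fun c => by
        simp [MulOpposite.algebraMap_apply] }
  have hS : S = ⊤ := by
    refine D.eq_top_of_generators_mem S (fun i => ?_) ?_
    · change unop (σ (unop (σ (D.s i)))) = D.s i
      simp [hs]
    · change unop (σ (unop (σ (D.x 0)))) = D.x 0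
      simp [hx]
  have : a ∈ S := hS ▸ Algebra.mem_top
  exact this

lemma ext_of_generators {σ τ : A →ₐ[ℂ] Aᵐᵒᵖ} (hs : ∀ i, σ (D.s i) = τ (D.s i))
    (hx : σ (D.x 0) = τ (D.x 0)) : σ = τ := by
  have h : AlgHom.equalizer σ τ = ⊤ := D.eq_top_of_generators_mem _ hs hx
  refine AlgHom.ext fun a => ?_
  have : a ∈ AlgHom.equalizer σ τ := h ▸ Algebra.mem_top
  exact this

/-- An anti-involution that fixes the generators. -/
structure IsAnti (σ : A →ₐ[ℂ] Aᵐᵒᵖ) : Prop where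
  s : ∀ i, σ (D.s i) = op (D.s i)
  x_zero : σ (D.x 0) = op (D.x 0)

variable {D} {σ : A →ₐ[ℂ] Aᵐᵒᵖ}

lemma IsAnti.involutive (hσ : D.IsAnti σ) (a : A) : unop (σ (unop (σ a))) = a :=
  D.involutive_of_fixes σ hσ.s hσ.x_zero a

lemma IsAnti.pm (hσ : D.IsAnti σ) (w : Perm (Fin r)) : unop (σ (D.pm w)) = D.pm w⁻¹ := by
  induction w using induction_on_adj with
  | h1 => simp [pm_one]
  | hs i w ih =>
    rw [pm_mul_adj, map_mul, unop_mul, ih, hσ.s, unop_op, mul_inv_rev, adj_inv, CycHeckeData.s,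
      pm_mul]

lemma IsAnti.x (hσ : D.IsAnti σ) (k : Fin r) : unop (σ (D.x k)) = D.x k := by
  obtain ⟨k, hk⟩ := k
  induction k with
  | zero => exact congrArg unop hσ.x_zero
  | succ k ih =>
    have h := D.x_succ (⟨k, by omega⟩ : Fin (r - 1))
    simp only at h
    rw [h, map_add, unop_add, map_mul, map_mul, unop_mul, unop_mul, ih, hσ.s, unop_op, mul_assoc]

end Anti

/-- Products of commuting elements may be permuted. -/
lemma prod_ofFn_perm {n : ℕ} {M : Type*} [Monoid M] (f g : Fin n → M) (ξ : Perm (Fin n))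
    (hfg : ∀ i, g i = f (ξ i)) (h : ∀ i j, Commute (f i) (f j)) :
    (List.ofFn g).prod = (List.ofFn f).prod := by
  have hg : g = f ∘ ξ := funext hfg
  subst hg
  refine List.Perm.prod_eq' (Equiv.Perm.ofFn_comp_perm ξ f) ?_
  rw [List.pairwise_ofFn]
  exact fun i j _ => h _ _

/-- The factors commute, so the cyclotomic relation is symmetric in the parameters. This is why `π`
may be formed with permuted parameters in the same algebra. -/
lemma cyclotomic_perm (ξ : Perm (Fin ℓ)) :
    (List.ofFn fun i : Fin ℓ => D.x 0 - algebraMap ℂ A (ω (ξ i))).prod = 0 := by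
  rw [← D.cyclotomic]
  exact prod_ofFn_perm _ _ ξ (fun _ => rfl) fun _ _ => D.x_sub_comm _ _ _ _

/-! #### Jucys–Murphy elements -/

lemma pm_x_zero_comm {w : Perm (Fin r)} (hw : w 0 = 0) : Commute (D.pm w) (D.x 0) := by
  have hpres : Preserves (fun k : Fin r => k ≠ 0) w := by
    intro k
    simp only [eq_iff_iff, not_iff_not]
    rw [← hw, w.injective.eq_iff, hw]
  -- With `False ≤ True` in `Prop`, this labelling is monotone with blocks `{0}` and its complement;
  -- the simple transpositions preserving it do not move 0.
  refine induction_on_preserves (κ := fun k : Fin r => k ≠ 0)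
    (p := fun w => Commute (D.pm w) (D.x 0)) ?_ ?_ ?_ w hpres
  · intro a b hab ha hb
    exact ha (le_antisymm (hb ▸ hab) (Fin.zero_le _))
  · rw [pm_one]; exact Commute.one_left _
  · intro i w hi _ h
    rw [pm_mul_adj]
    refine Commute.mul_left ?_ h
    have hi0 : i.val ≠ 0 := by
      intro h0
      simp [Fin.ext_iff, h0] at hi
    exact D.adj_x_comm i 0 (by simpa using hi0.symm) (by simp)

/-- Two permutations with the same preimage of 0 differ by one that fixes 0, and the latter commutes
with `x 0`. -/
lemma pm_conj_x_zero {v w : Perm (Fin r)} (h : v⁻¹ 0 = w⁻¹ 0) :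
    D.pm v * D.x 0 * D.pm v⁻¹ = D.pm w * D.x 0 * D.pm w⁻¹ := by
  have h1 : (w * v⁻¹) 0 = 0 := by rw [Perm.mul_apply, h]; simp
  have h2 := (D.pm_x_zero_comm h1).eq
  have h3 : D.pm w = D.pm v * D.pm (w * v⁻¹) := by rw [pm_mul]; simp
  have h4 : D.pm w⁻¹ = D.pm (w * v⁻¹)⁻¹ * D.pm v⁻¹ := by rw [pm_mul]; simp
  rw [h3, h4]
  have h5 := D.pm_mul_pm_inv (w * v⁻¹)
  calc _ = D.pm v * D.x 0 * (D.pm (w * v⁻¹) * D.pm (w * v⁻¹)⁻¹) * D.pm v⁻¹ := by rw [h5, mul_one]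
    _ = D.pm v * (D.x 0 * D.pm (w * v⁻¹)) * D.pm (w * v⁻¹)⁻¹ * D.pm v⁻¹ := by
        simp only [mul_assoc]
    _ = _ := by rw [← h2]; simp only [mul_assoc]

/-- `x k` is a conjugate of `x 0` plus a Jucys–Murphy element. -/
lemma x_eq_conj_add (k : Fin r) (w : Perm (Fin r)) (hw : w⁻¹ 0 = k) :
    D.x k = D.pm w * D.x 0 * D.pm w⁻¹ + ∑ j with j < k, D.pm (swap j k) := by
  obtain ⟨k, hk⟩ := k
  induction k generalizing w with
  | zero =>
    have h0 : w⁻¹ 0 = (1 : Perm (Fin r))⁻¹ 0 := hw.trans rfl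
    rw [D.pm_conj_x_zero h0, Finset.sum_eq_zero]
    · simp only [inv_one, D.pm_one, one_mul, mul_one, add_zero]
      rfl
    · intro j hj
      simp at hj
  | succ k ih =>
    have hk' : k < r := by omega
    have h := D.x_succ (⟨k, by omega⟩ : Fin (r - 1))
    simp only at h
    set i : Fin (r - 1) := ⟨k, by omega⟩ with hi
    have hv : (w * adj i)⁻¹ 0 = ⟨k, hk'⟩ := by
      rw [mul_inv_rev, adj_inv, Perm.mul_apply, hw, adj]
      simp [hi]
    rw [h, ih (w * adj i) hk' hv, mul_add, add_mul, pm_mul_adj, mul_inv_rev, adj_inv,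
      ← pm_mul, add_assoc]
    congr 1
    · have := D.s_mul_self i
      calc _ = (D.s i * D.s i) * D.pm w * D.x 0 * D.pm w⁻¹ * (D.s i * D.s i) := by
            simp only [mul_assoc, s, hi]
        _ = _ := by rw [this, one_mul, mul_one]
    -- Conjugation by the simple transposition turns `swap j k` into `swap j (k + 1)`, and the extra
    -- summand in `x_succ` is the missing `swap k (k + 1)`.
    · have hset : (Finset.univ.filter fun j : Fin r => j < ⟨k + 1, hk⟩) =
          insert ⟨k, hk'⟩ (Finset.univ.filter fun j : Fin r => j < ⟨k, hk'⟩) := by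
        ext j
        simp only [Finset.mem_filter, Finset.mem_univ, true_and, Finset.mem_insert, Fin.lt_def,
          Fin.ext_iff]
        omega
      rw [hset, Finset.sum_insert (by simp), add_comm, Finset.mul_sum, Finset.sum_mul]
      congr 1
      refine Finset.sum_congr rfl fun j hj => ?_
      simp only [Finset.mem_filter, Finset.mem_univ, true_and, Fin.lt_def] at hj
      rw [s, pm_mul, pm_mul]
      congr 1
      have h1 := Equiv.swap_apply_apply (adj i) j ⟨k, hk'⟩
      rw [adj_inv, mul_assoc] at h1
      rw [← h1, adj, swap_apply_left, swap_apply_of_ne_of_ne]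
      · simp only [ne_eq, Fin.ext_iff, hi]; omega
      · simp only [ne_eq, Fin.ext_iff, hi]; omega

end CycHeckeData

/-! ### Products of lists with commuting factors. -/

section ListProd

variable {M : Type*} [Monoid M]

lemma List.prod_ofFn_mul_of_commute {n : ℕ} (f g : Fin n → M) (z : M) (j : Fin n)
    (hz : ∀ i, Commute (f i) z) (hj : g j = f j * z) (hg : ∀ i, i ≠ j → g i = f i) :
    (List.ofFn f).prod * z = (List.ofFn g).prod := by
  induction n with
  | zero => exact j.elim0
  | succ n ih =>
    rw [List.ofFn_succ, List.ofFn_succ, List.prod_cons, List.prod_cons, mul_assoc]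
    refine Fin.cases (fun hj hg => ?_) (fun j hj hg => ?_) j hj hg
    · rw [hj, mul_assoc]
      congr 1
      have h1 : Commute ((List.ofFn fun i : Fin n => f i.succ).prod) z := by
        refine Commute.list_prod_left _ _ fun a ha => ?_
        obtain ⟨i, rfl⟩ := (List.mem_ofFn' _ _).1 ha
        exact hz _
      rw [h1.eq]
      congr 3
      funext i
      exact (hg _ (Fin.succ_ne_zero i)).symm
    · rw [hg 0 (Fin.succ_ne_zero j).symm]
      congr 1
      exact ih _ _ j (fun i => hz _) hj fun i hi => hg _ fun e => hi (Fin.succ_injective _ e)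

lemma List.prod_ofFn_mul_distrib {n : ℕ} (g p q : Fin n → M) (hg : ∀ i, g i = p i * q i)
    (hc : ∀ i j, Commute (q i) (p j)) :
    (List.ofFn g).prod = (List.ofFn p).prod * (List.ofFn q).prod := by
  induction n with
  | zero => simp
  | succ n ih =>
    rw [List.ofFn_succ, List.ofFn_succ, List.ofFn_succ, List.prod_cons, List.prod_cons,
      List.prod_cons, hg, ih _ _ _ (fun i => hg i.succ) fun i j => hc i.succ j.succ]
    have h1 : Commute (q 0) ((List.ofFn fun i : Fin n => p i.succ).prod) := by
      refine Commute.list_prod_right _ _ fun a ha => ?_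
      obtain ⟨i, rfl⟩ := (List.mem_ofFn' _ _).1 ha
      exact hc _ _
    simp only [mul_assoc]
    rw [← mul_assoc (q 0), h1.eq, mul_assoc]

end ListProd

/-! ### The elements $\pi_{[\lambda]}$ and the permutations commuting with them. -/

namespace CycHeckeData

variable {ℓ r : ℕ} [NeZero r] {ω : Fin ℓ → ℂ} {A : Type*} [Ring A] [Algebra ℂ A]
  (D : CycHeckeData (r := r) ω A)

/-- The product `(x_1 - u) ⋯ (x_a - u)`. -/
noncomputable def piFactor (a : ℕ) (u : ℂ) : A :=
  (((List.finRange r).filter fun k => k.val < a).map fun k =>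
    D.x k - algebraMap ℂ A u).prod

/-- The element `π_[λ]`. -/
noncomputable def piElt (u : Fin ℓ → ℂ) (lam : Multipartition ℓ r) : A :=
  (List.ofFn fun i : Fin ℓ => D.piFactor (lam.size i) (u i)).prod

lemma piFactor_zero (u : ℂ) : D.piFactor 0 u = 1 := by simp [piFactor]

lemma piFactor_succ {a : ℕ} (ha : a < r) (u : ℂ) :
    D.piFactor (a + 1) u = D.piFactor a u * (D.x ⟨a, ha⟩ - algebraMap ℂ A u) := by
  have hperm : ((List.finRange r).filter fun k => k.val < a + 1).Perm
      (((List.finRange r).filter fun k => k.val < a) ++ [⟨a, ha⟩]) := by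
    rw [List.perm_ext_iff_of_nodup ((List.nodup_finRange r).filter _)]
    · intro k
      simp only [List.mem_filter, List.mem_finRange, decide_eq_true_eq, true_and, List.mem_append,
        List.mem_singleton, Fin.ext_iff]
      omega
    · rw [List.nodup_append']
      refine ⟨(List.nodup_finRange r).filter _, List.nodup_singleton _, ?_⟩
      intro k hk hk'
      simp only [List.mem_filter, List.mem_finRange, decide_eq_true_eq, true_and,
        List.mem_singleton] at hk hk'
      simp [hk'] at hk
  rw [piFactor, piFactor, (hperm.map _).prod_eq', List.map_append, List.prod_append]
  · simp
  · rw [List.pairwise_map]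
    exact List.pairwise_of_forall fun _ _ => D.x_sub_comm _ _ _ _

lemma piFactor_succ_of_le {a : ℕ} (ha : r ≤ a) (u : ℂ) :
    D.piFactor (a + 1) u = D.piFactor a u := by
  rw [piFactor, piFactor]
  congr 2
  refine List.filter_congr fun k _ => ?_
  have := k.2
  simp only [decide_eq_decide]
  omega

lemma piFactor_x_comm (a : ℕ) (u : ℂ) (k : Fin r) (v : ℂ) :
    Commute (D.piFactor a u) (D.x k - algebraMap ℂ A v) := by
  refine Commute.list_prod_left _ _ fun y hy => ?_
  obtain ⟨k', -, rfl⟩ := List.mem_map.1 hy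
  exact D.x_sub_comm _ _ _ _

lemma piFactor_comm (a : ℕ) (u : ℂ) (b : ℕ) (v : ℂ) :
    Commute (D.piFactor a u) (D.piFactor b v) := by
  refine Commute.list_prod_right _ _ fun y hy => ?_
  obtain ⟨k', -, rfl⟩ := List.mem_map.1 hy
  exact D.piFactor_x_comm _ _ _ _

/-- Moving `s i` past the two factors exchanges them and produces the corrections $-1$ and $+1$,
which cancel. -/
lemma s_comm_x_mul_x (i : Fin (r - 1)) (u : ℂ) :
    Commute (D.s i) ((D.x ⟨i, by omega⟩ - algebraMap ℂ A u) *
      (D.x ⟨i + 1, by omega⟩ - algebraMap ℂ A u)) := by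
  have h1 := D.s_mul_x i
  have h2 := D.s_mul_x_succ i
  have h3 := D.x_sub_comm ⟨i, by omega⟩ ⟨i + 1, by omega⟩ u u
  have hu : D.s i * algebraMap ℂ A u = algebraMap ℂ A u * D.s i := (Algebra.commutes u _).symm
  have e1 : D.s i * (D.x ⟨i, by omega⟩ - algebraMap ℂ A u) =
      (D.x ⟨i + 1, by omega⟩ - algebraMap ℂ A u) * D.s i - 1 := by
    rw [mul_sub, h1, hu, sub_mul]; abel
  have e2 : D.s i * (D.x ⟨i + 1, by omega⟩ - algebraMap ℂ A u) =
      (D.x ⟨i, by omega⟩ - algebraMap ℂ A u) * D.s i + 1 := by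
    rw [mul_sub, h2, hu, sub_mul]; abel
  change _ = _
  rw [← mul_assoc, e1, sub_mul, mul_assoc, e2, mul_add, one_mul, mul_one, add_sub_cancel_right,
    ← mul_assoc, h3.eq]

lemma s_comm_x_sub (i : Fin (r - 1)) (j : Fin r) (h : j.val ≠ i.val) (h' : j.val ≠ i.val + 1)
    (u : ℂ) : Commute (D.s i) (D.x j - algebraMap ℂ A u) :=
  Commute.sub_right (show Commute _ _ from D.adj_x_comm i j h h') (Algebra.commutes u _).symm

/-- Apart from the excluded case, `x i` and `x (i + 1)` occur in the product both or not at all, and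
their joint factor commutes with `s i`. -/
lemma s_comm_piFactor (i : Fin (r - 1)) (u : ℂ) (a : ℕ) (ha : i.val + 1 ≠ a) :
    Commute (D.s i) (D.piFactor a u) := by
  induction a using Nat.strong_induction_on with
  | _ a ih =>
  cases a with
  | zero => rw [piFactor_zero]; exact Commute.one_right _
  | succ a =>
    by_cases har : r ≤ a
    · rw [piFactor_succ_of_le _ har]
      exact ih a (by omega) (by omega)
    have har' : a < r := by omega
    rw [D.piFactor_succ har']
    by_cases hia : i.val + 1 = a
    · subst hia
      -- The last two factors are split off together, which is why the induction is strong.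
      rw [D.piFactor_succ (a := i.val) (by omega), mul_assoc]
      exact Commute.mul_right (ih i.val (by omega) (by omega)) (D.s_comm_x_mul_x i u)
    · refine Commute.mul_right (ih a (by omega) hia) (D.s_comm_x_sub i _ ?_ ?_ u)
      · simp only; omega
      · simp only; omega

lemma pm_comm_piFactor (a : ℕ) (u : ℂ) {w : Perm (Fin r)}
    (hw : Preserves (fun k : Fin r => a ≤ k.val) w) : Commute (D.pm w) (D.piFactor a u) := by
  refine induction_on_preserves (κ := fun k : Fin r => a ≤ k.val)
    (p := fun w => Commute (D.pm w) (D.piFactor a u)) ?_ ?_ ?_ w hw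
  · intro k k' h hk
    exact le_trans hk h
  · rw [pm_one]; exact Commute.one_left _
  · intro i w hi _ h
    rw [pm_mul_adj]
    refine Commute.mul_left (D.s_comm_piFactor i u a ?_) h
    rintro rfl
    simp at hi

/-- The component part of the labelling by rows. -/
def _root_.Multipartition.compLabel (lam : Multipartition ℓ r) (k : Fin r) : Fin ℓ :=
  (lam.label k).1

lemma pm_comm_piElt (u : Fin ℓ → ℂ) (lam : Multipartition ℓ r) {w : Perm (Fin r)}
    (hw : Preserves lam.compLabel w) : Commute (D.pm w) (D.piElt u lam) := by
  refine Commute.list_prod_right _ _ fun y hy => ?_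
  obtain ⟨i, rfl⟩ := (List.mem_ofFn' _ _).1 hy
  refine D.pm_comm_piFactor _ _ fun k => ?_
  have h1 := lam.label_fst_lt_iff k i
  have h2 := lam.label_fst_lt_iff (w k) i
  have h3 : (lam.label (w k)).1 = (lam.label k).1 := hw k
  rw [h3] at h2
  rw [eq_iff_iff]
  beta_reduce
  rw [← not_lt, ← not_lt, ← h1, ← h2]

/-- The new factor extends the `j`-th product by one. In the application it records that the first
point of component `j` has moved to the preceding component. -/
lemma piElt_mul_x (u : Fin ℓ → ℂ) {lam mu : Multipartition ℓ r} (j : Fin ℓ)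
    (hj : lam.size j < r) (hsize : ∀ i : Fin ℓ, mu.size i = lam.size i + if i = j then 1 else 0) :
    D.piElt u lam * (D.x ⟨lam.size j, hj⟩ - algebraMap ℂ A (u j)) = D.piElt u mu := by
  refine List.prod_ofFn_mul_of_commute _ _ _ j (fun i => D.piFactor_x_comm _ _ _ _) ?_ ?_
  · rw [hsize, if_pos rfl, D.piFactor_succ hj]
  · intro i hi
    rw [hsize, if_neg hi, add_zero]

lemma exists_piFactor_eq (a : ℕ) (u : ℂ) :
    ∃ q, D.piFactor (a + 1) u = (D.x 0 - algebraMap ℂ A u) * q ∧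
      ∀ k v, Commute q (D.x k - algebraMap ℂ A v) := by
  induction a with
  | zero =>
    refine ⟨1, ?_, fun _ _ => Commute.one_left _⟩
    rw [D.piFactor_succ (NeZero.pos r), piFactor_zero, one_mul, mul_one]
    rfl
  | succ a ih =>
    obtain ⟨q, hq, hc⟩ := ih
    by_cases har : r ≤ a + 1
    · exact ⟨q, by rw [piFactor_succ_of_le _ har, hq], hc⟩
    · refine ⟨q * (D.x ⟨a + 1, by omega⟩ - algebraMap ℂ A u), ?_, fun k v => ?_⟩
      · rw [D.piFactor_succ (by omega), hq, mul_assoc]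
      · exact Commute.mul_left (hc _ _) (D.x_sub_comm _ _ _ _)

/-- When the first component is nonempty, each factor of `π` with positive index contains `x 0`
minus its parameter. The additional factor supplies the missing parameter, so the full cyclotomic
polynomial divides the product. -/
lemma piElt_mul_x_zero (ξ : Perm (Fin ℓ)) (lam : Multipartition ℓ r) (j : Fin ℓ) (hj : j.val = 0)
    (hpos : 0 < lam.size 1) :
    D.piElt (fun i => ω (ξ i)) lam * (D.x 0 - algebraMap ℂ A (ω (ξ j))) = 0 := by
  have hpos' : ∀ i : ℕ, i ≠ 0 → 0 < lam.size i := by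
    intro i hi
    have h0 := (lam.label_fst_lt_iff (0 : Fin r) 1).2 (by simpa using hpos)
    simpa using (lam.label_fst_lt_iff (0 : Fin r) i).1 (by omega)
  have hzero : lam.size 0 = 0 := by simp [Multipartition.size]
  have hex : ∀ i : Fin ℓ, ∃ q, (if i = j then D.x 0 - algebraMap ℂ A (ω (ξ j)) else
      D.piFactor (lam.size i) (ω (ξ i))) = (D.x 0 - algebraMap ℂ A (ω (ξ i))) * q ∧
      ∀ k v, Commute q (D.x k - algebraMap ℂ A v) := by
    intro i
    split_ifs with hi
    · exact ⟨1, by rw [hi, mul_one], fun _ _ => Commute.one_left _⟩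
    · obtain ⟨a, ha⟩ : ∃ a, lam.size i = a + 1 :=
        ⟨lam.size i - 1, by
          have := hpos' i (fun h => hi (Fin.ext (h.trans hj.symm)))
          omega⟩
      rw [ha]
      exact D.exists_piFactor_eq a _
  choose q hq hqc using hex
  rw [piElt, List.prod_ofFn_mul_of_commute _ (fun i : Fin ℓ =>
      if i = j then D.x 0 - algebraMap ℂ A (ω (ξ j)) else D.piFactor (lam.size i) (ω (ξ i))) _ j
      (fun i => D.piFactor_x_comm _ _ _ _),
    List.prod_ofFn_mul_distrib _ _ q hq (fun i j => hqc i _ _), D.cyclotomic_perm ξ, zero_mul]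
  · rw [if_pos rfl, hj, hzero, piFactor_zero, one_mul]
  · intro i hi
    rw [if_neg hi]

lemma IsAnti.list_prod {σ : A →ₐ[ℂ] Aᵐᵒᵖ} (l : List A) (hl : ∀ a ∈ l, unop (σ a) = a)
    (hc : ∀ a ∈ l, ∀ b ∈ l, Commute a b) : unop (σ l.prod) = l.prod := by
  induction l with
  | nil => simp
  | cons a l ih =>
    rw [List.prod_cons, map_mul, unop_mul, hl a List.mem_cons_self,
      ih (fun b hb => hl b (List.mem_cons_of_mem a hb))
        fun b hb c hc' => hc b (List.mem_cons_of_mem a hb) c (List.mem_cons_of_mem a hc')]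
    exact (Commute.list_prod_right _ _ fun b hb =>
      hc a List.mem_cons_self b (List.mem_cons_of_mem a hb)).symm

variable {D} in
lemma IsAnti.piElt {σ : A →ₐ[ℂ] Aᵐᵒᵖ} (hσ : D.IsAnti σ) (u : Fin ℓ → ℂ)
    (lam : Multipartition ℓ r) : unop (σ (D.piElt u lam)) = D.piElt u lam := by
  refine IsAnti.list_prod _ (fun a ha => ?_) fun a ha b hb => ?_
  · obtain ⟨i, rfl⟩ := (List.mem_ofFn' _ _).1 ha
    refine IsAnti.list_prod _ (fun a ha => ?_) fun a ha b hb => ?_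
    · obtain ⟨k, -, rfl⟩ := List.mem_map.1 ha
      rw [map_sub, unop_sub, hσ.x, AlgHom.commutes, MulOpposite.algebraMap_apply, unop_op]
    · obtain ⟨k, -, rfl⟩ := List.mem_map.1 ha
      obtain ⟨k', -, rfl⟩ := List.mem_map.1 hb
      exact D.x_sub_comm _ _ _ _
  · obtain ⟨i, rfl⟩ := (List.mem_ofFn' _ _).1 ha
    obtain ⟨i', rfl⟩ := (List.mem_ofFn' _ _).1 hb
    exact D.piFactor_comm _ _ _ _

end CycHeckeData

lemma Multipartition.mem_rowStabilizer_iff {ℓ r : ℕ} (lam : Multipartition ℓ r) (i : Fin ℓ)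
    (w : Perm (Fin r)) : w ∈ lam.rowStabilizer i ↔
      Preserves lam.label w ∧ ∀ k, lam.compLabel k ≠ i → w k = k := by
  constructor
  · intro h
    have key : ∀ k, (lam.compLabel k = i → lam.label (w k) = lam.label k) ∧
        (lam.compLabel k ≠ i → w k = k) := by
      intro k
      obtain ⟨b, rfl⟩ := lam.initialTableau.surjective k
      obtain ⟨b', hb'⟩ := lam.initialTableau.surjective (w (lam.initialTableau b))
      obtain ⟨h1, h2⟩ := h b b' hb'.symm
      rw [compLabel, ← hb', label_initialTableau, label_initialTableau]
      refine ⟨fun e => ?_, fun e => by rw [h2 e]⟩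
      obtain ⟨h3, h4⟩ := h1 e
      simp only at e
      rw [h3, h4, e]
    refine ⟨fun k => ?_, fun k => (key k).2⟩
    by_cases hk : lam.compLabel k = i
    · exact (key k).1 hk
    · rw [(key k).2 hk]
  · rintro ⟨h1, h2⟩ b b' e
    refine ⟨fun hb => ?_, fun hb => ?_⟩
    · have := h1 (lam.initialTableau b)
      rw [e, label_initialTableau, label_initialTableau, Prod.mk.injEq] at this
      exact ⟨this.1.trans hb, this.2⟩
    · have := h2 (lam.initialTableau b) (by rwa [compLabel, label_initialTableau])
      rw [e] at this
      exact lam.initialTableau.injective this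

/-! ### Signed symmetrizers as sums over the row stabilizer. -/

namespace CycHeckeData

lemma preserves_ne {ℓ r : ℕ} {c : Fin ℓ → Fin 2} {κ : Fin r → Fin ℓ} {w : Perm (Fin r)}
    (hw : Preserves κ w) : Preserves (fun k => c (κ k) ≠ 0) w :=
  fun k => by beta_reduce; rw [hw k]

variable {ℓ r : ℕ} [NeZero r] {ω : Fin ℓ → ℂ} {A : Type*} [Ring A] [Algebra ℂ A]
  (D : CycHeckeData (r := r) ω A)

/-- The image of a permutation `w`, with a sign for the part of `w` in those blocks of `κ` where
`c` is nonzero. -/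
noncomputable def tw (c : Fin ℓ → Fin 2) (κ : Fin r → Fin ℓ) (w : Perm (Fin r)) : A :=
  blockSign (fun k => c (κ k) ≠ 0) w • D.pm w

/-- The partial sign is multiplicative only on permutations that preserve the blocks, which is why
multiplicativity is required relative to `κ`. -/
lemma isRightHomOn_tw (c : Fin ℓ → Fin 2) (κ : Fin r → Fin ℓ) : IsRightHomOn κ (D.tw c κ) where
  one := by rw [tw, blockSign_one, pm_one, one_smul]
  mul v w hv hw := by
    rw [tw, tw, tw, smul_mul_smul_comm, pm_mul, blockSign_mul (preserves_ne hw) (preserves_ne hv),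
      mul_comm]

open Classical in
/-- The symmetrizer or antisymmetrizer of the row stabilizer in one component. -/
noncomputable def compSum (c : Fin 2) (lam : Multipartition ℓ r) (i : Fin ℓ) : A :=
  if c = 0 then ∑ w : Perm (Fin r) with w ∈ lam.rowStabilizer i, D.pm w else
    ∑ w : Perm (Fin r) with w ∈ lam.rowStabilizer i, ((sign w : ℤ) : ℂ) • D.pm w

/-- The element `x_λ^c`. -/
noncomputable def xElt (c : Fin ℓ → Fin 2) (lam : Multipartition ℓ r) : A :=
  (List.ofFn fun i : Fin ℓ => D.compSum (c i) lam i).prod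

-- An element of the row stabilizer of component `i` moves nothing elsewhere, so its partial sign is
-- 1 if `c i = 0` and its full sign otherwise.
open Classical in
lemma compSum_eq (c : Fin ℓ → Fin 2) (lam : Multipartition ℓ r) (i : Fin ℓ) :
    D.compSum (c i) lam i =
      ∑ w : Perm (Fin r) with w ∈ lam.rowStabilizer i, D.tw c lam.compLabel w := by
  have hκ : ∀ w ∈ lam.rowStabilizer i, Preserves lam.compLabel w := fun w hw k =>
    congrArg Prod.fst (((lam.mem_rowStabilizer_iff i w).1 hw).1 k)
  rw [compSum]
  split_ifs with hc
  · refine Finset.sum_congr rfl fun w hw => ?_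
    have hw : w ∈ lam.rowStabilizer i := by simpa using hw
    have h1 : restrict (fun k => c (lam.compLabel k) ≠ 0) w = 1 := by
      ext k
      rw [restrict_apply (preserves_ne (hκ w hw))]
      split_ifs with hk
      · rw [((lam.mem_rowStabilizer_iff i w).1 hw).2 k (fun e => hk (e ▸ hc))]
        rfl
      · rfl
    rw [tw, blockSign, h1]
    simp
  · refine Finset.sum_congr rfl fun w hw => ?_
    have hw : w ∈ lam.rowStabilizer i := by simpa using hw
    have h1 : restrict (fun k => c (lam.compLabel k) ≠ 0) w = w := by
      ext k
      rw [restrict_apply (preserves_ne (hκ w hw))]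
      split_ifs with hk
      · rfl
      · rw [((lam.mem_rowStabilizer_iff i w).1 hw).2 k (fun e => hk (e ▸ hc))]
    rw [tw, blockSign, h1]

/-- The row stabilizer is the direct product of the row stabilizers of the components, and the
partial sign is multiplicative on it. -/
lemma xElt_eq_stabSum (c : Fin ℓ → Fin 2) (lam : Multipartition ℓ r) :
    D.xElt c lam = stabSum (D.tw c lam.compLabel) lam.label := by
  classical
  have hκ : ∀ w, Preserves lam.label w → Preserves lam.compLabel w := fun w hw k =>
    congrArg Prod.fst (hw k)
  -- The product of the first `m` factors runs over the row-preserving permutations that fix the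
  -- components from `m` on.
  have key : ∀ m : ℕ, m ≤ ℓ →
      ((List.ofFn fun i : Fin ℓ => D.compSum (c i) lam i).take m).prod =
      ∑ w : Perm (Fin r) with Preserves lam.label w ∧
        ∀ k, m ≤ (lam.compLabel k).val → w k = k, D.tw c lam.compLabel w := by
    intro m
    induction m with
    | zero =>
      intro _
      rw [List.take_zero, List.prod_nil, Finset.sum_eq_single 1]
      · exact (D.isRightHomOn_tw c lam.compLabel).one.symm
      · intro w hw hne
        refine absurd (Equiv.ext fun k => ?_) hne
        exact (Finset.mem_filter.1 hw).2.2 k (Nat.zero_le _)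
      · intro h
        exact absurd (Finset.mem_filter.2 ⟨Finset.mem_univ _, Preserves.one, fun _ _ => rfl⟩) h
    | succ m ih =>
      intro hm
      rw [List.prod_take_succ _ _ (by simpa using hm), ih (by omega), List.getElem_ofFn,
        D.compSum_eq c, Finset.sum_mul_sum, ← Finset.sum_product']
      have hpres : ∀ (p : Fin ℓ → Prop) (w : Perm (Fin r)), Preserves lam.label w →
          Preserves (fun k => p (lam.compLabel k)) w := by
        intro p w hw k
        beta_reduce
        rw [hκ w hw k]
      have hlab : ∀ (p : Fin ℓ → Prop) (w : Perm (Fin r)), Preserves lam.label w →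
          Preserves lam.label (restrict (fun k => p (lam.compLabel k)) w) := by
        intro p w hw k
        rw [restrict_apply (hpres p w hw)]
        split_ifs
        · exact hw k
        · rfl
      -- The inverse splits a permutation into its parts on the components before `m` and on
      -- component `m`.
      refine Finset.sum_bij' (fun z _ => z.2 * z.1)
        (fun w _ => (restrict (fun k => (lam.compLabel k).val < m) w,
          restrict (fun k => lam.compLabel k = ⟨m, hm⟩) w)) ?_ ?_ ?_ ?_ ?_
      · rintro ⟨w, v⟩ hwv
        simp only [Finset.mem_product, Finset.mem_filter, Finset.mem_univ, true_and,
          lam.mem_rowStabilizer_iff] at hwv ⊢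
        refine ⟨hwv.2.1.mul hwv.1.1, fun k hk => ?_⟩
        rw [mul_apply, hwv.1.2 k (by omega), hwv.2.2 k (fun e => by simp [e] at hk)]
      · intro w hw
        simp only [Finset.mem_product, Finset.mem_filter, Finset.mem_univ, true_and,
          lam.mem_rowStabilizer_iff] at hw ⊢
        refine ⟨⟨hlab (fun i => i.val < m) w hw.1, fun k hk => ?_⟩,
          hlab (fun i => i = ⟨m, hm⟩) w hw.1, fun k hk => ?_⟩
        · rw [restrict_apply (hpres (fun i => i.val < m) w hw.1), if_neg (by omega)]
        · rw [restrict_apply (hpres (fun i => i = ⟨m, hm⟩) w hw.1), if_neg hk]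
      · rintro ⟨w, v⟩ hwv
        simp only [Finset.mem_product, Finset.mem_filter, Finset.mem_univ, true_and,
          lam.mem_rowStabilizer_iff] at hwv
        obtain ⟨⟨hw1, hw2⟩, hv1, hv2⟩ := hwv
        have hmul := hv1.mul hw1
        refine Prod.ext (Equiv.ext fun k => ?_) (Equiv.ext fun k => ?_)
        · simp only
          rw [restrict_apply (hpres (fun i => i.val < m) _ hmul)]
          split_ifs with hk
          · rw [mul_apply, hv2]
            rw [hκ w hw1 k]
            intro e
            simp [e] at hk
          · rw [hw2 k (by omega)]
        · simp only
          rw [restrict_apply (hpres (fun i => i = ⟨m, hm⟩) _ hmul)]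
          split_ifs with hk
          · rw [mul_apply, hw2 k (by simp [hk])]
          · rw [hv2 k hk]
      · intro w hw
        simp only [Finset.mem_filter, Finset.mem_univ, true_and] at hw
        refine Equiv.ext fun k => ?_
        simp only [mul_apply]
        rw [restrict_apply (hpres (fun i => i.val < m) w hw.1)]
        split_ifs with hk
        · rw [restrict_apply (hpres (fun i => i = ⟨m, hm⟩) w hw.1), if_neg]
          rw [hκ w hw.1 k]
          intro e
          simp [e] at hk
        · rw [restrict_apply (hpres (fun i => i = ⟨m, hm⟩) w hw.1)]
          split_ifs with hk'
          · rfl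
          · rw [hw.2]
            have : (lam.compLabel k).val ≠ m := fun e => hk' (Fin.ext e)
            omega
      · rintro ⟨w, v⟩ hwv
        simp only [Finset.mem_product, Finset.mem_filter, Finset.mem_univ, true_and,
          lam.mem_rowStabilizer_iff] at hwv
        exact (D.isRightHomOn_tw c lam.compLabel).mul _ _ (hκ _ hwv.1.1) (hκ _ hwv.2.1)
  have := key ℓ le_rfl
  rw [List.take_of_length_le (by simp)] at this
  rw [xElt, this, stabSum]
  refine Finset.sum_congr ?_ fun _ _ => rfl
  ext w
  simp only [Finset.mem_filter, Finset.mem_univ, true_and, and_iff_left_iff_imp]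
  intro _ k hk
  exact absurd (lam.compLabel k).2 (not_lt.2 hk)

variable {D} in
lemma IsAnti.stabSum {σ : A →ₐ[ℂ] Aᵐᵒᵖ} (hσ : D.IsAnti σ) (c : Fin ℓ → Fin 2)
    {κ : Fin r → Fin ℓ} {β : Type*} {L : Fin r → β} (hL : ∀ w, Preserves L w → Preserves κ w) :
    unop (σ (stabSum (D.tw c κ) L)) = stabSum (D.tw c κ) L := by
  classical
  rw [_root_.stabSum, map_sum, Finset.unop_sum]
  refine Finset.sum_bij' (fun w _ => w⁻¹) (fun w _ => w⁻¹) ?_ ?_ ?_ ?_ ?_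
  · intro w hw
    simp only [Finset.mem_filter, Finset.mem_univ, true_and] at hw ⊢
    exact hw.inv
  · intro w hw
    simp only [Finset.mem_filter, Finset.mem_univ, true_and] at hw ⊢
    exact hw.inv
  · intro w _; simp
  · intro w _; simp
  · intro w hw
    have hw : Preserves L w := by simpa using hw
    rw [tw, tw, map_smul, unop_smul, hσ.pm, blockSign_inv (preserves_ne (hL w hw))]

end CycHeckeData

/-! ### Straightening -/

namespace Multipartition

variable {ℓ r : ℕ}

lemma compLabel_of_label {lam : Multipartition ℓ r} {w : Perm (Fin r)}
    (hw : Preserves lam.label w) : Preserves lam.compLabel w := fun k => congrArg Prod.fst (hw k)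

/-- The permutation `d(t)`. -/
def stdPerm {lam : Multipartition ℓ r} (t : lam.Std) : Perm (Fin r) :=
  lam.initialTableau.symm.trans t.1

lemma size_eq_of_compLabel {lam mu : Multipartition ℓ r} (h : mu.compLabel = lam.compLabel)
    (i : ℕ) : mu.size i = lam.size i := by
  rw [← card_label_fst_lt, ← card_label_fst_lt]
  congr 1
  ext k
  have : (mu.label k).1 = (lam.label k).1 := congrFun h k
  simp [this]

lemma lt_of_labelCount {lam mu : Multipartition ℓ r} {L : Fin r → Fin ℓ × ℕ}
    (hmu : ∀ s n, labelCount L s n ≤ mu.partialSum s n)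
    (hle : ∀ s n, lam.partialSum s n ≤ labelCount L s n) {s : Fin ℓ} {n : ℕ}
    (hlt : lam.partialSum s n < labelCount L s n) : lam < mu := by
  refine lt_of_le_of_ne (fun s n => (hle s n).trans (hmu s n)) ?_
  rintro rfl
  exact absurd (hmu s n) (not_le.2 hlt)

/-- All points of the two rows except those of `E` go to the upper row. Since `E` is smaller than
the old lower row, the upper row grows; only the partial sum ending with it changes. -/
lemma labelCount_splitLabel (lam : Multipartition ℓ r) (s : Fin ℓ) (i : ℕ) {E : Finset (Fin r)}
    (hE : ∀ k ∈ E, lam.label k = (s, i) ∨ lam.label k = (s, i + 1))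
    (hcard : E.card < (lam.comp s).rowLen (i + 1)) :
    (∀ s' n, lam.partialSum s' n ≤
      labelCount (splitLabel lam.label (s, i) (s, i + 1) E) s' n) ∧
    lam.partialSum s (i + 1) < labelCount (splitLabel lam.label (s, i) (s, i + 1) E) s (i + 1) := by
  have hPQ : ((s, i) : Fin ℓ × ℕ) ≠ (s, i + 1) := by simp
  have hmerge : ∀ k ∈ E, mergeLabel lam.label (s, i) (s, i + 1) k = (s, i) := by
    intro k hk
    rcases hE k hk with h | h <;> simp [mergeLabel, h]
  have hlt : lam.partialSum s (i + 1) <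
      labelCount (splitLabel lam.label (s, i) (s, i + 1) E) s (i + 1) := by
    rw [← labelCount_label]
    set T : Finset (Fin r) := {k | lam.label k = (s, i + 1)} with hT
    set B : Finset (Fin r) := {k | (mergeLabel lam.label (s, i) (s, i + 1) k).1 < s ∨
      (mergeLabel lam.label (s, i) (s, i + 1) k).1 = s ∧
      (mergeLabel lam.label (s, i) (s, i + 1) k).2 < i + 1} with hB
    have h1 : labelCount lam.label s (i + 1) = (B \ T).card := by
      unfold labelCount
      congr 1
      ext k
      simp only [hB, hT, Finset.mem_filter, Finset.mem_univ, true_and, Finset.mem_sdiff, mergeLabel]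
      by_cases hk : lam.label k = (s, i + 1)
      · simp [hk]
      · simp [hk]
    have h2 : labelCount (splitLabel lam.label (s, i) (s, i + 1) E) s (i + 1) = (B \ E).card := by
      unfold labelCount
      congr 1
      ext k
      simp only [hB, Finset.mem_filter, Finset.mem_univ, true_and, Finset.mem_sdiff, splitLabel]
      by_cases hk : k ∈ E
      · simp [hk]
      · simp [hk]
    have hTB : T ⊆ B := by
      intro k hk
      simp only [hT, Finset.mem_filter, Finset.mem_univ, true_and] at hk
      simp [hB, mergeLabel, hk]
    have hEB : E ⊆ B := by
      intro k hk
      simp [hB, hmerge k hk]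
    have hTc : T.card = (lam.comp s).rowLen (i + 1) := lam.card_label_eq s (i + 1)
    rw [h1, h2, Finset.card_sdiff_of_subset hTB, Finset.card_sdiff_of_subset hEB]
    have := Finset.card_le_card hTB
    omega
  refine ⟨fun s' n => ?_, hlt⟩
  by_cases hsn : s' = s ∧ n = i + 1
  · obtain ⟨rfl, rfl⟩ := hsn
    exact hlt.le
  rw [← labelCount_label]
  refine le_of_eq (congrArg Finset.card (Finset.filter_congr fun k _ => ?_))
  have key : ∀ p : Fin ℓ × ℕ, p = (s, i) ∨ p = (s, i + 1) →
      ((p.1 < s' ∨ p.1 = s' ∧ p.2 < n) ↔ (s < s' ∨ s = s' ∧ i < n)) := by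
    rintro p (rfl | rfl)
    · rfl
    · by_cases hs : s = s'
      · subst hs
        simp only [lt_irrefl, false_or, true_and]
        have : n ≠ i + 1 := fun h => hsn ⟨rfl, h⟩
        omega
      · simp [hs]
  by_cases hk : lam.label k = (s, i) ∨ lam.label k = (s, i + 1)
  · rw [key _ hk, key]
    unfold splitLabel mergeLabel
    rcases hk with hk | hk <;> simp only [hk] <;> split_ifs <;> simp
  · push Not at hk
    have hkE : k ∉ E := fun h => by
      rcases hE k h with h | h
      · exact hk.1 h
      · exact hk.2 h
    simp [splitLabel, mergeLabel, hkE, hk.2]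

lemma preserves_compLabel_of_merge (lam : Multipartition ℓ r) (s : Fin ℓ) (i : ℕ) {g : Perm (Fin r)}
    (hg : Preserves (mergeLabel lam.label (s, i) (s, i + 1)) g) : Preserves lam.compLabel g := by
  have key : ∀ k, lam.compLabel k = (mergeLabel lam.label (s, i) (s, i + 1) k).1 := by
    intro k
    unfold mergeLabel compLabel
    split_ifs with h
    · rw [h]
    · rfl
  intro k
  rw [key, key, hg]

end Multipartition

/-! ### The ideal of more dominant shapes and the Garnir relations. -/

namespace CycHeckeData

open Multipartition

variable {ℓ r : ℕ} [NeZero r] {ω : Fin ℓ → ℂ} {A : Type*} [Ring A] [Algebra ℂ A]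
  (D : CycHeckeData (r := r) ω A) (u : Fin ℓ → ℂ) (c : Fin ℓ → Fin 2)

/-- The element `π_[λ] x_λ^c`. -/
noncomputable def mBase (lam : Multipartition ℓ r) : A := D.piElt u lam * D.xElt c lam

/-- The two-sided ideal generated by the elements `π_[μ] x_μ^c` with `μ` more dominant than `λ`. -/
def higher (lam : Multipartition ℓ r) : Submodule ℂ A :=
  Submodule.span ℂ {z | ∃ mu, lam < mu ∧ ∃ a b, z = a * D.mBase u c mu * b}

variable {u c}

lemma mem_higher {lam mu : Multipartition ℓ r} (h : lam < mu) (a b : A) :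
    a * D.mBase u c mu * b ∈ D.higher u c lam :=
  Submodule.subset_span ⟨mu, h, a, b, rfl⟩

lemma higher_mul {lam : Multipartition ℓ r} {z : A} (hz : z ∈ D.higher u c lam) (b : A) :
    z * b ∈ D.higher u c lam := by
  induction hz using Submodule.span_induction with
  | mem z hz =>
    obtain ⟨mu, h, a, b', rfl⟩ := hz
    rw [mul_assoc _ b']
    exact D.mem_higher h _ _
  | zero => rw [zero_mul]; exact Submodule.zero_mem _
  | add x y _ _ hx hy => rw [add_mul]; exact Submodule.add_mem _ hx hy
  | smul t x _ hx => rw [smul_mul_assoc]; exact Submodule.smul_mem _ _ hx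

lemma mul_higher {lam : Multipartition ℓ r} {z : A} (hz : z ∈ D.higher u c lam) (b : A) :
    b * z ∈ D.higher u c lam := by
  induction hz using Submodule.span_induction with
  | mem z hz =>
    obtain ⟨mu, h, a, b', rfl⟩ := hz
    rw [← mul_assoc, ← mul_assoc]
    exact D.mem_higher h _ _
  | zero => rw [mul_zero]; exact Submodule.zero_mem _
  | add x y _ _ hx hy => rw [mul_add]; exact Submodule.add_mem _ hx hy
  | smul t x _ hx => rw [mul_smul_comm]; exact Submodule.smul_mem _ _ hx

lemma tw_comm_piElt (u : Fin ℓ → ℂ) (c : Fin ℓ → Fin 2) (κ : Fin r → Fin ℓ)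
    (lam : Multipartition ℓ r) {w : Perm (Fin r)} (hw : Preserves lam.compLabel w) :
    Commute (D.tw c κ w) (D.piElt u lam) :=
  (D.pm_comm_piElt u lam hw).smul_left _

lemma mBase_mul_tw {lam : Multipartition ℓ r} {w : Perm (Fin r)} (hw : Preserves lam.label w) :
    D.mBase u c lam * D.tw c lam.compLabel w = D.mBase u c lam := by
  rw [mBase, mul_assoc, xElt_eq_stabSum,
    (D.isRightHomOn_tw c lam.compLabel).stabSum_mul (fun _ => compLabel_of_label) hw]

lemma piElt_eq_of_compLabel {lam mu : Multipartition ℓ r} (h : mu.compLabel = lam.compLabel) :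
    D.piElt u mu = D.piElt u lam := by
  unfold piElt
  congr 2
  funext i
  rw [size_eq_of_compLabel h]

/-- The sum over the stabilizer of a labelling is conjugate to some `x_μ^c`. -/
lemma exists_stabSum_eq (c : Fin ℓ → Fin 2) (L : Fin r → Fin ℓ × ℕ) {κ : Fin r → Fin ℓ}
    (hκ : ∀ k, (L k).1 = κ k) (hmono : Monotone κ) :
    ∃ (mu : Multipartition ℓ r) (v : Perm (Fin r)), mu.compLabel = κ ∧ Preserves κ v ∧
      stabSum (D.tw c κ) L = D.tw c κ v * D.xElt c mu * D.tw c κ v⁻¹ ∧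
      ∀ s n, labelCount L s n ≤ mu.partialSum s n := by
  obtain ⟨mu, v, h1, h2, h3, h4⟩ := exists_shape L
    (fun k k' h => by simpa only [hκ] using hmono h)
  have hmu : mu.compLabel = κ := funext fun k => (h1 k).trans (hκ k)
  have hv : Preserves κ v := by
    intro k
    rw [← hmu]
    change (mu.label (v k)).1 = (mu.label k).1
    rw [h2, h1]
  refine ⟨mu, v, hmu, hv, ?_, h4⟩
  classical
  subst hmu
  rw [xElt_eq_stabSum, ← (D.isRightHomOn_tw c mu.compLabel).stabSum_comp
    (fun _ => compLabel_of_label) hv, stabSum, stabSum]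
  -- `L` and `mu.label ∘ v` name the rows differently but have the same fibres, hence the same
  -- stabilizer.
  refine Finset.sum_congr ?_ fun _ _ => rfl
  ext w
  simp only [Finset.mem_filter, Finset.mem_univ, true_and]
  exact forall_congr' fun k => h3 _ _

section Garnir

variable (lam : Multipartition ℓ r) (s : Fin ℓ) (i : ℕ)

/-- Each term of the inclusion–exclusion formula prescribes at most `F.card` points for the lower
row. It therefore factors through the symmetrizer of a strictly more dominant shape with the same
component sizes, so with the same `π`. -/
lemma garnirSum_mem_higher {F : Finset (Fin r)}
    (hF : ∀ k ∈ F, lam.label k = (s, i) ∨ lam.label k = (s, i + 1))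
    (hcard : F.card < (lam.comp s).rowLen (i + 1)) :
    D.piElt u lam * garnirSum (D.tw c lam.compLabel) lam.label (s, i) (s, i + 1) F ∈
      D.higher u c lam := by
  classical
  have hPQ : ((s, i) : Fin ℓ × ℕ) ≠ (s, i + 1) := by simp
  rw [garnirSum_eq_sum_redistSum, Finset.mul_sum]
  refine Submodule.sum_mem _ fun E hE => ?_
  rw [mul_smul_comm]
  refine Submodule.smul_mem _ _ ?_
  set E' := (F.filter fun k => lam.label k = (s, i + 1)) ∪ E with hE'
  have hEF : E' ⊆ F := by
    refine Finset.union_subset (Finset.filter_subset _ _) ?_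
    exact (Finset.mem_powerset.1 hE).trans (Finset.filter_subset _ _)
  have hE'F : ∀ k ∈ E', lam.label k = (s, i) ∨ lam.label k = (s, i + 1) :=
    fun k hk => hF k (hEF hk)
  have hmerge : ∀ k ∈ E', mergeLabel lam.label (s, i) (s, i + 1) k = (s, i) := by
    intro k hk
    rcases hE'F k hk with h | h <;> simp [mergeLabel, h]
  have hκ : ∀ k, (splitLabel lam.label (s, i) (s, i + 1) E' k).1 = lam.compLabel k := by
    intro k
    unfold splitLabel mergeLabel compLabel
    split_ifs with h1 h2
    · rcases hE'F k h1 with h | h <;> rw [h]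
    · rw [h2]
    · rfl
  obtain ⟨mu, v, h1, h2, h3, h4⟩ := D.exists_stabSum_eq c _ hκ lam.label_fst_mono
  have hlt : lam < mu := by
    obtain ⟨h5, h6⟩ := labelCount_splitLabel lam s i hE'F
      (lt_of_le_of_lt (Finset.card_le_card hEF) hcard)
    exact lt_of_labelCount h4 h5 h6
  have h5 := redistSum_mul_stabSum hPQ (D.isRightHomOn_tw c lam.compLabel)
    (fun g hg => preserves_compLabel_of_merge lam s i hg) hmerge
  have hcomm : Commute (D.piElt u lam)
      (redistSum (D.tw c lam.compLabel) lam.label (s, i) (s, i + 1) E') := by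
    refine Commute.sum_right _ _ _ fun g hg => (D.tw_comm_piElt u c _ lam ?_).symm
    simp only [Finset.mem_filter] at hg
    exact preserves_compLabel_of_merge lam s i hg.2.1
  have hne := stabCard_ne_zero (splitLabel lam.label (s, i) (s, i + 1) E')
  -- Division by the order of the stabilizer exhibits its symmetrizer as a factor of the
  -- redistribution sum.
  rw [← inv_smul_smul₀ hne (redistSum _ _ _ _ E'), ← h5, h3, mul_smul_comm]
  refine Submodule.smul_mem _ _ ?_
  have hcomm2 : Commute (D.piElt u lam) (D.tw c lam.compLabel v) :=
    (D.tw_comm_piElt u c _ lam h2).symm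
  have : D.piElt u lam * (redistSum (D.tw c lam.compLabel) lam.label (s, i) (s, i + 1) E' *
      (D.tw c lam.compLabel v * D.xElt c mu * D.tw c lam.compLabel v⁻¹)) =
      (redistSum (D.tw c lam.compLabel) lam.label (s, i) (s, i + 1) E' *
      D.tw c lam.compLabel v) * D.mBase u c mu * D.tw c lam.compLabel v⁻¹ := by
    rw [mBase, D.piElt_eq_of_compLabel h1, ← mul_assoc, hcomm.eq]
    simp only [mul_assoc]
    rw [← mul_assoc (D.piElt u lam), hcomm2.eq]
    simp only [mul_assoc]
  rw [this]
  exact D.mem_higher hlt _ _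

end Garnir

end CycHeckeData

/-! ### Sorting along rows, column descents and the Garnir weight. -/

namespace Multipartition

variable {ℓ r : ℕ}

/-- Every permutation can be sorted along the rows. -/
lemma exists_rowSorted (lam : Multipartition ℓ r) (w : Perm (Fin r)) :
    ∃ g : Perm (Fin r), Preserves lam.label g ∧
      ∀ k k', k < k' → lam.label k = lam.label k' → (w * g) k < (w * g) k' := by
  classical
  -- The sorted arrangement is the one that maximizes this sum over the row stabilizer: an inversion
  -- within a row could be swapped to increase it.
  obtain ⟨g, hg, hmax⟩ := Finset.exists_max_image
    ({g : Perm (Fin r) | Preserves lam.label g} : Finset (Perm (Fin r)))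
    (fun g => ∑ k : Fin r, ((k : ℕ) : ℤ) * (((w * g) k : ℕ) : ℤ))
    ⟨1, by simpa using Preserves.one⟩
  have hg : Preserves lam.label g := by simpa using hg
  refine ⟨g, hg, fun k k' hk hlab => ?_⟩
  by_contra hlt
  have hlt' : (w * g) k' < (w * g) k :=
    lt_of_le_of_ne (not_lt.1 hlt) fun e => hk.ne ((w * g).injective e).symm
  have hsw : Preserves lam.label (swap k k') := by
    intro j
    rw [swap_apply_def]
    split_ifs with e e
    · rw [e, hlab]
    · rw [e, hlab]
    · rfl
  have h1 := hmax (g * swap k k') (by simpa using hg.mul hsw)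
  rw [← mul_assoc, sum_mul_swap (fun k : Fin r => ((k : ℕ) : ℤ)) (w * g) hk.ne] at h1
  have h2 : (0 : ℤ) < ((k' : ℕ) : ℤ) - ((k : ℕ) : ℤ) := by
    have := Fin.lt_def.1 hk
    omega
  have h3 : (0 : ℤ) < (((w * g) k : ℕ) : ℤ) - (((w * g) k' : ℕ) : ℤ) := by
    have := Fin.lt_def.1 hlt'
    omega
  have := mul_pos h2 h3
  linarith

/-- A row-sorted tableau that is not standard has a descent in a column between adjacent rows. -/
lemma isStandard_or_exists_descent (lam : Multipartition ℓ r) (w : Perm (Fin r))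
    (hw : ∀ k k', k < k' → lam.label k = lam.label k' → w k < w k') :
    Tableau.IsStandard (lam := lam) (lam.initialTableau.trans w) ∨
    ∃ b b' : Box lam, b'.comp = b.comp ∧ b'.row = b.row + 1 ∧ b'.col = b.col ∧
      w (lam.initialTableau b') < w (lam.initialTableau b) := by
  by_contra h
  push Not at h
  obtain ⟨h1, h2⟩ := h
  refine h1 ⟨fun b b' hc hr hlt => ?_, ?_⟩
  · refine hw _ _ (lam.initialTableau_lt_iff.2 (Box.lt_iff.2 (Or.inr ⟨hc, Or.inr ⟨hr, hlt⟩⟩))) ?_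
    rw [label_initialTableau, label_initialTableau, hc, hr]
  · rintro ⟨s, i, j, hm⟩ ⟨s', i', j', hm'⟩ hs hj hlt
    simp only at hs hj hlt
    subst hs hj
    simp only [Equiv.trans_apply]
    -- Without descents between adjacent rows the column increases box by box; the intermediate
    -- boxes exist because the diagram is closed upwards.
    induction i', hlt using Nat.le_induction with
    | base =>
      refine lt_of_le_of_ne (h2 ⟨s, i, j, hm⟩ ⟨s, i + 1, j, hm'⟩ rfl rfl rfl) fun e => ?_
      have := lam.initialTableau.injective (w.injective e)
      simp at this
    | succ i' hle ih =>
      have hm'' : (i', j) ∈ lam.comp s := (lam.comp s).up_left_mem (Nat.le_succ i') le_rfl hm'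
      exact (ih hm'').trans_le (h2 ⟨s, i', j, hm''⟩ ⟨s, i' + 1, j, hm'⟩ rfl rfl rfl)

/-- The points that stay fixed in the Garnir relation for the boxes `b` and `b'` below it. -/
def garnirFixed (lam : Multipartition ℓ r) (b b' : Box lam) : Finset (Fin r) :=
  {k | (lam.label k = (b.comp, b.row) ∧ k < lam.initialTableau b) ∨
    (lam.label k = (b'.comp, b'.row) ∧ lam.initialTableau b' < k)}

/-- If the boxes lie in column `j` (counted from 0), then `j` points are fixed to the left of `b`,
and the points to the right of `b'` number the length of the lower row minus `j + 1`. Together this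
is one less than that length. -/
lemma card_garnirFixed (lam : Multipartition ℓ r) {b b' : Box lam} (hc : b'.comp = b.comp)
    (hr : b'.row = b.row + 1) (hj : b'.col = b.col) :
    (lam.garnirFixed b b').card < (lam.comp b.comp).rowLen (b.row + 1) := by
  obtain ⟨s, i, j, hm⟩ := b
  obtain ⟨s', i', j', hm'⟩ := b'
  simp only at hc hr hj
  subst hc hr hj
  simp only
  set X : Finset (Fin r) :=
    {k | lam.label k = (s', i) ∧ k < lam.initialTableau ⟨s', i, j', hm⟩} with hX
  set Y : Finset (Fin r) :=
    {k | lam.label k = (s', i + 1) ∧ k < lam.initialTableau ⟨s', i + 1, j', hm'⟩} with hY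
  set Z : Finset (Fin r) :=
    {k | lam.label k = (s', i + 1) ∧ lam.initialTableau ⟨s', i + 1, j', hm'⟩ < k} with hZ
  have hXj : X.card ≤ j' := by
    rw [← Finset.card_range j']
    refine Finset.card_le_card_of_injOn (fun k => (lam.initialTableau.symm k).col) ?_ ?_
    · intro k hk
      obtain ⟨⟨s, i2, j2, hm2⟩, rfl⟩ := lam.initialTableau.surjective k
      simp only [hX, Finset.coe_filter, Finset.mem_univ, true_and, Set.mem_ofPred_eq,
        label_initialTableau, Prod.mk.injEq, initialTableau_lt_iff, Box.lt_iff] at hk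
      obtain ⟨⟨rfl, rfl⟩, hk⟩ := hk
      simpa using hk
    · intro k hk k' hk' e
      obtain ⟨⟨s, i2, j2, hm2⟩, rfl⟩ := lam.initialTableau.surjective k
      obtain ⟨⟨s3, i3, j3, hm3⟩, rfl⟩ := lam.initialTableau.surjective k'
      simp only [hX, Finset.coe_filter, Finset.mem_univ, true_and, Set.mem_ofPred_eq,
        label_initialTableau, Prod.mk.injEq] at hk hk'
      simp only [Equiv.symm_apply_apply] at e
      obtain ⟨⟨rfl, rfl⟩, -⟩ := hk
      obtain ⟨⟨rfl, rfl⟩, -⟩ := hk'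
      subst e
      rfl
  have hjY : j' ≤ Y.card := by
    rw [← Finset.card_fin j']
    have hmem : ∀ n : Fin j', (i + 1, n.val) ∈ lam.comp s' := fun n =>
      (lam.comp s').up_left_mem le_rfl n.2.le hm'
    refine Finset.card_le_card_of_injOn
      (fun n => lam.initialTableau ⟨s', i + 1, n, hmem n⟩) ?_ ?_
    · intro n _
      simp [hY, initialTableau_lt_iff, Box.lt_iff]
    · intro n _ n' _ e
      have := lam.initialTableau.injective e
      simpa [Fin.ext_iff] using this
  have hYZ : Y.card + Z.card < (lam.comp s').rowLen (i + 1) := by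
    have hdisj : Disjoint Y Z := by
      rw [Finset.disjoint_left]
      intro k hk hk'
      simp only [hY, hZ, Finset.mem_filter, Finset.mem_univ, true_and] at hk hk'
      exact lt_asymm hk.2 hk'.2
    rw [← Finset.card_union_of_disjoint hdisj, ← lam.card_label_eq]
    refine Finset.card_lt_card (Finset.ssubset_iff_of_subset ?_ |>.2
      ⟨lam.initialTableau ⟨s', i + 1, j', hm'⟩, by simp, by simp [hY, hZ]⟩)
    intro k hk
    rcases Finset.mem_union.1 hk with hk | hk
    · simpa using (Finset.mem_filter.1 hk).2.1
    · simpa using (Finset.mem_filter.1 hk).2.1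
  have hG : (lam.garnirFixed ⟨s', i, j', hm⟩ ⟨s', i + 1, j', hm'⟩) = X ∪ Z := by
    rw [garnirFixed, Finset.filter_or]
  rw [hG]
  have := Finset.card_union_le X Z
  omega

/-- The weight that increases under the Garnir relations. -/
def rowWeight (lam : Multipartition ℓ r) (w : Perm (Fin r)) : ℤ :=
  ∑ k, ((lam.label k).2 : ℤ) * ((w k : ℕ) : ℤ)

lemma rowWeight_mul (lam : Multipartition ℓ r) (w g : Perm (Fin r)) :
    lam.rowWeight (w * g) = ∑ k, ((lam.label (g⁻¹ k)).2 : ℤ) * ((w k : ℕ) : ℤ) := by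
  rw [rowWeight, ← Equiv.sum_comp g⁻¹]
  simp

lemma rowWeight_mul_of_preserves (lam : Multipartition ℓ r) (w : Perm (Fin r)) {g : Perm (Fin r)}
    (hg : Preserves lam.label g) : lam.rowWeight (w * g) = lam.rowWeight w := by
  rw [rowWeight_mul, rowWeight]
  exact Finset.sum_congr rfl fun k _ => by rw [hg.inv]

/-- Outside `garnirFixed`, the entries of the upper row are at least the entry of `b`, and those of
the lower row are below it. A redistribution that changes the rows exchanges some large entries with
small ones, moving the large ones down, where they count more. -/
lemma rowWeight_lt_of_garnir (lam : Multipartition ℓ r) {w : Perm (Fin r)}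
    (hw : ∀ k k', k < k' → lam.label k = lam.label k' → w k < w k')
    {b b' : Box lam} (hc : b'.comp = b.comp) (hr : b'.row = b.row + 1)
    (hdesc : w (lam.initialTableau b') < w (lam.initialTableau b)) {g : Perm (Fin r)}
    (hg : Preserves (mergeLabel lam.label (b.comp, b.row) (b.comp, b.row + 1)) g)
    (hgF : ∀ k ∈ lam.garnirFixed b b', (lam.label (g⁻¹ k) = (b.comp, b.row + 1) ↔
      lam.label k = (b.comp, b.row + 1)))
    (hgl : ¬ Preserves lam.label g) : lam.rowWeight w < lam.rowWeight (w * g) := by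
  set P : Fin ℓ × ℕ := (b.comp, b.row) with hP
  set Q : Fin ℓ × ℕ := (b.comp, b.row + 1) with hQ
  have hPQ : P ≠ Q := by simp [hP, hQ]
  have hbP : lam.label (lam.initialTableau b) = P := lam.label_initialTableau b
  have hbQ : lam.label (lam.initialTableau b') = Q := by
    rw [label_initialTableau, hc, hr]
  set θ : ℤ := ((w (lam.initialTableau b) : ℕ) : ℤ) with hθ
  set δ : Fin r → ℤ := fun k => ((lam.label (g⁻¹ k)).2 : ℤ) - ((lam.label k).2 : ℤ) with hδ
  have hsum0 : ∑ k, δ k = 0 := by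
    rw [hδ, Finset.sum_sub_distrib, sub_eq_zero]
    exact Equiv.sum_comp g⁻¹ (fun k => ((lam.label k).2 : ℤ))
  -- The total change of the row indices is zero, so `θ` may be subtracted from all entries; then
  -- every term is nonnegative.
  have hdiff : lam.rowWeight (w * g) - lam.rowWeight w = ∑ k, δ k * (((w k : ℕ) : ℤ) - θ) := by
    simp only [mul_sub, Finset.sum_sub_distrib, ← Finset.sum_mul, hsum0, zero_mul, sub_zero]
    rw [rowWeight_mul, rowWeight, ← Finset.sum_sub_distrib]
    exact Finset.sum_congr rfl fun k _ => by rw [hδ]; ring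
  have hmerge : ∀ k, mergeLabel lam.label P Q (g⁻¹ k) = mergeLabel lam.label P Q k := hg.inv
  have hcase : ∀ k, lam.label (g⁻¹ k) = lam.label k ∨
      (δ k = 1 ∧ θ ≤ ((w k : ℕ) : ℤ)) ∨ (δ k = -1 ∧ ((w k : ℕ) : ℤ) < θ) := by
    intro k
    have hk := hmerge k
    unfold mergeLabel at hk
    by_cases h1 : lam.label (g⁻¹ k) = Q
    · by_cases h2 : lam.label k = Q
      · exact Or.inl (h1.trans h2.symm)
      · rw [if_pos h1, if_neg h2] at hk
        refine Or.inr (Or.inl ⟨?_, ?_⟩)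
        · simp only [hδ, h1, ← hk, hP, hQ]; push_cast; ring
        · have hnF : k ∉ lam.garnirFixed b b' := fun hF => h2 ((hgF k hF).1 h1)
          have hle : ¬ k < lam.initialTableau b := by
            intro hlt
            exact hnF (by simp [garnirFixed, ← hk, hP, hlt])
          rcases eq_or_lt_of_le (not_lt.1 hle) with e | hlt
          · rw [hθ, e]
          · have := Fin.lt_def.1 (hw _ _ hlt (hbP.trans hk))
            omega
    · by_cases h2 : lam.label k = Q
      · rw [if_neg h1, if_pos h2] at hk
        refine Or.inr (Or.inr ⟨?_, ?_⟩)
        · simp only [hδ, h2, hk, hP, hQ]; push_cast; ring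
        · have hnF : k ∉ lam.garnirFixed b b' := fun hF => h1 ((hgF k hF).2 h2)
          have hle : ¬ lam.initialTableau b' < k := by
            intro hlt
            refine hnF ?_
            simp only [garnirFixed, Finset.mem_filter, Finset.mem_univ, true_and]
            exact Or.inr ⟨by rw [h2, hc, hr], hlt⟩
          have hd := Fin.lt_def.1 hdesc
          rcases eq_or_lt_of_le (not_lt.1 hle) with e | hlt
          · rw [hθ, e]
            omega
          · have := Fin.lt_def.1 (hw _ _ hlt (h2.trans hbQ.symm))
            omega
      · rw [if_neg h1, if_neg h2] at hk
        exact Or.inl hk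
  have hδ0 : ∀ k, lam.label (g⁻¹ k) = lam.label k → δ k = 0 := by
    intro k hk
    simp only [hδ, hk, sub_self]
  have hnonneg : ∀ k, 0 ≤ δ k * (((w k : ℕ) : ℤ) - θ) := by
    intro k
    rcases hcase k with h | ⟨h1, h2⟩ | ⟨h1, h2⟩
    · rw [hδ0 k h, zero_mul]
    · rw [h1]; linarith
    · rw [h1]; linarith
  -- Strictness comes from a point that moves up, since its entry is strictly below `θ`. Such a
  -- point exists because the changes sum to zero without all vanishing.
  have hneg : ∃ k, δ k < 0 := by
    by_contra hall
    push Not at hall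
    have hzero := (Finset.sum_eq_zero_iff_of_nonneg fun k _ => hall k).1 hsum0
    refine hgl ?_
    have : Preserves lam.label g⁻¹ := by
      intro k
      have h0 := hzero k (Finset.mem_univ k)
      rcases hcase k with h | ⟨h1, -⟩ | ⟨h1, -⟩
      · exact h
      · omega
      · omega
    simpa using this.inv
  obtain ⟨k, hk⟩ := hneg
  have hpos : 0 < δ k * (((w k : ℕ) : ℤ) - θ) := by
    rcases hcase k with h | ⟨h1, h2⟩ | ⟨h1, h2⟩
    · rw [hδ0 k h] at hk; omega
    · omega
    · rw [h1]; linarith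
  have := Finset.sum_pos' (fun k _ => hnonneg k) ⟨k, Finset.mem_univ k, hpos⟩
  omega

end Multipartition

/-! ### Straightening into standard tableaux. -/

namespace CycHeckeData

open Multipartition

variable {ℓ r : ℕ} [NeZero r] {ω : Fin ℓ → ℂ} {A : Type*} [Ring A] [Algebra ℂ A]
  (D : CycHeckeData (r := r) ω A) (u : Fin ℓ → ℂ) (c : Fin ℓ → Fin 2)

/-- The right cell module of `λ`, together with the higher ideal. -/
def cellSpan (lam : Multipartition ℓ r) : Submodule ℂ A :=
  Submodule.span ℂ (Set.range fun t : lam.Std => D.mBase u c lam * D.pm (stdPerm t)) ⊔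
    D.higher u c lam

variable {u c}

lemma mBase_mul_pm_mul (lam : Multipartition ℓ r) {g : Perm (Fin r)} (w : Perm (Fin r)) :
    D.mBase u c lam * D.tw c lam.compLabel g * D.pm w =
      blockSign (fun k => c (lam.compLabel k) ≠ 0) g • (D.mBase u c lam * D.pm (w * g)) := by
  rw [tw, mul_smul_comm, smul_mul_assoc, mul_assoc, pm_mul]

/-- Induction over increasing `rowWeight`. Sorting the rows costs only a sign and keeps the weight.
If the sorted tableau is not standard, a Garnir relation expresses it, modulo the higher ideal, by
tableaux of larger weight. -/
theorem mBase_mul_pm_mem (lam : Multipartition ℓ r) (w : Perm (Fin r)) :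
    D.mBase u c lam * D.pm w ∈ D.cellSpan u c lam := by
  refine Finite.induction_on_gt lam.rowWeight
    (p := fun w => D.mBase u c lam * D.pm w ∈ D.cellSpan u c lam) (fun w ih => ?_) w
  obtain ⟨g₀, hg₀, hsort⟩ := lam.exists_rowSorted w
  have hred : D.mBase u c lam * D.pm w =
      blockSign (fun k => c (lam.compLabel k) ≠ 0) g₀ • (D.mBase u c lam * D.pm (w * g₀)) := by
    rw [← mBase_mul_pm_mul, D.mBase_mul_tw hg₀]
  rw [hred]
  refine Submodule.smul_mem _ _ ?_
  rw [← lam.rowWeight_mul_of_preserves w hg₀] at ih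
  generalize w * g₀ = w at ih hsort
  rcases lam.isStandard_or_exists_descent w hsort with hstd | ⟨b, b', hc, hr, hj, hdesc⟩
  · refine Submodule.mem_sup_left (Submodule.subset_span ⟨⟨_, hstd⟩, ?_⟩)
    beta_reduce
    congr 2
    ext k
    simp [stdPerm]
  · classical
    have hG := D.garnirSum_mem_higher (u := u) (c := c) lam b.comp b.row
      (F := lam.garnirFixed b b') (fun k hk => by
        simp only [garnirFixed, Finset.mem_filter, Finset.mem_univ, true_and] at hk
        rcases hk with hk | hk
        · exact Or.inl hk.1
        · exact Or.inr (by rw [hk.1, hc, hr])) (lam.card_garnirFixed hc hr hj)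
    have hm : D.mBase u c lam *
        garnirSum (D.tw c lam.compLabel) lam.label (b.comp, b.row) (b.comp, b.row + 1)
          (lam.garnirFixed b b') * D.pm w ∈ D.higher u c lam := by
      rw [mBase, mul_assoc (D.piElt u lam), xElt_eq_stabSum,
        stabSum_mul_garnirSum (D.isRightHomOn_tw c lam.compLabel)
          (fun g hg => preserves_compLabel_of_merge lam _ _ hg), mul_smul_comm]
      exact D.higher_mul (Submodule.smul_mem _ _ hG) _
    rw [garnirSum, Finset.mul_sum, Finset.sum_mul,
      ← Finset.sum_filter_add_sum_filter_not _ (fun g => Preserves lam.label g)] at hm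
    rw [Finset.sum_congr rfl (g := fun _ => D.mBase u c lam * D.pm w)] at hm
    swap
    · intro g hg
      rw [D.mBase_mul_tw (Finset.mem_filter.1 hg).2]
    rw [Finset.sum_const, ← Nat.cast_smul_eq_nsmul ℂ] at hm
    have hrest : ∀ S : Finset (Perm (Fin r)), (∀ g ∈ S, lam.rowWeight w < lam.rowWeight (w * g)) →
        ∑ g ∈ S, D.mBase u c lam * D.tw c lam.compLabel g * D.pm w ∈ D.cellSpan u c lam := by
      intro S hS
      refine Submodule.sum_mem _ fun g hg => ?_
      rw [mBase_mul_pm_mul]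
      exact Submodule.smul_mem _ _ (ih _ (hS g hg))
    have hm' := Submodule.mem_sup_right
      (S := Submodule.span ℂ (Set.range fun t : lam.Std => D.mBase u c lam * D.pm (stdPerm t))) hm
    rw [← cellSpan, Submodule.add_mem_iff_left _ (hrest _ ?_)] at hm'
    -- The coefficient of the tableau under treatment is the number of Garnir permutations that
    -- preserve all rows; it is nonzero because the identity is among them.
    · refine (Submodule.smul_mem_iff _ ?_).1 hm'
      rw [Nat.cast_ne_zero, Finset.card_ne_zero]
      refine ⟨1, ?_⟩
      simp only [Finset.mem_filter, Finset.mem_univ, true_and]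
      exact ⟨⟨Preserves.one, fun k _ => by simp⟩, Preserves.one⟩
    · intro g hg
      simp only [Finset.mem_filter, Finset.mem_univ, true_and] at hg
      exact lam.rowWeight_lt_of_garnir hsort hc hr hdesc hg.1.1 hg.1.2 hg.2

end CycHeckeData

/-! ### The action of the polynomial generators -/

namespace Multipartition

variable {ℓ r : ℕ}

/-- The labelling in which the point `a` forms a new row of the component `j`. -/
def moveLabel (L : Fin r → Fin ℓ × ℕ) (a : Fin r) (j : Fin ℓ) : Fin r → Fin ℓ × ℕ :=
  Function.update L a (j, ∑ k, (L k).2 + 1)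

lemma moveLabel_self (L : Fin r → Fin ℓ × ℕ) (a : Fin r) (j : Fin ℓ) :
    moveLabel L a j a = (j, ∑ k, (L k).2 + 1) := Function.update_self ..

lemma moveLabel_of_ne (L : Fin r → Fin ℓ × ℕ) {a k : Fin r} (h : k ≠ a) (j : Fin ℓ) :
    moveLabel L a j k = L k := Function.update_of_ne h ..

/-- The new row index exceeds every row index in use, so `a` is alone in its row and must be fixed.
-/
lemma preserves_of_moveLabel {L : Fin r → Fin ℓ × ℕ} {a : Fin r} {j : Fin ℓ} {w : Perm (Fin r)}
    (hw : Preserves (moveLabel L a j) w) : w a = a ∧ Preserves L w := by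
  have ha : w a = a := by
    by_contra hne
    have h := hw a
    rw [moveLabel_of_ne L hne, moveLabel_self] at h
    have h1 := Finset.single_le_sum (f := fun k => (L k).2) (fun _ _ => Nat.zero_le _)
      (Finset.mem_univ (w a))
    simp only [h] at h1
    omega
  refine ⟨ha, fun k => ?_⟩
  by_cases hk : k = a
  · rw [hk, ha]
  · have hk' : w k ≠ a := fun e => hk (w.injective (e.trans ha.symm))
    have := hw k
    rwa [moveLabel_of_ne L hk', moveLabel_of_ne L hk] at this

/-- A point moved to an earlier component is counted at least as often as before, and additionally
in the count that stops just before its old component. -/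
lemma labelCount_moveLabel {L : Fin r → Fin ℓ × ℕ} {a : Fin r} {j : Fin ℓ} (hj : j < (L a).1) :
    (∀ s n, labelCount L s n ≤ labelCount (moveLabel L a j) s n) ∧
      labelCount L (L a).1 0 < labelCount (moveLabel L a j) (L a).1 0 := by
  have hsub : ∀ s n, ({k | (L k).1 < s ∨ (L k).1 = s ∧ (L k).2 < n} : Finset (Fin r)) ⊆
      ({k | (moveLabel L a j k).1 < s ∨ (moveLabel L a j k).1 = s ∧
        (moveLabel L a j k).2 < n} : Finset (Fin r)) := by
    intro s n k hk
    simp only [Finset.mem_filter, Finset.mem_univ, true_and] at hk ⊢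
    by_cases hka : k = a
    · subst hka
      rw [moveLabel_self]
      rcases hk with hk | hk
      · exact Or.inl (hj.trans hk)
      · exact Or.inl (hk.1 ▸ hj)
    · rwa [moveLabel_of_ne L hka]
  refine ⟨fun s n => Finset.card_le_card (hsub s n), Finset.card_lt_card ?_⟩
  refine (Finset.ssubset_iff_of_subset (hsub _ _)).2 ⟨a, ?_, ?_⟩
  · simp [moveLabel_self, hj]
  · simp

lemma compLabel_size {lam : Multipartition ℓ r} {k a : Fin r}
    (ha : a.val = lam.size (lam.compLabel k)) : lam.compLabel a = lam.compLabel k := by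
  have h1 := lam.label_fst_lt_iff a (lam.compLabel k)
  have h2 := lam.label_fst_lt_iff k (lam.compLabel k)
  have hle : a ≤ k := by
    rw [Fin.le_def, ha]
    by_contra h
    exact absurd (h2.2 (not_le.1 h)) (lt_irrefl _)
  refine le_antisymm (lam.label_fst_mono hle) ?_
  by_contra h
  have := h1.1 (not_le.1 h)
  omega

end Multipartition

namespace CycHeckeData

open Multipartition

variable {ℓ r : ℕ} [NeZero r] {ω : Fin ℓ → ℂ} {A : Type*} [Ring A] [Algebra ℂ A]
  (D : CycHeckeData (r := r) ω A) {u : Fin ℓ → ℂ} {c : Fin ℓ → Fin 2}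

lemma xElt_comm_piElt (u : Fin ℓ → ℂ) (c : Fin ℓ → Fin 2) (lam : Multipartition ℓ r) :
    Commute (D.xElt c lam) (D.piElt u lam) := by
  classical
  rw [xElt_eq_stabSum, stabSum]
  refine Commute.sum_left _ _ _ fun w hw => D.tw_comm_piElt u c _ lam ?_
  simp only [Finset.mem_filter, Finset.mem_univ, true_and] at hw
  exact compLabel_of_label hw

/-- The two sign conventions differ only in whether `a` belongs to a signed block, which is
irrelevant because the stabilizer fixes `a`. -/
lemma stabSum_tw_moveLabel (c : Fin ℓ → Fin 2) {L : Fin r → Fin ℓ × ℕ} {a : Fin r} {j : Fin ℓ}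
    {κ : Fin r → Fin ℓ} (hL : ∀ k, (L k).1 = κ k) :
    stabSum (D.tw c κ) (moveLabel L a j) =
      stabSum (D.tw c fun k => (moveLabel L a j k).1) (moveLabel L a j) := by
  classical
  unfold stabSum
  refine Finset.sum_congr rfl fun w hw => ?_
  have hw : Preserves (moveLabel L a j) w := by simpa using hw
  obtain ⟨ha, hLw⟩ := preserves_of_moveLabel hw
  have hκ : Preserves κ w := fun k => by rw [← hL, ← hL, hLw k]
  have hκ' : Preserves (fun k => (moveLabel L a j k).1) w := fun k => congrArg Prod.fst (hw k)
  have hres : restrict (fun k => c (κ k) ≠ 0) w =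
      restrict (fun k => c (moveLabel L a j k).1 ≠ 0) w := by
    ext k
    rw [restrict_apply (preserves_ne hκ), restrict_apply (preserves_ne hκ')]
    by_cases hk : k = a
    · subst hk
      simp [ha]
    · rw [moveLabel_of_ne L hk, hL]
  rw [tw, tw, blockSign, blockSign, hres]

/-- Multiplication by `x_a`, where `a` is the first entry of a component. -/
lemma xElt_mul_pm_mul_piElt_mem {lam : Multipartition ℓ r} {a : Fin r}
    (ha : a.val = lam.size (lam.compLabel a)) {g : Perm (Fin r)} (hg : Preserves lam.compLabel g)
    (hgg : g⁻¹ = g) (hpos : 0 < (lam.compLabel a).val) :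
    D.xElt c lam * D.pm g *
      (D.piElt u lam * (D.x a - algebraMap ℂ A (u (lam.compLabel a)))) ∈ D.higher u c lam := by
  classical
  set κ := lam.compLabel with hκ
  set j := κ a with hj
  -- The component preceding that of `a`; it exists by `hpos`.
  set j' : Fin ℓ := ⟨j.val - 1, by omega⟩ with hj'
  have hjj : j' < j := by rw [Fin.lt_def]; simp only [hj']; omega
  set L₁ : Fin r → Fin ℓ × ℕ := lam.label ∘ g with hL₁
  have hL₁κ : ∀ k, (L₁ k).1 = κ k := fun k => hg k
  set L₂ := moveLabel L₁ a j' with hL₂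
  set κ₂ : Fin r → Fin ℓ := fun k => (L₂ k).1 with hκ₂
  have hκ₂a : κ₂ a = j' := by simp [hκ₂, hL₂, moveLabel_self]
  have hκ₂k : ∀ k, k ≠ a → κ₂ k = κ k := by
    intro k hk
    simp only [hκ₂, hL₂]
    rw [moveLabel_of_ne L₁ hk, hL₁κ]
  have hlt_iff : ∀ k : Fin r, κ k < j ↔ k < a := by
    intro k
    rw [Fin.lt_def, Fin.lt_def, ha]
    exact lam.label_fst_lt_iff k j
  have hmono : Monotone κ₂ := by
    intro k k' hkk
    by_cases hk : k = a
    · by_cases hk' : k' = a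
      · rw [hk, hk']
      · rw [hk, hκ₂a, hκ₂k k' hk']
        refine hjj.le.trans ?_
        by_contra h
        have := (hlt_iff k').1 (not_le.1 h)
        exact absurd (hk ▸ hkk) (not_le.2 this)
    · by_cases hk' : k' = a
      · rw [hk', hκ₂a, hκ₂k k hk]
        have : k < a := lt_of_le_of_ne (hk' ▸ hkk) hk
        have := Fin.lt_def.1 ((hlt_iff k).2 this)
        rw [Fin.le_def]
        simp only [hj']
        omega
      · rw [hκ₂k k hk, hκ₂k k' hk']
        exact lam.label_fst_mono hkk
  obtain ⟨mu, v, h1, h2, h3, h4⟩ := D.exists_stabSum_eq c L₂ (κ := κ₂) (fun _ => rfl) hmono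
  have hlt : lam < mu := by
    have hla : (L₁ a).1 = j := hL₁κ a
    obtain ⟨h5, h6⟩ := labelCount_moveLabel (L := L₁) (a := a) (j := j') (by rw [hla]; exact hjj)
    have h7 : ∀ s n, labelCount L₁ s n = lam.partialSum s n := fun s n => by
      rw [hL₁, labelCount_comp, labelCount_label]
    refine lt_of_labelCount (L := L₂) (s := (L₁ a).1) (n := 0) h4 (fun s n => ?_) ?_
    · rw [← h7]; exact h5 s n
    · rw [← h7]; exact h6
  have hsize : ∀ i : Fin ℓ, mu.size i = lam.size i + if i = j then 1 else 0 := by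
    intro i
    rw [← card_label_fst_lt, ← card_label_fst_lt]
    have e1 : ∀ k, (mu.label k).1 = κ₂ k := fun k => congrFun h1 k
    simp only [e1]
    change Finset.card {k | (κ₂ k).val < i.val} = Finset.card {k | (κ k).val < i.val} + _
    split_ifs with hi
    · have : (Finset.univ.filter fun k => (κ₂ k).val < i.val) =
          insert a (Finset.univ.filter fun k => (κ k).val < i.val) := by
        ext k
        simp only [Finset.mem_filter, Finset.mem_univ, true_and, Finset.mem_insert]
        by_cases hk : k = a
        · subst hk
          simp only [hκ₂a, hi, hj', true_or, iff_true]
          omega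
        · rw [hκ₂k k hk]
          simp [hk]
      rw [this, Finset.card_insert_of_notMem]
      simp [← hj, hi]
    · rw [add_zero]
      congr 1
      ext k
      simp only [Finset.mem_filter, Finset.mem_univ, true_and]
      by_cases hk : k = a
      · subst hk
        rw [hκ₂a, ← hj]
        have : i.val ≠ j.val := fun e => hi (Fin.ext e)
        simp only [hj']
        omega
      · rw [hκ₂k k hk]
  -- Moving `a` from component `j` to `j - 1` increases exactly one partial size, namely the one
  -- before `j`, so the linear factor is absorbed into `π`.
  have hpi : D.piElt u lam * (D.x a - algebraMap ℂ A (u j)) = D.piElt u mu := by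
    rw [← D.piElt_mul_x u j (by rw [← ha]; exact a.2) hsize]
    congr 4
    exact Fin.ext ha
  rw [hpi]
  set ρ := D.tw c κ with hρ
  have hhom : IsRightHomOn κ ρ := D.isRightHomOn_tw c κ
  have hS1 : D.xElt c lam * ρ g = ρ g * stabSum ρ L₁ := by
    rw [hL₁, hhom.stabSum_comp (fun _ => compLabel_of_label) hg, xElt_eq_stabSum, hgg,
      ← mul_assoc, ← mul_assoc, hhom.mul g g hg hg]
    have : g * g = 1 := by nth_rewrite 1 [← hgg]; simp
    rw [this, hhom.one, one_mul]
  -- Isolating `a` gives a smaller stabilizer, so its symmetrizer can be split off, up to a nonzero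
  -- scalar, from the symmetrizer of `L₁`.
  have hS2 : stabSum ρ L₁ * stabSum ρ L₂ = (stabCard L₂ : ℂ) • stabSum ρ L₁ := by
    have hL₁pres : ∀ w : Perm (Fin r), Preserves L₁ w → Preserves κ w := fun w hw k => by
      rw [← hL₁κ, ← hL₁κ, hw k]
    exact hhom.sum_mul_stabSum (q := Preserves L₁) hL₁pres
      (fun w hw => hL₁pres w (preserves_of_moveLabel hw).2)
      fun h hh w hw => (preserves_of_moveLabel hh).2.mul hw
  have hS3 : stabSum ρ L₂ = D.tw c κ₂ v * D.xElt c mu * D.tw c κ₂ v⁻¹ := by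
    rw [← h3]
    exact D.stabSum_tw_moveLabel c hL₁κ
  have hpm : D.pm g = blockSign (fun k => c (κ k) ≠ 0) g • ρ g := by
    rw [hρ, tw, smul_smul, blockSign_mul_self, one_smul]
  rw [hpm, mul_smul_comm, smul_mul_assoc]
  refine Submodule.smul_mem _ _ ?_
  rw [hS1, ← inv_smul_smul₀ (stabCard_ne_zero L₂) (stabSum ρ L₁), ← hS2, hS3, mul_smul_comm,
    smul_mul_assoc]
  refine Submodule.smul_mem _ _ ?_
  have hv : Preserves mu.compLabel v := by rw [h1]; exact h2
  have hcv : Commute (D.tw c κ₂ v⁻¹) (D.piElt u mu) := D.tw_comm_piElt u c _ mu hv.inv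
  have hcx := D.xElt_comm_piElt u c mu
  have : ρ g * (stabSum ρ L₁ * (D.tw c κ₂ v * D.xElt c mu * D.tw c κ₂ v⁻¹)) * D.piElt u mu =
      (ρ g * (stabSum ρ L₁ * D.tw c κ₂ v)) * D.mBase u c mu * D.tw c κ₂ v⁻¹ := by
    simp only [mul_assoc, mBase]
    rw [hcv.eq, ← mul_assoc (D.xElt c mu), hcx.eq]
    simp only [mul_assoc]
  rw [this]
  exact D.mem_higher hlt _ _

lemma cellSpan_mul_pm {lam : Multipartition ℓ r} {z : A} (hz : z ∈ D.cellSpan u c lam)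
    (w : Perm (Fin r)) : z * D.pm w ∈ D.cellSpan u c lam := by
  have hle : D.cellSpan u c lam ≤
      (D.cellSpan u c lam).comap (LinearMap.mulRight ℂ (D.pm w)) := by
    refine sup_le (Submodule.span_le.2 ?_)
      fun y hy => Submodule.mem_sup_right (D.higher_mul hy _)
    rintro _ ⟨t, rfl⟩
    change D.mBase u c lam * D.pm (stdPerm t) * D.pm w ∈ D.cellSpan u c lam
    rw [mul_assoc, pm_mul]
    exact D.mBase_mul_pm_mem lam _
  exact hle hz

/-- Modulo group elements, which `mBase_mul_pm_mem` handles, `x k` is a conjugate of `x a` with `a`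
the first entry in the component of `k`. For `x a` itself one subtracts the parameter of that
component. -/
lemma mBase_mul_x_mem (ξ : Perm (Fin ℓ)) (lam : Multipartition ℓ r) (k : Fin r) :
    D.mBase (fun i => ω (ξ i)) c lam * D.x k ∈ D.cellSpan (fun i => ω (ξ i)) c lam := by
  set u : Fin ℓ → ℂ := fun i => ω (ξ i) with hu
  have hsz : lam.size (lam.compLabel k) < r := by
    have h2 := lam.label_fst_lt_iff k (lam.compLabel k)
    by_contra h
    exact absurd (h2.2 (lt_of_lt_of_le k.2 (not_lt.1 h))) (lt_irrefl _)
  set a : Fin r := ⟨lam.size (lam.compLabel k), hsz⟩ with ha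
  have hak : lam.compLabel a = lam.compLabel k := compLabel_size rfl
  set g : Perm (Fin r) := swap a k with hg
  have hgg : g⁻¹ = g := swap_inv a k
  have hgpres : Preserves lam.compLabel g := by
    intro i
    rw [hg, swap_apply_def]
    split_ifs with e e
    · rw [e, hak]
    · rw [e, hak]
    · rfl
  have hsum : ∀ (b : Fin r) (v w : Perm (Fin r)), D.mBase u c lam * D.pm v *
      (∑ j with j < b, D.pm (swap j b)) * D.pm w ∈ D.cellSpan u c lam := by
    intro b v w
    refine D.cellSpan_mul_pm ?_ w
    rw [Finset.mul_sum]
    refine Submodule.sum_mem _ fun j _ => ?_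
    rw [mul_assoc, pm_mul]
    exact D.mBase_mul_pm_mem lam _
  set w : Perm (Fin r) := swap 0 a with hw
  have hxa := D.x_eq_conj_add a w (by rw [hw, swap_inv, swap_apply_left])
  have hxk := D.x_eq_conj_add k (w * g) (by
    rw [mul_inv_rev, hgg, Perm.mul_apply, hw, swap_inv, swap_apply_left, hg, swap_apply_left])
  -- The two Jucys–Murphy formulas contain the same conjugate of `x 0` up to conjugation by `g`;
  -- eliminating it leaves only group elements.
  have hxk' : D.x k = D.pm g * D.x a * D.pm g -
      D.pm g * (∑ j with j < a, D.pm (swap j a)) * D.pm g + ∑ j with j < k, D.pm (swap j k) := by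
    rw [hxk, hxa, mul_inv_rev, hgg, ← pm_mul, ← pm_mul]
    simp only [mul_add, add_mul, mul_assoc, add_sub_cancel_right]
  have hmain : D.mBase u c lam * D.pm g * D.x a ∈ D.cellSpan u c lam := by
    have hcx := D.xElt_comm_piElt u c lam
    have hcg := D.pm_comm_piElt u lam hgpres
    have e : D.mBase u c lam * D.pm g * D.x a = D.xElt c lam * D.pm g *
        (D.piElt u lam * (D.x a - algebraMap ℂ A (u (lam.compLabel a)))) +
        u (lam.compLabel a) • (D.mBase u c lam * D.pm g) := by
      have h1 : D.mBase u c lam * D.pm g = D.xElt c lam * D.pm g * D.piElt u lam := by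
        rw [mBase, ← hcx.eq, mul_assoc, ← hcg.eq, mul_assoc]
      rw [h1, mul_sub, mul_sub, Algebra.smul_def, Algebra.commutes]
      simp only [mul_assoc, sub_add_cancel]
    rw [e]
    refine Submodule.add_mem _ ?_ (Submodule.smul_mem _ _ (D.mBase_mul_pm_mem lam g))
    have haa : a.val = lam.size (lam.compLabel a) := by rw [hak]
    by_cases hpos : 0 < (lam.compLabel a).val
    · exact Submodule.mem_sup_right (D.xElt_mul_pm_mul_piElt_mem haa hgpres hgg hpos)
    -- In the first component there is no earlier component to move to; here `a = 0`, and the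
    -- cyclotomic relation kills the product.
    · have h0 : (lam.compLabel a).val = 0 := by omega
      have ha0 : a = 0 := Fin.ext (by rw [haa, h0]; simp [Multipartition.size])
      have hp : 0 < lam.size 1 := by
        have := (lam.label_fst_lt_iff a 1).1 (by change (lam.compLabel a).val < 1; omega)
        omega
      have := D.piElt_mul_x_zero ξ lam (lam.compLabel a) h0 hp
      rw [ha0] at this ⊢
      rw [hu, this, mul_zero]
      exact Submodule.zero_mem _
  rw [hxk', mul_add, mul_sub]
  refine Submodule.add_mem _ (Submodule.sub_mem _ ?_ ?_) ?_
  · rw [← mul_assoc, ← mul_assoc]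
    exact D.cellSpan_mul_pm hmain g
  · rw [← mul_assoc, ← mul_assoc]
    exact hsum a g g
  · simpa [pm_one] using hsum k 1 1

/-- The right ideal generated by `π_[λ] x_λ^c` is spanned by the standard elements, modulo the
higher ideal. -/
theorem mBase_mul_mem (ξ : Perm (Fin ℓ)) (lam : Multipartition ℓ r) (b : A) :
    D.mBase (fun i => ω (ξ i)) c lam * b ∈ D.cellSpan (fun i => ω (ξ i)) c lam := by
  set u : Fin ℓ → ℂ := fun i => ω (ξ i) with hu
  refine D.mul_mem_of_generators _ (fun z hz i => D.cellSpan_mul_pm hz _) (fun z hz => ?_)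
    (by simpa [pm_one] using D.mBase_mul_pm_mem (u := u) (c := c) lam 1) b
  have hle : D.cellSpan u c lam ≤
      (D.cellSpan u c lam).comap (LinearMap.mulRight ℂ (D.x 0)) := by
    refine sup_le (Submodule.span_le.2 ?_)
      fun y hy => Submodule.mem_sup_right (D.higher_mul hy _)
    rintro _ ⟨t, rfl⟩
    change D.mBase u c lam * D.pm (stdPerm t) * D.x 0 ∈ D.cellSpan u c lam
    generalize stdPerm t = w
    have h1 := D.x_eq_conj_add (w⁻¹ 0) w rfl
    -- `x 0` is moved to the left through the permutation, so that it meets `mBase` as some `x k`,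
    -- at the cost of group elements.
    have h2 : D.pm w * D.x 0 = D.x (w⁻¹ 0) * D.pm w -
        (∑ j with j < w⁻¹ 0, D.pm (swap j (w⁻¹ 0))) * D.pm w := by
      rw [h1, add_mul, add_sub_cancel_right, mul_assoc _ _ (D.pm w), pm_inv_mul_pm, mul_one]
    rw [mul_assoc, h2, mul_sub, ← mul_assoc, ← mul_assoc]
    refine Submodule.sub_mem _ (D.cellSpan_mul_pm (D.mBase_mul_x_mem ξ lam _) w)
      (D.cellSpan_mul_pm ?_ w)
    rw [Finset.mul_sum]
    exact Submodule.sum_mem _ fun j _ => D.mBase_mul_pm_mem lam _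
  exact hle hz

end CycHeckeData

/-! ### Cellularity, given the dimension -/

lemma Multipartition.lt_of_mem {ℓ r : ℕ} (lam : Multipartition ℓ r) {s : Fin ℓ} {i j : ℕ}
    (h : (i, j) ∈ lam.comp s) : i < r ∧ j < r := by
  have hcard : (lam.comp s).card ≤ r :=
    (Finset.single_le_sum (f := fun s => (lam.comp s).card) (fun _ _ => Nat.zero_le _)
      (Finset.mem_univ s)).trans lam.sum_card.le
  have h1 := YoungDiagram.mem_iff_lt_colLen.1 h
  have h2 := YoungDiagram.mem_iff_lt_rowLen.1 h
  rw [YoungDiagram.colLen_eq_card] at h1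
  rw [YoungDiagram.rowLen_eq_card] at h2
  have h3 : ((lam.comp s).col j).card ≤ (lam.comp s).card :=
    Finset.card_le_card (Finset.filter_subset _ _)
  have h4 : ((lam.comp s).row i).card ≤ (lam.comp s).card :=
    Finset.card_le_card (Finset.filter_subset _ _)
  omega

instance Multipartition.instFinite {ℓ r : ℕ} : Finite (Multipartition ℓ r) := by
  refine Finite.of_injective
    (fun lam : Multipartition ℓ r => fun (s : Fin ℓ) (i j : Fin r) =>
      (((i : ℕ), (j : ℕ)) ∈ lam.comp s : Prop)) fun lam mu h => ?_
  have key : ∀ s i j, i < r → j < r → ((i, j) ∈ lam.comp s ↔ (i, j) ∈ mu.comp s) := by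
    intro s i j hi hj
    exact (congrFun (congrFun (congrFun h s) ⟨i, hi⟩) ⟨j, hj⟩).to_iff
  ext1
  funext s
  refine SetLike.ext fun ⟨i, j⟩ => ⟨fun hm => ?_, fun hm => ?_⟩
  · have := lam.lt_of_mem hm
    exact (key s i j this.1 this.2).1 hm
  · have := mu.lt_of_mem hm
    exact (key s i j this.1 this.2).2 hm

namespace CycHeckeData

open Multipartition

variable {ℓ r : ℕ} [NeZero r] {ω : Fin ℓ → ℂ} {A : Type*} [Ring A] [Algebra ℂ A]
  (D : CycHeckeData (r := r) ω A) (u : Fin ℓ → ℂ) (c : Fin ℓ → Fin 2)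

/-- The element `d(s)⁻¹ π_[λ] x_λ^c d(t)`. -/
noncomputable def mElt (lam : Multipartition ℓ r) (s t : lam.Std) : A :=
  D.pm (stdPerm s)⁻¹ * D.mBase u c lam * D.pm (stdPerm t)

/-- The span of the elements `m_{u,v}` of shape at least as dominant as `λ`. -/
def geSpan (lam : Multipartition ℓ r) : Submodule ℂ A :=
  Submodule.span ℂ {b | ∃ mu, lam ≤ mu ∧ ∃ U V, b = D.mElt u c mu U V}

variable {D u c} {σ : A →ₐ[ℂ] Aᵐᵒᵖ}

lemma IsAnti.mBase (hσ : D.IsAnti σ) (lam : Multipartition ℓ r) :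
    unop (σ (D.mBase u c lam)) = D.mBase u c lam := by
  rw [CycHeckeData.mBase, map_mul, unop_mul, hσ.piElt, xElt_eq_stabSum,
    hσ.stabSum c (fun _ => compLabel_of_label), ← xElt_eq_stabSum]
  exact (D.xElt_comm_piElt u c lam).eq

lemma IsAnti.mElt (hσ : D.IsAnti σ) (lam : Multipartition ℓ r) (s t : lam.Std) :
    unop (σ (D.mElt u c lam s t)) = D.mElt u c lam t s := by
  rw [CycHeckeData.mElt, CycHeckeData.mElt, map_mul, map_mul, unop_mul, unop_mul, hσ.pm, hσ.pm,
    hσ.mBase, inv_inv, mul_assoc]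

lemma IsAnti.higher (hσ : D.IsAnti σ) {lam : Multipartition ℓ r} {z : A}
    (hz : z ∈ D.higher u c lam) : unop (σ z) ∈ D.higher u c lam := by
  induction hz using Submodule.span_induction with
  | mem z hz =>
    obtain ⟨mu, h, a, b, rfl⟩ := hz
    rw [map_mul, map_mul, unop_mul, unop_mul, hσ.mBase, ← mul_assoc]
    exact D.mem_higher h _ _
  | zero => rw [map_zero, unop_zero]; exact Submodule.zero_mem _
  | add x y _ _ hx hy => rw [map_add, unop_add]; exact Submodule.add_mem _ hx hy
  | smul t x _ hx => rw [map_smul, unop_smul]; exact Submodule.smul_mem _ _ hx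

lemma exists_mBase_mul (D : CycHeckeData (r := r) ω A) (ξ : Perm (Fin ℓ)) (c : Fin ℓ → Fin 2)
    (lam : Multipartition ℓ r) (b : A) :
    ∃ f : lam.Std → ℂ, D.mBase (fun i => ω (ξ i)) c lam * b -
      ∑ t, f t • (D.mBase (fun i => ω (ξ i)) c lam * D.pm (stdPerm t)) ∈
        D.higher (fun i => ω (ξ i)) c lam := by
  obtain ⟨y, hy, z, hz, e⟩ := Submodule.mem_sup.1 (D.mBase_mul_mem (c := c) ξ lam b)
  obtain ⟨f, rfl⟩ := (Submodule.mem_span_range_iff_exists_fun ℂ).1 hy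
  exact ⟨f, by rwa [← e, add_sub_cancel_left]⟩

/-- The mirror image under `σ`: `mBase` is fixed, the higher ideal is stable, and `pm w` goes to `pm
w⁻¹`. -/
lemma IsAnti.exists_mul_mBase (hσ : D.IsAnti σ) (ξ : Perm (Fin ℓ)) (c : Fin ℓ → Fin 2)
    (lam : Multipartition ℓ r) (a : A) :
    ∃ f : lam.Std → ℂ, a * D.mBase (fun i => ω (ξ i)) c lam -
      ∑ s, f s • (D.pm (stdPerm s)⁻¹ * D.mBase (fun i => ω (ξ i)) c lam) ∈
        D.higher (fun i => ω (ξ i)) c lam := by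
  obtain ⟨f, hf⟩ := D.exists_mBase_mul ξ c lam (unop (σ a))
  refine ⟨f, ?_⟩
  have := hσ.higher hf
  rw [map_sub, unop_sub, map_mul, unop_mul, hσ.involutive, hσ.mBase, map_sum,
    Finset.unop_sum] at this
  simpa only [map_smul, unop_smul, map_mul, unop_mul, hσ.mBase, hσ.pm] using this

lemma geSpan_mono {lam mu : Multipartition ℓ r} (h : lam ≤ mu) :
    D.geSpan u c mu ≤ D.geSpan u c lam :=
  Submodule.span_mono fun _ ⟨nu, hnu, U, V, e⟩ => ⟨nu, h.trans hnu, U, V, e⟩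

/-- Induction from the most dominant shapes downwards: both sides are straightened modulo the higher
ideal, whose generators are covered by the induction hypothesis. -/
theorem IsAnti.mul_mBase_mul_mem (hσ : D.IsAnti σ) (ξ : Perm (Fin ℓ)) (c : Fin ℓ → Fin 2)
    (lam : Multipartition ℓ r) (a b : A) :
    a * D.mBase (fun i => ω (ξ i)) c lam * b ∈ D.geSpan (fun i => ω (ξ i)) c lam := by
  revert a b
  induction lam using (wellFounded_gt (α := Multipartition ℓ r)).induction with
  | _ lam ih =>
  intro a b
  set u : Fin ℓ → ℂ := fun i => ω (ξ i) with hu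
  have hhigh : D.higher u c lam ≤ D.geSpan u c lam := by
    refine Submodule.span_le.2 ?_
    rintro _ ⟨mu, hmu, a, b, rfl⟩
    exact geSpan_mono hmu.le (ih mu hmu a b)
  obtain ⟨f, hf⟩ := D.exists_mBase_mul ξ c lam b
  obtain ⟨f', hf'⟩ := hσ.exists_mul_mBase ξ c lam a
  rw [← hu] at hf hf'
  have e : a * D.mBase u c lam * b =
      a * (D.mBase u c lam * b - ∑ t, f t • (D.mBase u c lam * D.pm (stdPerm t))) +
      ∑ t, f t • ((a * D.mBase u c lam -
        ∑ s, f' s • (D.pm (stdPerm s)⁻¹ * D.mBase u c lam)) * D.pm (stdPerm t)) +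
      ∑ t, f t • ∑ s, f' s • D.mElt u c lam s t := by
    simp only [mul_sub, sub_mul, Finset.mul_sum, Finset.sum_mul, smul_sub, Finset.sum_sub_distrib,
      mul_smul_comm, smul_mul_assoc, CycHeckeData.mElt, mul_assoc]
    abel
  rw [e]
  refine Submodule.add_mem _ (Submodule.add_mem _ (hhigh (D.mul_higher hf a)) ?_) ?_
  · exact Submodule.sum_mem _ fun t _ => Submodule.smul_mem _ _ (hhigh (D.higher_mul hf' _))
  · exact Submodule.sum_mem _ fun t _ => Submodule.smul_mem _ _
      (Submodule.sum_mem _ fun s _ => Submodule.smul_mem _ _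
        (Submodule.subset_span ⟨lam, le_rfl, s, t, rfl⟩))

/-- The unit lies in the two-sided ideal generated by some `π_[μ] x_μ^c`. -/
lemma exists_mul_mBase_mul_eq_one [NeZero ℓ] (D : CycHeckeData (r := r) ω A) (u : Fin ℓ → ℂ)
    (c : Fin ℓ → Fin 2) : ∃ (mu : Multipartition ℓ r) (a b : A), a * D.mBase u c mu * b = 1 := by
  classical
  have hℓ := NeZero.pos ℓ
  -- All points lie in the last component, each in a row of its own: the stabilizer is trivial and
  -- every product in `π` is empty.
  set L : Fin r → Fin ℓ × ℕ := fun k => (⟨ℓ - 1, by omega⟩, k.val) with hL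
  obtain ⟨mu, v, h1, h2, h3, h4⟩ := D.exists_stabSum_eq c L (κ := fun _ => ⟨ℓ - 1, by omega⟩)
    (fun _ => rfl) monotone_const
  have hone : stabSum (D.tw c fun _ => ⟨ℓ - 1, by omega⟩) L = 1 := by
    rw [stabSum, Finset.sum_eq_single 1]
    · exact (D.isRightHomOn_tw c _).one
    · intro w hw hne
      have hw : Preserves L w := by simpa using hw
      refine absurd (Equiv.ext fun k => Fin.ext ?_) hne
      exact congrArg Prod.snd (hw k)
    · intro h
      exact absurd (by simpa using Preserves.one) h
  have hpi : D.piElt u mu = 1 := by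
    refine List.prod_eq_one fun y hy => ?_
    obtain ⟨i, rfl⟩ := (List.mem_ofFn' _ _).1 hy
    have : mu.size i = 0 := by
      rw [← card_label_fst_lt, Finset.card_eq_zero, Finset.filter_eq_empty_iff]
      intro k _
      have hk : (mu.label k).1 = ⟨ℓ - 1, by omega⟩ := congrFun h1 k
      rw [hk]
      simp only
      omega
    beta_reduce
    rw [this, piFactor_zero]
  refine ⟨mu, D.tw c (fun _ => ⟨ℓ - 1, by omega⟩) v, D.tw c (fun _ => ⟨ℓ - 1, by omega⟩) v⁻¹, ?_⟩
  rw [mBase, hpi, one_mul, ← h3, hone]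

theorem IsAnti.span_range_mElt [NeZero ℓ] (hσ : D.IsAnti σ) (ξ : Perm (Fin ℓ))
    (c : Fin ℓ → Fin 2) :
    Submodule.span ℂ (Set.range fun p : Σ lam : (Multipartition ℓ r)ᵒᵈ,
      (OrderDual.ofDual lam).Std × (OrderDual.ofDual lam).Std =>
        D.mElt (fun i => ω (ξ i)) c (OrderDual.ofDual p.1) p.2.1 p.2.2) = ⊤ := by
  rw [eq_top_iff]
  intro a _
  obtain ⟨mu, a', b, h⟩ := D.exists_mul_mBase_mul_eq_one (fun i => ω (ξ i)) c
  have h1 := hσ.mul_mBase_mul_mem ξ c mu (a * a') b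
  rw [mul_assoc a, mul_assoc a, h, mul_one] at h1
  refine Submodule.span_mono ?_ h1
  rintro _ ⟨nu, -, U, V, rfl⟩
  exact ⟨⟨OrderDual.toDual nu, U, V⟩, rfl⟩

theorem IsAnti.module_finite [NeZero ℓ] (hσ : D.IsAnti σ) : Module.Finite ℂ A := by
  have : Finite (Σ lam : (Multipartition ℓ r)ᵒᵈ,
      (OrderDual.ofDual lam).Std × (OrderDual.ofDual lam).Std) :=
    inferInstanceAs (Finite (Σ lam : Multipartition ℓ r, lam.Std × lam.Std))
  exact ⟨hσ.span_range_mElt 1 0 ▸ Submodule.fg_span (Set.finite_range _)⟩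

/-- A spanning family with no more members than the dimension is a basis. The structure constants
come from straightening on the left only, so they cannot depend on `T`. -/
theorem isCellularBasis [NeZero ℓ] (D : CycHeckeData (r := r) ω A) {σ : A ≃ₐ[ℂ] Aᵐᵒᵖ}
    (hσ : D.IsAnti (σ : A →ₐ[ℂ] Aᵐᵒᵖ)) (ξ : Perm (Fin ℓ)) (c : Fin ℓ → Fin 2)
    (hdim : Nat.card (Σ lam : Multipartition ℓ r, lam.Std × lam.Std) ≤ Module.finrank ℂ A) :
    IsCellularBasis ℂ (Λ := (Multipartition ℓ r)ᵒᵈ) (fun lam => (OrderDual.ofDual lam).Std)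
      (fun lam => D.mElt (fun i => ω (ξ i)) c (OrderDual.ofDual lam)) σ := by
  set u : Fin ℓ → ℂ := fun i => ω (ξ i) with hu
  have hspan := hσ.span_range_mElt ξ c
  rw [← hu] at hspan
  refine ⟨?_, hspan, hσ.involutive, fun lam S T => hσ.mElt _ S T, fun lam a => ?_⟩
  · have : Finite (Σ lam : (Multipartition ℓ r)ᵒᵈ,
        (OrderDual.ofDual lam).Std × (OrderDual.ofDual lam).Std) :=
      inferInstanceAs (Finite (Σ lam : Multipartition ℓ r, lam.Std × lam.Std))
    have := Fintype.ofFinite (Σ lam : (Multipartition ℓ r)ᵒᵈ,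
        (OrderDual.ofDual lam).Std × (OrderDual.ofDual lam).Std)
    refine linearIndependent_of_top_le_span_of_card_eq_finrank hspan.ge (le_antisymm ?_ ?_)
    · rw [← Nat.card_eq_fintype_card]
      exact hdim
    · have h := finrank_range_le_card (R := ℂ) (fun p : Σ lam : (Multipartition ℓ r)ᵒᵈ,
        (OrderDual.ofDual lam).Std × (OrderDual.ofDual lam).Std =>
          D.mElt u c (OrderDual.ofDual p.1) p.2.1 p.2.2)
      rwa [Set.finrank, hspan, finrank_top] at h
  · induction lam using OrderDual.rec with
    | _ lam =>
    -- The coefficients are fixed before the right-hand tableau appears; it is multiplied on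
    -- afterwards.
    have hf : ∀ s : lam.Std, _ := fun s => hσ.exists_mul_mBase ξ c lam (a * D.pm (stdPerm s)⁻¹)
    choose f hf using hf
    refine ⟨fun s' s => f s s', fun S T => ?_⟩
    have hle : D.higher u c lam ≤ Submodule.span ℂ {b : A | ∃ mu : (Multipartition ℓ r)ᵒᵈ,
        mu < OrderDual.toDual lam ∧ ∃ U V, b = D.mElt u c (OrderDual.ofDual mu) U V} := by
      refine Submodule.span_le.2 ?_
      rintro _ ⟨mu, hmu, a, b, rfl⟩
      refine Submodule.span_mono ?_ (hσ.mul_mBase_mul_mem ξ c mu a b)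
      rintro _ ⟨nu, hnu, U, V, rfl⟩
      exact ⟨OrderDual.toDual nu, OrderDual.toDual_lt_toDual.2 (hmu.trans_le hnu), U, V, rfl⟩
    have h := hle (D.higher_mul (hf S) (D.pm (stdPerm T)))
    simp only [sub_mul, Finset.sum_mul, smul_mul_assoc] at h
    simp only [CycHeckeData.mElt, OrderDual.ofDual_toDual, ← mul_assoc]
    simp only [CycHeckeData.mElt] at h
    exact h

end CycHeckeData

/-! ### The degenerate cyclotomic Hecke algebra by generators and relations -/

/-- Elements of an algebra that satisfy the defining relations of the degenerate cyclotomic Hecke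
algebra. -/
structure HeckeRelations {ℓ r : ℕ} [NeZero r] (ω : Fin ℓ → ℂ) {B : Type*} [Ring B] [Algebra ℂ B]
    (S : Fin (r - 1) → B) (X : Fin r → B) : Prop where
  s_sq : ∀ i, S i * S i = 1
  x_comm : ∀ i j, X i * X j = X j * X i
  s_comm : ∀ i j : Fin (r - 1), i.val + 1 < j.val ∨ j.val + 1 < i.val → S i * S j = S j * S i
  s_x_comm : ∀ (i : Fin (r - 1)) (j : Fin r), j.val ≠ i.val → j.val ≠ i.val + 1 →
    S i * X j = X j * S i
  x_s : ∀ i : Fin (r - 1), X ⟨i, by omega⟩ * S i - S i * X ⟨i + 1, by omega⟩ = -1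
  s_x : ∀ i : Fin (r - 1), S i * X ⟨i, by omega⟩ - X ⟨i + 1, by omega⟩ * S i = -1
  braid : ∀ i j : Fin (r - 1), j.val = i.val + 1 → S i * S j * S i = S j * S i * S j
  cyclotomic : (List.ofFn fun i : Fin ℓ => X 0 - algebraMap ℂ B (ω i)).prod = 0

namespace HeckeRelations

variable {ℓ r : ℕ} [NeZero r] {ω : Fin ℓ → ℂ} {B : Type*} [Ring B] [Algebra ℂ B]
  {S : Fin (r - 1) → B} {X : Fin r → B}

/-- The opposite elements satisfy the relations, too. -/
lemma op (h : HeckeRelations ω S X) :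
    HeckeRelations ω (fun i => op (S i)) (fun j => op (X j)) where
  s_sq i := by rw [← op_mul, h.s_sq, op_one]
  x_comm i j := by rw [← op_mul, ← op_mul, h.x_comm]
  s_comm i j hij := by rw [← op_mul, ← op_mul, h.s_comm i j hij]
  s_x_comm i j h1 h2 := by rw [← op_mul, ← op_mul, h.s_x_comm i j h1 h2]
  x_s i := by rw [← op_mul, ← op_mul, ← op_sub, h.s_x, op_neg, op_one]
  s_x i := by rw [← op_mul, ← op_mul, ← op_sub, h.x_s, op_neg, op_one]
  braid i j hij := by
    rw [← op_mul, ← op_mul, ← op_mul, ← op_mul, ← mul_assoc, ← mul_assoc, h.braid i j hij]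
  cyclotomic := by
    have hc : ∀ i j : Fin ℓ, Commute (X 0 - algebraMap ℂ B (ω i)) (X 0 - algebraMap ℂ B (ω j)) :=
      fun i j => Commute.sub_left (Commute.sub_right (Commute.refl _)
        (Algebra.commutes _ _).symm) (Algebra.commutes _ _)
    have h1 := congrArg MulOpposite.op h.cyclotomic
    rw [MulOpposite.op_list_prod, List.map_ofFn, op_zero] at h1
    rw [← h1]
    -- Passing to the opposite algebra reverses the product, which does not matter because the
    -- factors are polynomials in `X 0`.
    refine (List.reverse_perm _).symm.prod_eq' ?_
    rw [List.pairwise_ofFn]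
    exact fun i j _ => (hc i j).op

theorem exists_lift (h : HeckeRelations ω S X) : ∃ φ : DegCycHecke r ω →ₐ[ℂ] B,
    (∀ i, φ (DegCycHecke.s ω i) = S i) ∧ ∀ j, φ (DegCycHecke.x ω j) = X j := by
  let g : HeckeGen r → B := fun g => match g with
    | .s i => S i
    | .x j => X j
  have h1 : ∀ ⦃a b⦄, DegAffineHecke.Rel r a b → FreeAlgebra.lift ℂ g a = FreeAlgebra.lift ℂ g b := by
    intro a b hab
    cases hab with
    | s_sq i => simpa [g] using h.s_sq i
    | x_comm i j => simpa [g] using h.x_comm i j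
    | s_comm i j hij => simpa [g] using h.s_comm i j hij
    | s_x_comm i j h1 h2 => simpa [g] using h.s_x_comm i j h1 h2
    | x_s i => simpa [g] using h.x_s i
    | s_x i => simpa [g] using h.s_x i
    | braid i j hij => simpa [g] using h.braid i j hij
  let φ₁ : DegAffineHecke r →ₐ[ℂ] B := RingQuot.liftAlgHom ℂ ⟨FreeAlgebra.lift ℂ g, h1⟩
  have hs : ∀ i, φ₁ (DegAffineHecke.s i) = S i := fun i => by
    simp [φ₁, DegAffineHecke.s, g]
  have hx : ∀ j, φ₁ (DegAffineHecke.x j) = X j := fun j => by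
    simp [φ₁, DegAffineHecke.x, g]
  have h2 : ∀ ⦃a b⦄, DegCycHecke.Rel r ω a b → φ₁ a = φ₁ b := by
    intro a b hab
    cases hab
    rw [map_list_prod, map_zero, List.map_ofFn, ← h.cyclotomic]
    congr 2
    funext i
    simp only [Function.comp]
    rw [← hx 0, ← AlgHom.commutes φ₁ (ω i)]
    exact map_sub φ₁ _ _
  refine ⟨RingQuot.liftAlgHom ℂ ⟨φ₁, h2⟩, fun i => ?_, fun j => ?_⟩
  · rw [DegCycHecke.s, RingQuot.liftAlgHom_mkAlgHom_apply, hs]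
  · rw [DegCycHecke.x, RingQuot.liftAlgHom_mkAlgHom_apply, hx]

end HeckeRelations

/-! ### The presented algebra and its anti-involution. -/

namespace DegCycHecke

variable {ℓ r : ℕ} [NeZero r] (ω : Fin ℓ → ℂ)

lemma ofFree_surjective : Function.Surjective (ofFree (r := r) ω) :=
  (RingQuot.mkAlgHom_surjective ℂ (Rel r ω)).comp
    (RingQuot.mkAlgHom_surjective ℂ (DegAffineHecke.Rel r))

lemma heckeRelations : HeckeRelations ω (s (r := r) ω) (x (r := r) ω) where
  s_sq i := (map_mul (ofFree ω) _ _).symm.trans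
    ((ofFree_rel ω (.s_sq i)).trans (map_one (ofFree ω)))
  x_comm i j := (map_mul (ofFree ω) _ _).symm.trans
    ((ofFree_rel ω (.x_comm i j)).trans (map_mul (ofFree ω) _ _))
  s_comm i j h := (map_mul (ofFree ω) _ _).symm.trans
    ((ofFree_rel ω (.s_comm i j h)).trans (map_mul (ofFree ω) _ _))
  s_x_comm i j h h' := (map_mul (ofFree ω) _ _).symm.trans
    ((ofFree_rel ω (.s_x_comm i j h h')).trans (map_mul (ofFree ω) _ _))
  x_s i := by
    have h := ofFree_rel ω (DegAffineHecke.Rel.x_s i)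
    rw [map_sub, map_mul, map_mul, map_neg, map_one] at h
    exact h
  s_x i := by
    have h := ofFree_rel ω (DegAffineHecke.Rel.s_x i)
    rw [map_sub, map_mul, map_mul, map_neg, map_one] at h
    exact h
  braid i j hij := by
    have h := ofFree_rel ω (DegAffineHecke.Rel.braid i j hij)
    rw [map_mul, map_mul, map_mul, map_mul] at h
    exact h
  cyclotomic := by
    have h := RingQuot.mkAlgHom_rel ℂ (DegCycHecke.Rel.cyc (r := r) (ω := ω))
    rw [map_list_prod, map_zero, List.map_ofFn] at h
    refine Eq.trans ?_ h
    congr 2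
    funext i
    refine Eq.trans ?_ (map_sub (RingQuot.mkAlgHom ℂ (Rel r ω)) _ _).symm
    rw [AlgHom.commutes]
    rfl

/-- The generators of the degenerate cyclotomic Hecke algebra. -/
noncomputable def data : CycHeckeData (r := r) ω (DegCycHecke r ω) where
  x := x ω
  pm w := perm ω (op w)
  pm_one := map_one (perm ω)
  pm_mul v w := (map_mul (perm ω) _ _).symm
  x_comm := (heckeRelations ω).x_comm
  adj_x_comm i j h h' := by
    have e : perm ω (op (adj i)) = s ω i := perm_simpleTransposition ω i
    rw [e]
    exact (heckeRelations ω).s_x_comm i j h h'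
  adj_mul_x i := by
    have e : perm ω (op (adj i)) = s ω i := perm_simpleTransposition ω i
    rw [e]
    have h := (heckeRelations (r := r) ω).s_x i
    exact (sub_eq_iff_eq_add.1 h).trans ((add_comm _ _).trans (sub_eq_add_neg _ _).symm)
  cyclotomic := (heckeRelations ω).cyclotomic
  generate T hs hx := by
    rw [eq_top_iff]
    intro a _
    obtain ⟨a, rfl⟩ := ofFree_surjective ω a
    have hT : (⊤ : Subalgebra ℂ (FreeAlgebra ℂ (HeckeGen r))) ≤ T.comap (ofFree ω) := by
      rw [← FreeAlgebra.adjoin_range_ι, Algebra.adjoin_le_iff]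
      rintro _ ⟨g, rfl⟩
      cases g with
      | s i =>
        have e : perm ω (op (adj i)) = s ω i := perm_simpleTransposition ω i
        have := hs (adj i)
        rw [e] at this
        exact this
      | x j => exact hx j
    exact hT Algebra.mem_top

lemma data_s (i : Fin (r - 1)) : (data ω).s i = s ω i := perm_simpleTransposition ω i

variable {ω} in
lemma FixesGenerators.isAnti {σ : DegCycHecke r ω ≃ₐ[ℂ] (DegCycHecke r ω)ᵐᵒᵖ}
    (h : FixesGenerators ω σ) :
    (data ω).IsAnti (σ : DegCycHecke r ω →ₐ[ℂ] (DegCycHecke r ω)ᵐᵒᵖ) where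
  s i := by rw [data_s]; exact h.1 i
  x_zero := h.2

/-- The relations hold in the opposite algebra, which gives the homomorphism. It is its own inverse,
and it is unique because the $s_i$ and $x_1$ already generate. -/
theorem existsUnique_fixesGenerators :
    ∃! σ : DegCycHecke r ω ≃ₐ[ℂ] (DegCycHecke r ω)ᵐᵒᵖ, FixesGenerators ω σ := by
  obtain ⟨φ, hs, hx⟩ := (heckeRelations (r := r) ω).op.exists_lift
  have hφ : (data ω).IsAnti φ := ⟨fun i => by rw [data_s]; exact hs i, hx 0⟩
  refine ⟨AlgEquiv.ofBijective φ ⟨fun a b h => ?_, fun b => ?_⟩, ⟨hs, hx 0⟩, fun τ hτ => ?_⟩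
  · rw [← hφ.involutive a, ← hφ.involutive b, h]
  · exact ⟨unop (φ (unop b)), by rw [← op_unop (φ _), hφ.involutive, op_unop]⟩
  · have h := (data ω).ext_of_generators (σ := (τ : DegCycHecke r ω →ₐ[ℂ] (DegCycHecke r ω)ᵐᵒᵖ))
      (τ := φ) (fun i => (hτ.isAnti.s i).trans (hφ.s i).symm) (hτ.isAnti.x_zero.trans hφ.x_zero.symm)
    exact AlgEquiv.ext fun a => DFunLike.congr_fun h a

end DegCycHecke

/-! ### A representation on words -/

namespace WordRep

variable {r : ℕ} {α : Type*} (lv : α → ℕ) (up : α → Option α) (om : ℕ → ℂ)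

/-- Permutation of the letters. -/
def P (π : Perm (Fin r)) : Module.End ℂ ((Fin r → α) → ℂ) where
  toFun f w := f (w ∘ π)
  map_add' _ _ := rfl
  map_smul' _ _ := rfl

/-- Multiplication by a function. -/
def diag (d : (Fin r → α) → ℂ) : Module.End ℂ ((Fin r → α) → ℂ) where
  toFun f w := d w * f w
  map_add' f g := by funext w; simp [mul_add]
  map_smul' c f := by funext w; simp [mul_left_comm]

/-- The operator that raises the level of the `i`-th letter of the argument. -/
def shift (i : Fin r) : Module.End ℂ ((Fin r → α) → ℂ) where
  toFun f w := (up (w i)).elim 0 fun a => f (Function.update w i a)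
  map_add' f g := by
    funext w
    cases h : up (w i) <;> simp [h]
  map_smul' c f := by
    funext w
    cases h : up (w i) <;> simp [h]

/-- The operator that exchanges the letters at `i` and `j` if the first is the higher one. -/
def b (i j : Fin r) : Module.End ℂ ((Fin r → α) → ℂ) :=
  P (swap i j) * diag fun w => if lv (w j) < lv (w i) then 1 else 0

/-- The part of `y i` that acts on the `i`-th letter only. -/
def c (i : Fin r) : Module.End ℂ ((Fin r → α) → ℂ) := diag (fun w => om (lv (w i))) + shift up i

/-- The conjugates of the first polynomial generator. -/
def y (i : Fin r) : Module.End ℂ ((Fin r → α) → ℂ) :=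
  c lv up om i - ∑ k ∈ Finset.univ.erase i, b lv i k

variable {lv up om}

@[simp] lemma P_apply (π : Perm (Fin r)) (f : (Fin r → α) → ℂ) (w : Fin r → α) :
    P π f w = f (w ∘ π) := rfl

@[simp] lemma diag_apply (d f : (Fin r → α) → ℂ) (w : Fin r → α) : diag d f w = d w * f w := rfl

lemma P_one : P (1 : Perm (Fin r)) = (1 : Module.End ℂ ((Fin r → α) → ℂ)) := rfl

lemma P_mul (π τ : Perm (Fin r)) :
    P π * P τ = (P (π * τ) : Module.End ℂ ((Fin r → α) → ℂ)) := rfl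

lemma b_apply (i j : Fin r) (f : (Fin r → α) → ℂ) (w : Fin r → α) :
    b lv i j f w = if lv (w i) < lv (w j) then f (w ∘ swap i j) else 0 := by
  simp [b]

lemma shift_apply (i : Fin r) (f : (Fin r → α) → ℂ) (w : Fin r → α) :
    shift up i f w = (up (w i)).elim 0 fun a => f (Function.update w i a) := rfl

lemma c_apply (i : Fin r) (f : (Fin r → α) → ℂ) (w : Fin r → α) :
    c lv up om i f w = om (lv (w i)) * f w + shift up i f w := rfl

lemma update_comp_perm (w : Fin r → α) (π : Perm (Fin r)) (i : Fin r) (a : α) :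
    Function.update (w ∘ π) i a = Function.update w (π i) a ∘ π := by
  rw [Function.update_comp_equiv, symm_apply_apply]

lemma P_mul_c (π : Perm (Fin r)) (i : Fin r) :
    P π * c lv up om i = c lv up om (π i) * P π := by
  refine LinearMap.ext fun f => funext fun w => ?_
  simp only [Module.End.mul_apply, P_apply, c_apply, shift_apply, Function.comp_apply,
    update_comp_perm]

lemma P_mul_b (π : Perm (Fin r)) (i j : Fin r) :
    P π * b lv i j = b lv (π i) (π j) * P π := by
  refine LinearMap.ext fun f => funext fun w => ?_
  simp only [Module.End.mul_apply, P_apply, b_apply, Function.comp_apply]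
  rw [Equiv.swap_apply_apply]
  simp [Function.comp_assoc, ← coe_mul, mul_assoc]

lemma P_mul_y (π : Perm (Fin r)) (i : Fin r) :
    P π * y lv up om i = y lv up om (π i) * P π := by
  rw [y, y, mul_sub, sub_mul, P_mul_c, Finset.mul_sum, Finset.sum_mul]
  congr 1
  refine Finset.sum_nbij π ?_ π.injective.injOn ?_ fun k _ => P_mul_b π i k
  · intro k hk
    simpa using hk
  · intro k hk
    exact ⟨π⁻¹ k, by simpa [Equiv.symm_apply_eq] using hk, by simp⟩

lemma c_comm {i j : Fin r} (hij : i ≠ j) :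
    c lv up om i * c lv up om j = c lv up om j * c lv up om i := by
  refine LinearMap.ext fun f => funext fun w => ?_
  simp only [Module.End.mul_apply, c_apply, shift_apply]
  cases hi : up (w i) <;> cases hj : up (w j) <;>
    simp [hi, hj, hij, hij.symm, Function.update_comm hij] <;> ring

lemma c_comm_b {i j k : Fin r} (hij : i ≠ j) (hik : i ≠ k) :
    c lv up om i * b lv j k = b lv j k * c lv up om i := by
  refine LinearMap.ext fun f => funext fun w => ?_
  simp only [Module.End.mul_apply, c_apply, b_apply, shift_apply, Function.comp_apply,
    swap_apply_of_ne_of_ne hij hik, update_comp_perm]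
  cases hi : up (w i) <;> simp [hij.symm, hik.symm]
  split_ifs <;> simp

lemma b_comm_b {i j k l : Fin r} (hij : i ≠ j) (hil : i ≠ l) (hkj : k ≠ j) (hkl : k ≠ l) :
    b lv i k * b lv j l = b lv j l * b lv i k := by
  refine LinearMap.ext fun f => funext fun w => ?_
  simp only [Module.End.mul_apply, b_apply, Function.comp_apply,
    swap_apply_of_ne_of_ne hij hil, swap_apply_of_ne_of_ne hkj hkl,
    swap_apply_of_ne_of_ne hij.symm hkj.symm, swap_apply_of_ne_of_ne hil.symm hkl.symm]
  have h : swap i k * swap j l = swap j l * swap i k := by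
    refine (Perm.Disjoint.commute fun x => ?_).eq
    by_cases h1 : x = i ∨ x = k
    · right
      rcases h1 with rfl | rfl
      · exact swap_apply_of_ne_of_ne hij hil
      · exact swap_apply_of_ne_of_ne hkj hkl
    · left
      exact swap_apply_of_ne_of_ne (fun h => h1 (.inl h)) fun h => h1 (.inr h)
  rw [Function.comp_assoc, Function.comp_assoc, ← coe_mul, ← coe_mul, h]
  split_ifs <;> rfl

/-- The relation between the `b`'s that involve three letters. -/
lemma b_triple {i j k : Fin r} (hij : i ≠ j) (hik : i ≠ k) (hjk : j ≠ k) :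
    b lv i j * b lv j k - b lv j k * b lv i j + (b lv i k * b lv j i - b lv j i * b lv i k) +
      (b lv i k * b lv j k - b lv j k * b lv i k) =
    -(P (swap i j) * (b lv i k - b lv j k)) := by
  refine LinearMap.ext fun f => funext fun w => ?_
  -- Every product of two of the three transpositions is one of two 3-cycles. Once these are
  -- normalized, the identity compares their coefficients for each ordering of the three levels.
  have e1 : swap i j * swap j k = swap i k * swap i j := by
    rw [mul_swap_eq_swap_mul, swap_apply_right, swap_apply_of_ne_of_ne hik.symm hjk.symm]
  have e2 : swap j k * swap i k = swap i k * swap i j := by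
    rw [mul_swap_eq_swap_mul, swap_apply_right, swap_apply_of_ne_of_ne hij hik, e1]
  have e3 : swap j k * swap i j = swap i k * swap j k := by
    rw [mul_swap_eq_swap_mul, swap_apply_left, swap_apply_of_ne_of_ne hij hik]
  have e4 : swap i j * swap i k = swap i k * swap j k := by
    rw [mul_swap_eq_swap_mul, swap_apply_left, swap_apply_of_ne_of_ne hik.symm hjk.symm, e3]
  simp only [LinearMap.add_apply, LinearMap.sub_apply, LinearMap.neg_apply, Pi.add_apply,
    Pi.sub_apply, Pi.neg_apply, Module.End.mul_apply, b_apply, P_apply, Function.comp_apply,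
    Function.comp_assoc, ← coe_mul, swap_comm j i, e1, e2, e3, e4, swap_apply_left,
    swap_apply_right, swap_apply_of_ne_of_ne hij hik, swap_apply_of_ne_of_ne hij.symm hjk,
    swap_apply_of_ne_of_ne hik.symm hjk.symm]
  split_ifs <;> first | omega | ring

/-- The part of the commutator of `y i` and `y j` that involves only the letters at `i` and `j`.
That raising increases the level by exactly one decides the cases where a shift changes the
comparison of the two levels. -/
lemma c_b_pair {i j : Fin r} (hup : ∀ a a', up a = some a' → lv a' = lv a + 1) (hij : i ≠ j) :
    -(c lv up om i * b lv j i - b lv j i * c lv up om i) -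
      (b lv i j * c lv up om j - c lv up om j * b lv i j) +
      (b lv i j * b lv j i - b lv j i * b lv i j) =
    P (swap i j) * (c lv up om i - b lv i j - (c lv up om j - b lv j i)) := by
  refine LinearMap.ext fun f => funext fun w => ?_
  simp only [LinearMap.add_apply, LinearMap.sub_apply, LinearMap.neg_apply, Pi.add_apply,
    Pi.sub_apply, Pi.neg_apply, Module.End.mul_apply, b_apply, c_apply, shift_apply, P_apply,
    Function.comp_apply, update_comp_perm, swap_comm j i, swap_apply_left, swap_apply_right,
    Function.comp_assoc, ← coe_mul, swap_mul_self, coe_one, Function.comp_id]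
  have hi := hup (w i)
  have hj := hup (w j)
  rcases lt_trichotomy (lv (w i)) (lv (w j)) with h | h | h
  all_goals
    cases hi' : up (w i) <;> cases hj' : up (w j)
    all_goals
      simp only [Option.elim, Function.update_self, Function.update_of_ne hij,
        Function.update_of_ne hij.symm]
      try have := hi _ hi'
      try have := hj _ hj'
      split_ifs <;> first | omega | (rw [h]; ring) | ring

/-- Pure ring algebra: the commutator splits into the two-letter part `h4` and the part `h5` in
which a third letter takes part. -/
lemma commutator_aux {R : Type*} [Ring R] {ci cj bij bji Ri Rj s : R} (h1 : ci * cj = cj * ci)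
    (h2 : ci * Rj = Rj * ci) (h3 : cj * Ri = Ri * cj)
    (h4 : -(ci * bji - bji * ci) - (bij * cj - cj * bij) + (bij * bji - bji * bij) =
      s * (ci - bij - (cj - bji)))
    (h5 : bij * Rj - Rj * bij + (Ri * bji - bji * Ri) + (Ri * Rj - Rj * Ri) = -(s * (Ri - Rj))) :
    (ci - (bij + Ri)) * (cj - (bji + Rj)) - (cj - (bji + Rj)) * (ci - (bij + Ri)) =
      s * (ci - (bij + Ri) - (cj - (bji + Rj))) := by
  have e : (ci - (bij + Ri)) * (cj - (bji + Rj)) - (cj - (bji + Rj)) * (ci - (bij + Ri)) =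
      (ci * cj - cj * ci) - (ci * Rj - Rj * ci) + (cj * Ri - Ri * cj) +
      (-(ci * bji - bji * ci) - (bij * cj - cj * bij) + (bij * bji - bji * bij)) +
      (bij * Rj - Rj * bij + (Ri * bji - bji * Ri) + (Ri * Rj - Rj * Ri)) := by noncomm_ring
  rw [e, h4, h5, h1, h2, h3]
  noncomm_ring

/-- This relation, together with $w\,y_i=y_{w(i)}\,w$, is what makes the sums of the $y_k$ and the
Jucys–Murphy elements commute. -/
lemma y_commutator {i j : Fin r} (hup : ∀ a a', up a = some a' → lv a' = lv a + 1) (hij : i ≠ j) :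
    y lv up om i * y lv up om j - y lv up om j * y lv up om i =
      P (swap i j) * (y lv up om i - y lv up om j) := by
  set K := (Finset.univ.erase i).erase j with hK
  have hi : y lv up om i = c lv up om i - (b lv i j + ∑ k ∈ K, b lv i k) := by
    rw [y, ← Finset.add_sum_erase _ _ (Finset.mem_erase.2 ⟨hij.symm, Finset.mem_univ j⟩)]
  have hj : y lv up om j = c lv up om j - (b lv j i + ∑ k ∈ K, b lv j k) := by
    rw [y, ← Finset.add_sum_erase _ _ (Finset.mem_erase.2 ⟨hij, Finset.mem_univ i⟩),
      Finset.erase_right_comm]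
  have hk : ∀ k ∈ K, k ≠ j ∧ k ≠ i := fun k hk => by simpa [hK] using hk
  rw [hi, hj]
  refine commutator_aux (c_comm hij) ?_ ?_ (c_b_pair hup hij) ?_
  · rw [Finset.mul_sum, Finset.sum_mul]
    exact Finset.sum_congr rfl fun k hk' => c_comm_b hij (hk k hk').2.symm
  · rw [Finset.mul_sum, Finset.sum_mul]
    exact Finset.sum_congr rfl fun k hk' => c_comm_b hij.symm (hk k hk').1.symm
  -- Operators on disjoint pairs of positions commute, so in the double sum only the terms with a
  -- common third position remain.
  · have h : (∑ k ∈ K, b lv i k) * (∑ k ∈ K, b lv j k) - (∑ k ∈ K, b lv j k) * (∑ k ∈ K, b lv i k) =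
        ∑ k ∈ K, (b lv i k * b lv j k - b lv j k * b lv i k) := by
      rw [Finset.sum_mul_sum, Finset.sum_mul_sum, Finset.sum_comm (s := K) (t := K)
        (f := fun k l => b lv j k * b lv i l), ← Finset.sum_sub_distrib]
      refine Finset.sum_congr rfl fun k hk' => ?_
      rw [← Finset.sum_sub_distrib]
      refine Finset.sum_eq_single k (fun l hl hlk => ?_) (fun h => absurd hk' h)
      rw [sub_eq_zero]
      exact b_comm_b hij (hk l hl).2.symm (hk k hk').1 hlk.symm
    rw [h, Finset.mul_sum, Finset.sum_mul, Finset.mul_sum, Finset.sum_mul,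
      ← Finset.sum_sub_distrib, ← Finset.sum_sub_distrib, ← Finset.sum_add_distrib,
      ← Finset.sum_add_distrib, ← Finset.sum_sub_distrib, Finset.mul_sum, ← Finset.sum_neg_distrib]
    exact Finset.sum_congr rfl fun k hk' =>
      b_triple hij (hk k hk').2.symm (hk k hk').1.symm

end WordRep

/-! ### Polynomial generators on words and the cyclotomic relation. -/

namespace WordRep

variable {r : ℕ} {α : Type*} (lv : α → ℕ) (up : α → Option α) (om : ℕ → ℂ)

/-- The Jucys–Murphy elements. -/
def jucysMurphy (k : Fin r) : Module.End ℂ ((Fin r → α) → ℂ) :=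
  ∑ j with j < k, P (swap j k)

/-- The polynomial generators. -/
def X (k : Fin r) : Module.End ℂ ((Fin r → α) → ℂ) := y lv up om k + jucysMurphy k

variable {lv up om}

lemma P_mul_P_swap (π : Perm (Fin r)) (i j : Fin r) :
    P π * P (swap i j) = (P (swap (π i) (π j)) * P π : Module.End ℂ ((Fin r → α) → ℂ)) := by
  rw [P_mul, P_mul, mul_swap_eq_swap_mul]

lemma P_mul_jucysMurphy {π : Perm (Fin r)} {k : Fin r} (hk : π k = k)
    (h : ∀ j, j < k → π j < k) (h' : ∀ j, j < k → π⁻¹ j < k) :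
    P π * jucysMurphy k = (jucysMurphy k * P π : Module.End ℂ ((Fin r → α) → ℂ)) := by
  rw [jucysMurphy, Finset.mul_sum, Finset.sum_mul]
  refine Finset.sum_nbij π ?_ π.injective.injOn ?_ fun j _ => ?_
  · intro j hj
    simpa using h j (by simpa using hj)
  · intro j hj
    exact ⟨π⁻¹ j, by simpa using h' j (by simpa using hj), by simp⟩
  · rw [P_mul_P_swap, hk]

lemma P_swap_mul_jucysMurphy {i j k : Fin r} (hi : i < k) (hj : j < k) :
    P (swap i j) * jucysMurphy k =
      (jucysMurphy k * P (swap i j) : Module.End ℂ ((Fin r → α) → ℂ)) := by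
  have h : ∀ l, l < k → swap i j l < k := by
    intro l hl
    rw [swap_apply_def]
    split_ifs <;> assumption
  exact P_mul_jucysMurphy (swap_apply_of_ne_of_ne hi.ne' hj.ne') h (by rwa [swap_inv])

lemma jucysMurphy_comm {i j : Fin r} (hij : i < j) :
    jucysMurphy i * jucysMurphy j =
      (jucysMurphy j * jucysMurphy i : Module.End ℂ ((Fin r → α) → ℂ)) := by
  rw [jucysMurphy, Finset.sum_mul, Finset.mul_sum]
  refine Finset.sum_congr rfl fun k hk => P_swap_mul_jucysMurphy (lt_trans ?_ hij) hij
  simpa using hk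

/-- Of the Jucys–Murphy sum at `j`, only the transposition of `i` and `j` fails to commute with `y
i`. The resulting term is the negative of the commutator of `y i` and `y j`. -/
lemma X_comm_of_lt (hup : ∀ a a', up a = some a' → lv a' = lv a + 1) {i j : Fin r} (hij : i < j) :
    X lv up om i * X lv up om j = X lv up om j * X lv up om i := by
  have h1 := y_commutator (om := om) hup hij.ne
  have h2 : jucysMurphy i * y lv up om j = y lv up om j * jucysMurphy i := by
    rw [jucysMurphy, Finset.sum_mul, Finset.mul_sum]
    refine Finset.sum_congr rfl fun k hk => ?_
    have hk : k < i := by simpa using hk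
    rw [P_mul_y, swap_apply_of_ne_of_ne (hk.trans hij).ne' hij.ne']
  have h3 : y lv up om i * jucysMurphy j - jucysMurphy j * y lv up om i =
      P (swap i j) * (y lv up om j - y lv up om i) := by
    rw [jucysMurphy, Finset.sum_mul, Finset.mul_sum, ← Finset.sum_sub_distrib,
      Finset.sum_eq_single_of_mem i (by simpa using hij)]
    · rw [mul_sub, P_mul_y (swap i j) j, swap_apply_right]
    · intro k _ hk
      rw [P_mul_y, swap_apply_def, if_neg hk.symm, if_neg hij.ne, sub_self]
  have h4 := jucysMurphy_comm (α := α) hij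
  rw [← sub_eq_zero]
  have e : X lv up om i * X lv up om j - X lv up om j * X lv up om i =
      (y lv up om i * y lv up om j - y lv up om j * y lv up om i) +
      (y lv up om i * jucysMurphy j - jucysMurphy j * y lv up om i) +
      (jucysMurphy i * y lv up om j - y lv up om j * jucysMurphy i) +
      (jucysMurphy i * jucysMurphy j - jucysMurphy j * jucysMurphy i) := by
    rw [X, X]
    noncomm_ring
  rw [e, h1, h2, h3, h4, sub_self, sub_self, mul_sub, mul_sub]
  abel

/-- The part `y` is permuted without correction. The inhomogeneous term arises because the later
Jucys–Murphy sum has one more transposition, the simple one. -/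
lemma adj_mul_X (i : Fin (r - 1)) :
    P (adj i) * X lv up om ⟨i, by omega⟩ = X lv up om ⟨i + 1, by omega⟩ * P (adj i) - 1 := by
  have hi : adj i ⟨i, by omega⟩ = ⟨i + 1, by omega⟩ := by simp [adj]
  have hset : (Finset.univ.filter fun j : Fin r => j < ⟨i + 1, by omega⟩) =
      insert ⟨i, by omega⟩ (Finset.univ.filter fun j : Fin r => j < ⟨i, by omega⟩) := by
    ext j
    simp only [Finset.mem_filter, Finset.mem_univ, true_and, Finset.mem_insert, Fin.lt_def,
      Fin.ext_iff]
    omega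
  rw [X, X, mul_add, P_mul_y, hi, add_mul, add_sub_assoc]
  congr 1
  rw [jucysMurphy, jucysMurphy, hset, Finset.sum_insert (by simp), add_mul, Finset.mul_sum,
    Finset.sum_mul]
  have h1 : P (swap ⟨i, by omega⟩ ⟨i + 1, by omega⟩) * P (adj i) =
      (1 : Module.End ℂ ((Fin r → α) → ℂ)) := by
    rw [← P_one, P_mul]
    exact congrArg P (adj_mul_self i)
  rw [h1, add_sub_cancel_left]
  refine Finset.sum_congr rfl fun j hj => ?_
  simp only [Finset.mem_filter, Finset.mem_univ, true_and, Fin.lt_def] at hj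
  rw [P_mul_P_swap, hi, adj, swap_apply_of_ne_of_ne]
  · simp only [ne_eq, Fin.ext_iff]; omega
  · simp only [ne_eq, Fin.ext_iff]; omega

lemma adj_mul_X_of_ne (i : Fin (r - 1)) (j : Fin r) (h : j.val ≠ i.val) (h' : j.val ≠ i.val + 1) :
    P (adj i) * X lv up om j = X lv up om j * P (adj i) := by
  have hj : adj i j = j := by
    rw [adj]
    exact swap_apply_of_ne_of_ne (by simpa [Fin.ext_iff] using h) (by simpa [Fin.ext_iff] using h')
  have hl : ∀ k, k < j → adj i k < j := by
    intro k hk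
    rw [adj, swap_apply_def]
    simp only [Fin.lt_def, Fin.ext_iff] at hk ⊢
    split_ifs <;> (try simp only) <;> omega
  rw [X, mul_add, add_mul, P_mul_y, P_mul_jucysMurphy hj hl (by rwa [adj_inv]), hj]

lemma adj_comm (i j : Fin (r - 1)) (h : i.val + 1 < j.val ∨ j.val + 1 < i.val) :
    adj i * adj j = adj j * adj i := by
  rw [adj, adj, mul_swap_eq_swap_mul, swap_apply_of_ne_of_ne, swap_apply_of_ne_of_ne]
  all_goals simp only [ne_eq, Fin.ext_iff]; omega

lemma adj_braid (i j : Fin (r - 1)) (h : j.val = i.val + 1) :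
    adj i * adj j * adj i = adj j * adj i * adj j := by
  obtain ⟨j, hj⟩ := j
  simp only at h
  subst h
  have key : ∀ a b c : Fin r, a ≠ b → a ≠ c → b ≠ c →
      swap a b * swap b c * swap a b = swap b c * swap a b * swap b c := by
    intro a b c hab hac hbc
    have h2 := swap_mul_swap_mul_swap hbc.symm hac.symm
    rw [swap_comm b a, swap_comm c b] at h2
    rw [swap_mul_swap_mul_swap hab hac, h2, swap_comm]
  exact key _ _ _ (by simp) (by simp; omega) (by simp)

/-- The filtration of the words by the level of the first letter. -/
lemma prod_apply_eq_zero [NeZero r] (hup : ∀ a a', up a = some a' → lv a' = lv a + 1) (n : ℕ)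
    (f : (Fin r → α) → ℂ) (hf : ∀ w, n ≤ lv (w 0) → f w = 0) :
    (List.ofFn fun i : Fin n => y lv up om (0 : Fin r) -
      algebraMap ℂ (Module.End ℂ ((Fin r → α) → ℂ)) (om i)).prod f = 0 := by
  induction n generalizing f with
  | zero =>
    funext w
    simpa using hf w (Nat.zero_le _)
  | succ n ih =>
    rw [List.ofFn_succ', List.concat_eq_append, List.prod_append, List.prod_singleton,
      Module.End.mul_apply]
    refine ih _ fun w hw => ?_
    -- The operator `y 0` is triangular: besides the scalar `om` of the level, its value at `w` uses
    -- only words whose first letter has higher level. So each linear factor lowers by one the level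
    -- from which `f` vanishes.
    have h1 : shift up 0 f w = 0 := by
      rw [shift_apply]
      cases h : up (w 0) with
      | none => rfl
      | some a =>
        refine hf _ ?_
        rw [Function.update_self, hup _ _ h]
        omega
    have h2 : ∀ k, b lv 0 k f w = 0 := by
      intro k
      rw [b_apply]
      split_ifs with h
      · refine hf _ ?_
        rw [Function.comp_apply, swap_apply_left]
        omega
      · rfl
    have h3 : om (lv (w 0)) * f w = om n * f w := by
      rcases hw.eq_or_lt with h | h
      · rw [h]
      · rw [hf w h, mul_zero, mul_zero]
    simp [y, c_apply, h1, h2, h3, Module.algebraMap_end_apply]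

theorem heckeRelations {ℓ : ℕ} [NeZero r] (hup : ∀ a a', up a = some a' → lv a' = lv a + 1)
    (hlv : ∀ a, lv a < ℓ) :
    HeckeRelations (fun i : Fin ℓ => om i) (fun i : Fin (r - 1) => P (adj i))
      (X lv up om : Fin r → Module.End ℂ ((Fin r → α) → ℂ)) where
  s_sq i := by rw [P_mul, adj_mul_self, P_one]
  x_comm i j := by
    rcases lt_trichotomy i j with h | rfl | h
    · exact X_comm_of_lt hup h
    · rfl
    · exact (X_comm_of_lt hup h).symm
  s_comm i j h := by rw [P_mul, P_mul, adj_comm i j h]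
  s_x_comm := adj_mul_X_of_ne
  x_s i := by
    have h := adj_mul_X (lv := lv) (up := up) (om := om) i
    have hs : P (adj i) * P (adj i) = (1 : Module.End ℂ ((Fin r → α) → ℂ)) := by
      rw [P_mul, adj_mul_self, P_one]
    have h2 : P (adj i) * (P (adj i) * X lv up om ⟨i, by omega⟩) * P (adj i) =
        P (adj i) * (X lv up om ⟨i + 1, by omega⟩ * P (adj i) - 1) * P (adj i) := by rw [h]
    rw [← mul_assoc, hs, one_mul, mul_sub, mul_one, sub_mul, hs, ← mul_assoc, mul_assoc, hs,
      mul_one] at h2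
    rw [h2, sub_sub_cancel_left]
  s_x i := by rw [adj_mul_X, sub_sub_cancel_left]
  braid i j h := by rw [P_mul, P_mul, P_mul, P_mul, adj_braid i j h]
  cyclotomic := by
    refine LinearMap.ext fun f => ?_
    have h0 : X lv up om (0 : Fin r) = y lv up om 0 := by
      rw [X, jucysMurphy, Finset.filter_false_of_mem (by simp), Finset.sum_empty, add_zero]
    rw [h0]
    exact prod_apply_eq_zero hup ℓ f fun w hw => absurd (hlv (w 0)) (by omega)

end WordRep

/-! ### A lower bound for the dimension -/

namespace WordRep

variable {ℓ r : ℕ}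

/-- Letters are pairs of a level and a label; this raises the level. -/
def raise (a : Fin ℓ × Fin r) : Option (Fin ℓ × Fin r) :=
  if h : a.1.val + 1 < ℓ then some (⟨a.1 + 1, h⟩, a.2) else none

lemma raise_eq_some {a a' : Fin ℓ × Fin r} :
    raise a = some a' ↔ a'.1.val = a.1 + 1 ∧ a'.2 = a.2 := by
  obtain ⟨i, n⟩ := a
  obtain ⟨i', n'⟩ := a'
  rw [raise]
  split_ifs with h
  · simp only [Option.some.injEq, Prod.mk.injEq, Fin.ext_iff] at h ⊢
    omega
  · simp only [false_iff] at h ⊢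
    have := i'.2
    omega

lemma P_single (π : Perm (Fin r)) (w : Fin r → Fin ℓ × Fin r) :
    P π (Pi.single w (1 : ℂ)) = Pi.single (w ∘ ⇑π⁻¹) 1 := by
  classical
  funext v
  simp only [P_apply, Pi.single_apply]
  congr 1
  rw [eq_iff_iff]
  constructor
  · rintro rfl
    funext k
    simp
  · rintro rfl
    funext k
    simp

/-- On point masses the operator goes the other way: it replaces a letter by the one a level below.
-/
lemma shift_single {i : Fin r} {v w : Fin r → Fin ℓ × Fin r}
    (h : raise (w i) = some (v i)) (h' : ∀ k, k ≠ i → v k = w k) :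
    shift raise i (Pi.single v (1 : ℂ)) = Pi.single w 1 := by
  classical
  funext u
  rw [shift_apply]
  cases hu : raise (u i) with
  | none =>
    rw [Option.elim_none, Pi.single_apply, if_neg]
    rintro rfl
    rw [h] at hu
    cases hu
  | some a =>
    rw [Option.elim_some, Pi.single_apply, Pi.single_apply]
    congr 1
    rw [eq_iff_iff]
    rw [raise_eq_some] at h hu
    constructor
    · rintro rfl
      funext k
      by_cases hk : k = i
      · subst hk
        rw [Function.update_self] at h
        exact Prod.ext (Fin.ext (by omega)) (hu.2.symm.trans h.2)
      · rw [← h' k hk, Function.update_of_ne hk]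
    · rintro rfl
      funext k
      by_cases hk : k = i
      · subst hk
        rw [Function.update_self]
        exact Prod.ext (Fin.ext (by omega)) (hu.2.trans h.2.symm)
      · rw [Function.update_of_ne hk, h' k hk]

/-- The word with levels `p` and labels `π`. -/
def word (p : Fin r → Fin ℓ) (π : Perm (Fin r)) (k : Fin r) : Fin ℓ × Fin r := (p k, π k)

lemma word_injective : Function.Injective
    (fun q : (Fin r → Fin ℓ) × Perm (Fin r) => word q.1 q.2) := by
  rintro ⟨p, π⟩ ⟨p', π'⟩ h
  have h1 : ∀ k, (p k, π k) = (p' k, π' k) := congrFun h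
  simp only [Prod.mk.injEq] at h1 ⊢
  exact ⟨funext fun k => (h1 k).1, Equiv.ext fun k => (h1 k).2⟩

/-- A subspace that is stable under the operators `P π` and `y i` and contains a word with
all levels maximal contains all words. -/
lemma single_word_mem (om : ℕ → ℂ) (N : Submodule ℂ ((Fin r → Fin ℓ × Fin r) → ℂ))
    (hP : ∀ π, ∀ f ∈ N, P π f ∈ N) (hy : ∀ i, ∀ f ∈ N, y (fun a => a.1.val) raise om i f ∈ N)
    (p₀ : Fin r → Fin ℓ) (hp₀ : ∀ k, (p₀ k).val + 1 = ℓ) (h₀ : Pi.single (word p₀ 1) 1 ∈ N)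
    (p : Fin r → Fin ℓ) (π : Perm (Fin r)) : Pi.single (word p π) 1 ∈ N := by
  induction hm : ∑ k, (ℓ - 1 - (p k).val) generalizing p with
  | zero =>
    have hp : p = p₀ := by
      funext k
      rw [Finset.sum_eq_zero_iff] at hm
      have h1 := hm k (Finset.mem_univ k)
      have h2 := hp₀ k
      have h3 := (p k).2
      exact Fin.ext (by omega)
    have h := hP π⁻¹ _ h₀
    rw [P_single, inv_inv] at h
    have e : word p π = word p₀ 1 ∘ ⇑π := by
      funext k
      have h1 : p k = p₀ (π k) := by rw [hp]; exact Fin.ext (by have := hp₀ k; have := hp₀ (π k); omega)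
      simp [word, h1]
    rwa [e]
  | succ m ih =>
    obtain ⟨i, -, hi⟩ : ∃ i ∈ Finset.univ, ℓ - 1 - (p i).val ≠ 0 := by
      by_contra h
      push Not at h
      rw [Finset.sum_eq_zero h] at hm
      omega
    have hlt : (p i).val + 1 < ℓ := by omega
    -- The level at `i` is raised so that `word q π` is available by induction; `y i` is then used
    -- to come back down.
    set q : Fin r → Fin ℓ := Function.update p i ⟨p i + 1, hlt⟩ with hq
    have hqk : ∀ k, k ≠ i → q k = p k := fun k hk => Function.update_of_ne hk _ _
    have hqi : (q i).val = p i + 1 := by rw [hq, Function.update_self]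
    have hv : Pi.single (word q π) 1 ∈ N := by
      refine ih q ?_
      rw [← Finset.add_sum_erase _ _ (Finset.mem_univ i)] at hm ⊢
      rw [Finset.sum_congr rfl fun k hk => by rw [hqk k (Finset.ne_of_mem_erase hk)], hqi]
      omega
    have h1 : shift raise i (Pi.single (word q π) (1 : ℂ)) = Pi.single (word p π) 1 := by
      refine shift_single (raise_eq_some.2 ⟨hqi, rfl⟩) fun k hk => ?_
      rw [word, word, hqk k hk]
    have hd : ∀ d : (Fin r → Fin ℓ × Fin r) → ℂ, diag d (Pi.single (word q π) 1) ∈ N := by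
      intro d
      have : diag d (Pi.single (word q π) 1) = d (word q π) • Pi.single (word q π) 1 := by
        classical
        funext w
        simp only [diag_apply, Pi.smul_apply, Pi.single_apply, smul_eq_mul]
        split_ifs with h
        · rw [h]
        · rw [mul_zero, mul_zero]
      rw [this]
      exact N.smul_mem _ hv
    have h2 := hy i _ hv
    rw [y, LinearMap.sub_apply, LinearMap.sum_apply] at h2
    -- The terms of `y i` other than the shift only rescale or permute the point mass, so they stay
    -- in `N` and can be removed.
    have h3 := N.add_mem h2 (N.sum_mem (t := Finset.univ.erase i)
      (f := fun k => b (fun a : Fin ℓ × Fin r => a.1.val) i k (Pi.single (word q π) 1))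
      fun k _ => by rw [b, Module.End.mul_apply]; exact hP _ _ (hd _))
    rw [sub_add_cancel, c, LinearMap.add_apply, h1] at h3
    exact (N.add_mem_iff_right (hd _)).1 h3

end WordRep

namespace DegCycHecke

open WordRep

variable {ℓ r : ℕ} [NeZero r] (ω : Fin ℓ → ℂ)

/-- The orbit map of one word of top levels with pairwise distinct labels has an image containing
the point masses of all words with such labels: $\ell^r$ choices of levels and $r!$ arrangements of
labels. -/
theorem pow_mul_factorial_le_finrank [NeZero ℓ] :
    ℓ ^ r * r.factorial ≤ Module.finrank ℂ (DegCycHecke r ω) := by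
  obtain ⟨σ, hσ, -⟩ := existsUnique_fixesGenerators (r := r) ω
  -- `finrank` is 0 in infinite dimension, so finiteness, known from the spanning family, is needed
  -- before any lower bound.
  have hfin : Module.Finite ℂ (DegCycHecke r ω) := hσ.isAnti.module_finite
  have hℓ := NeZero.pos ℓ
  -- The parameters extended by zero; only levels below `ℓ` occur.
  set om : ℕ → ℂ := fun n => if h : n < ℓ then ω ⟨n, h⟩ else 0 with hom
  have hω : ω = fun i : Fin ℓ => om i := by
    funext i
    simp [hom]
  have hrel := WordRep.heckeRelations (r := r) (ℓ := ℓ) (lv := fun a : Fin ℓ × Fin r => a.1.val)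
    (up := raise) (om := om) (fun a a' h => (raise_eq_some.1 h).1) fun a => a.1.2
  rw [← hω] at hrel
  obtain ⟨φ, hs, hx⟩ := hrel.exists_lift
  set p₀ : Fin r → Fin ℓ := fun _ => ⟨ℓ - 1, by omega⟩ with hp₀
  set z : (Fin r → Fin ℓ × Fin r) → ℂ := Pi.single (word p₀ 1) 1 with hz
  let ev : DegCycHecke r ω →ₗ[ℂ] ((Fin r → Fin ℓ × Fin r) → ℂ) :=
    (LinearMap.applyₗ z).comp φ.toLinearMap
  have hev : ∀ T ∈ φ.range, ∀ f ∈ LinearMap.range ev, T f ∈ LinearMap.range ev := by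
    rintro _ ⟨t, rfl⟩ _ ⟨h, rfl⟩
    refine ⟨t * h, ?_⟩
    change φ (t * h) z = φ t (φ h z)
    rw [map_mul, Module.End.mul_apply]
  have hP : ∀ π, P π ∈ φ.range := by
    intro π
    induction π using induction_on_adj with
    | h1 => exact φ.range.one_mem
    | hs i π ih =>
      rw [← P_mul]
      exact φ.range.mul_mem ih ⟨s ω i, hs i⟩
  have hy : ∀ i, y (fun a : Fin ℓ × Fin r => a.1.val) raise om i ∈ φ.range := by
    have h0 : y (fun a : Fin ℓ × Fin r => a.1.val) raise om (0 : Fin r) ∈ φ.range := by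
      refine ⟨x ω 0, (hx 0).trans ?_⟩
      rw [X, jucysMurphy, Finset.filter_false_of_mem (by simp), Finset.sum_empty, add_zero]
    intro i
    have h := P_mul_y (lv := fun a : Fin ℓ × Fin r => a.1.val) (up := raise) (om := om)
      (swap 0 i) 0
    rw [swap_apply_left] at h
    have h2 : y (fun a : Fin ℓ × Fin r => a.1.val) raise om i =
        P (swap 0 i) * y (fun a : Fin ℓ × Fin r => a.1.val) raise om 0 * P (swap 0 i) := by
      rw [h, mul_assoc, P_mul, swap_mul_self, P_one, mul_one]
    rw [h2]
    exact φ.range.mul_mem (φ.range.mul_mem (hP _) h0) (hP _)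
  have hmem := single_word_mem om (LinearMap.range ev) (fun π => hev _ (hP π))
    (fun i => hev _ (hy i)) p₀ (fun k => Nat.sub_add_cancel hℓ)
    ⟨1, by change φ 1 z = _; rw [map_one]; rfl⟩
  have hli : LinearIndependent ℂ (fun q : (Fin r → Fin ℓ) × Perm (Fin r) =>
      (Pi.single (word q.1 q.2) 1 : (Fin r → Fin ℓ × Fin r) → ℂ)) := by
    have := (Pi.basisFun ℂ (Fin r → Fin ℓ × Fin r)).linearIndependent.comp _
      (word_injective (ℓ := ℓ) (r := r))
    simpa [Function.comp_def] using this
  calc ℓ ^ r * r.factorial = Fintype.card ((Fin r → Fin ℓ) × Perm (Fin r)) := by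
        simp [Fintype.card_perm]
    _ = Module.finrank ℂ (Submodule.span ℂ (Set.range _)) := (finrank_span_eq_card hli).symm
    _ ≤ Module.finrank ℂ (LinearMap.range ev) := by
        refine Submodule.finrank_mono (Submodule.span_le.2 ?_)
        rintro _ ⟨q, rfl⟩
        exact hmem q.1 q.2
    _ ≤ _ := LinearMap.finrank_range_le ev

end DegCycHecke

/-! ### Counting pairs of lattice words of the same content -/

namespace LatticeWord

variable {ℓ : ℕ}

/-- `ρ` gives the row lengths of a multipartition. -/
def IsShape (ρ : Fin ℓ × ℕ →₀ ℕ) : Prop := ∀ s i, ρ (s, i + 1) ≤ ρ (s, i)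

/-- The rows from which a box may be removed. -/
def removable (ρ : Fin ℓ × ℕ →₀ ℕ) : Finset (Fin ℓ × ℕ) :=
  ρ.support.filter fun b => ρ (b.1, b.2 + 1) < ρ b

/-- The rows to which a box may be added. -/
def addable (ρ : Fin ℓ × ℕ →₀ ℕ) : Finset (Fin ℓ × ℕ) :=
  (removable ρ).image (fun b => (b.1, b.2 + 1)) ∪ Finset.univ.image fun s => (s, 0)

lemma mem_removable {ρ : Fin ℓ × ℕ →₀ ℕ} {s : Fin ℓ} {i : ℕ} :
    (s, i) ∈ removable ρ ↔ ρ (s, i + 1) < ρ (s, i) := by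
  simp only [removable, Finset.mem_filter, Finsupp.mem_support_iff]
  omega

lemma zero_mem_addable {ρ : Fin ℓ × ℕ →₀ ℕ} {s : Fin ℓ} : (s, 0) ∈ addable ρ := by
  simp [addable]

lemma succ_mem_addable {ρ : Fin ℓ × ℕ →₀ ℕ} {s : Fin ℓ} {i : ℕ} :
    (s, i + 1) ∈ addable ρ ↔ ρ (s, i + 1) < ρ (s, i) := by
  rw [← mem_removable]
  simp [addable]

/-- In each component the addable rows are the top row and the rows just below the removable ones,
hence one more. The resulting `ℓ` is the constant in the commutation of adding and removing boxes.
-/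
lemma card_addable (ρ : Fin ℓ × ℕ →₀ ℕ) : (addable ρ).card = (removable ρ).card + ℓ := by
  rw [addable, Finset.card_union_of_disjoint, Finset.card_image_of_injective,
    Finset.card_image_of_injective, Finset.card_univ, Fintype.card_fin]
  · exact fun s s' h => congrArg Prod.fst h
  · rintro ⟨s, i⟩ ⟨s', i'⟩ h
    simpa using h
  · rw [Finset.disjoint_left]
    intro a ha ha'
    obtain ⟨b, -, rfl⟩ := Finset.mem_image.1 ha
    simp at ha'

lemma single_apply_pair (a b : Fin ℓ × ℕ) : Finsupp.single a 1 b = if a = b then 1 else 0 :=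
  Finsupp.single_apply

lemma mem_removable_add {ρ : Fin ℓ × ℕ →₀ ℕ} (hρ : IsShape ρ) (a : Fin ℓ × ℕ) :
    a ∈ removable (ρ + Finsupp.single a 1) := by
  obtain ⟨s, i⟩ := a
  have := hρ s i
  simp [mem_removable]
  omega

lemma mem_addable_sub {ρ : Fin ℓ × ℕ →₀ ℕ} (hρ : IsShape ρ) {b : Fin ℓ × ℕ}
    (hb : b ∈ removable ρ) : b ∈ addable (ρ - Finsupp.single b 1) := by
  obtain ⟨s, i⟩ := b
  rw [mem_removable] at hb
  cases i with
  | zero => exact zero_mem_addable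
  | succ i =>
    have := hρ s i
    simp [succ_mem_addable]
    omega

/-- For different rows, adding and removing a box may be done in either order. -/
lemma addable_removable_iff {ρ : Fin ℓ × ℕ →₀ ℕ} {a b : Fin ℓ × ℕ} (hab : b ≠ a) :
    a ∈ addable ρ ∧ b ∈ removable (ρ + Finsupp.single a 1) ↔
      a ∈ addable (ρ - Finsupp.single b 1) ∧ b ∈ removable ρ := by
  obtain ⟨s, i⟩ := b
  obtain ⟨s', i'⟩ := a
  cases i' with
  | zero => simp [zero_mem_addable, mem_removable, hab.symm]
  | succ i' =>
    simp only [succ_mem_addable, mem_removable, Finsupp.add_apply, Finsupp.tsub_apply,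
      single_apply_pair, if_neg hab, if_neg hab.symm]
    by_cases h : s = s' ∧ i = i'
    · obtain ⟨rfl, rfl⟩ := h
      simp
      omega
    · have h1 : ¬ (s', i' + 1) = (s, i + 1) := by
        rintro ⟨⟩
        exact h ⟨rfl, rfl⟩
      have h2 : ¬ (s, i) = (s', i') := by
        rintro ⟨⟩
        exact h ⟨rfl, rfl⟩
      simp only [if_neg h1, if_neg h2, add_zero, tsub_zero]

lemma IsShape.sub {ρ : Fin ℓ × ℕ →₀ ℕ} (hρ : IsShape ρ) {b : Fin ℓ × ℕ} (hb : b ∈ removable ρ) :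
    IsShape (ρ - Finsupp.single b 1) := by
  obtain ⟨s, i⟩ := b
  rw [mem_removable] at hb
  intro s' j
  have := hρ s' j
  simp only [Finsupp.tsub_apply, single_apply_pair]
  split_ifs with h1 h2 h2 <;> try omega
  cases h2
  omega

lemma IsShape.add {ρ : Fin ℓ × ℕ →₀ ℕ} (hρ : IsShape ρ) {a : Fin ℓ × ℕ} (ha : a ∈ addable ρ) :
    IsShape (ρ + Finsupp.single a 1) := by
  obtain ⟨s, i⟩ := a
  intro s' j
  have := hρ s' j
  simp only [Finsupp.add_apply, single_apply_pair]
  split_ifs with h1 h2 h2 <;> try omega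
  cases h1
  rw [succ_mem_addable] at ha
  omega

/-- Adding and removing boxes commute up to a constant. -/
lemma sum_addable_sum_removable {ρ : Fin ℓ × ℕ →₀ ℕ} (hρ : IsShape ρ)
    (g : (Fin ℓ × ℕ →₀ ℕ) → ℕ) :
    ∑ a ∈ addable ρ, ∑ b ∈ removable (ρ + Finsupp.single a 1),
        g (ρ + Finsupp.single a 1 - Finsupp.single b 1) =
      ∑ b ∈ removable ρ, ∑ a ∈ addable (ρ - Finsupp.single b 1),
        g (ρ - Finsupp.single b 1 + Finsupp.single a 1) + ℓ * g ρ := by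
  have h1 : ∀ a ∈ addable ρ, ∑ b ∈ removable (ρ + Finsupp.single a 1),
      g (ρ + Finsupp.single a 1 - Finsupp.single b 1) = g ρ +
        ∑ b ∈ (removable (ρ + Finsupp.single a 1)).erase a,
          g (ρ + Finsupp.single a 1 - Finsupp.single b 1) := by
    intro a _
    rw [← Finset.add_sum_erase _ _ (mem_removable_add hρ a), add_tsub_cancel_right]
  have hsub : ∀ b ∈ removable ρ, Finsupp.single b 1 ≤ ρ := by
    rintro ⟨s, i⟩ hb
    rw [mem_removable] at hb
    rw [Finsupp.single_le_iff]
    omega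
  have h2 : ∀ b ∈ removable ρ, ∑ a ∈ addable (ρ - Finsupp.single b 1),
      g (ρ - Finsupp.single b 1 + Finsupp.single a 1) = g ρ +
        ∑ a ∈ (addable (ρ - Finsupp.single b 1)).erase b,
          g (ρ - Finsupp.single b 1 + Finsupp.single a 1) := by
    intro b hb
    rw [← Finset.add_sum_erase _ _ (mem_addable_sub hρ hb), tsub_add_cancel_of_le (hsub b hb)]
  -- On both sides the terms that restore `ρ` are separated; there are `ℓ` more of them on the left.
  rw [Finset.sum_congr rfl h1, Finset.sum_congr rfl h2, Finset.sum_add_distrib,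
    Finset.sum_add_distrib, Finset.sum_const, Finset.sum_const, card_addable]
  have h3 : ∑ a ∈ addable ρ, ∑ b ∈ (removable (ρ + Finsupp.single a 1)).erase a,
        g (ρ + Finsupp.single a 1 - Finsupp.single b 1) =
      ∑ b ∈ removable ρ, ∑ a ∈ (addable (ρ - Finsupp.single b 1)).erase b,
        g (ρ - Finsupp.single b 1 + Finsupp.single a 1) := by
    rw [Finset.sum_comm' (s' := fun b => (addable (ρ - Finsupp.single b 1)).erase b)
      (t' := removable ρ)]
    · refine Finset.sum_congr rfl fun b hb => Finset.sum_congr rfl fun a _ => ?_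
      rw [tsub_add_eq_add_tsub (hsub b hb)]
    · intro a b
      simp only [Finset.mem_erase]
      have := @addable_removable_iff ℓ ρ a b
      tauto
  rw [h3, smul_eq_mul, smul_eq_mul]
  ring

/-- The number of ways to build up `ρ` in `n` steps. -/
noncomputable def pathCount : ℕ → (Fin ℓ × ℕ →₀ ℕ) → ℕ
  | 0, ρ => by classical exact if ρ = 0 then 1 else 0
  | n + 1, ρ => ∑ b ∈ removable ρ, pathCount n (ρ - Finsupp.single b 1)

/-- Each commutation of the added box past one of the `n + 1` removals contributes `ℓ` times the
remaining count. -/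
lemma sum_addable_pathCount (n : ℕ) {ρ : Fin ℓ × ℕ →₀ ℕ} (hρ : IsShape ρ) :
    ∑ a ∈ addable ρ, pathCount (n + 1) (ρ + Finsupp.single a 1) =
      ℓ * (n + 1) * pathCount n ρ := by
  induction n generalizing ρ with
  | zero =>
    have h : ∑ b ∈ removable ρ, ∑ a ∈ addable (ρ - Finsupp.single b 1),
        pathCount 0 (ρ - Finsupp.single b 1 + Finsupp.single a 1) = 0 := by
      refine Finset.sum_eq_zero fun b _ => Finset.sum_eq_zero fun a _ => ?_
      rw [pathCount, if_neg]
      intro h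
      have := DFunLike.congr_fun h a
      simp at this
    have := sum_addable_sum_removable hρ (pathCount 0)
    rw [h] at this
    simp only [pathCount] at this ⊢
    rw [this]
    ring
  | succ n ih =>
    have := sum_addable_sum_removable hρ (pathCount (n + 1))
    rw [Finset.sum_congr rfl fun b hb => ih (hρ.sub hb), ← Finset.mul_sum] at this
    change ∑ a ∈ addable ρ, ∑ b ∈ removable (ρ + Finsupp.single a 1), _ = _
    rw [this]
    change ℓ * (n + 1) * pathCount (n + 1) ρ + _ = _
    ring

/-- The content of a word. -/
noncomputable def content (w : List (Fin ℓ × ℕ)) : Fin ℓ × ℕ →₀ ℕ :=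
  (w.map fun a => Finsupp.single a 1).sum

lemma content_cons (a : Fin ℓ × ℕ) (w : List (Fin ℓ × ℕ)) :
    content (a :: w) = content w + Finsupp.single a 1 := by
  simp [content, add_comm]

/-- The words of length `n` all of whose final segments have a shape as content. -/
noncomputable def words : ℕ → Finset (List (Fin ℓ × ℕ))
  | 0 => {[]}
  | n + 1 => (words n).biUnion fun w => (addable (content w)).image fun a => a :: w

lemma cons_mem_words {n : ℕ} {a : Fin ℓ × ℕ} {w : List (Fin ℓ × ℕ)} :
    a :: w ∈ words (n + 1) ↔ w ∈ words n ∧ a ∈ addable (content w) := by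
  simp only [words, Finset.mem_biUnion, Finset.mem_image, List.cons.injEq]
  constructor
  · rintro ⟨v, hv, b, hb, rfl, rfl⟩
    exact ⟨hv, hb⟩
  · rintro ⟨hw, ha⟩
    exact ⟨w, hw, a, ha, rfl, rfl⟩

lemma sum_words_succ (n : ℕ) (g : List (Fin ℓ × ℕ) → ℕ) :
    ∑ w ∈ words (n + 1), g w = ∑ w ∈ words n, ∑ a ∈ addable (content w), g (a :: w) := by
  rw [words, Finset.sum_biUnion]
  · refine Finset.sum_congr rfl fun w _ => Finset.sum_image fun a _ b _ h => ?_
    exact (List.cons.inj h).1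
  · intro v _ w _ hvw
    rw [Function.onFun, Finset.disjoint_left]
    intro u hu hu'
    obtain ⟨a, -, rfl⟩ := Finset.mem_image.1 hu
    obtain ⟨b, -, h⟩ := Finset.mem_image.1 hu'
    exact hvw (List.cons.inj h).2.symm

lemma exists_cons_of_mem_words {n : ℕ} {w : List (Fin ℓ × ℕ)} (hw : w ∈ words (n + 1)) :
    ∃ a v, w = a :: v := by
  obtain ⟨v, -, hv⟩ := Finset.mem_biUnion.1 hw
  obtain ⟨a, -, rfl⟩ := Finset.mem_image.1 hv
  exact ⟨a, v, rfl⟩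

lemma isShape_content {n : ℕ} {w : List (Fin ℓ × ℕ)} (hw : w ∈ words n) : IsShape (content w) := by
  induction n generalizing w with
  | zero =>
    obtain rfl : w = [] := by simpa [words] using hw
    intro s i
    simp [content]
  | succ n ih =>
    obtain ⟨a, v, rfl⟩ := exists_cons_of_mem_words hw
    rw [cons_mem_words] at hw
    rw [content_cons]
    exact (ih hw.1).add hw.2

-- The first letter of the word is the box added last; stripping it off follows the recursion of
-- `pathCount`.
open Classical in
lemma card_words_content_le (n : ℕ) (ρ : Fin ℓ × ℕ →₀ ℕ) :
    ((words n).filter fun w => content w = ρ).card ≤ pathCount n ρ := by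
  induction n generalizing ρ with
  | zero =>
    rw [words, pathCount]
    split_ifs with h
    · exact (Finset.card_filter_le _ _).trans (by simp)
    · rw [Nat.le_zero, Finset.card_eq_zero, Finset.filter_eq_empty_iff]
      intro w hw e
      obtain rfl : w = [] := by simpa using hw
      exact h (e.symm.trans (by simp [content]))
  | succ n ih =>
    have hsub : (words (n + 1)).filter (fun w => content w = ρ) ⊆ (removable ρ).biUnion fun b =>
        ((words n).filter fun w => content w = ρ - Finsupp.single b 1).image fun w => b :: w := by
      intro w hw
      rw [Finset.mem_filter] at hw
      obtain ⟨hw, e⟩ := hw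
      obtain ⟨a, v, rfl⟩ := exists_cons_of_mem_words hw
      rw [cons_mem_words] at hw
      rw [content_cons] at e
      subst e
      refine Finset.mem_biUnion.2 ⟨a, mem_removable_add (isShape_content hw.1) a, ?_⟩
      rw [add_tsub_cancel_right]
      exact Finset.mem_image.2 ⟨v, Finset.mem_filter.2 ⟨hw.1, rfl⟩, rfl⟩
    refine (Finset.card_le_card hsub).trans (Finset.card_biUnion_le.trans ?_)
    exact Finset.sum_le_sum fun b _ => Finset.card_image_le.trans (ih _)

/-- Extending the words by one letter multiplies the total by $\ell(n+1)$. -/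
lemma sum_words_pathCount (n : ℕ) :
    ∑ w ∈ words (ℓ := ℓ) n, pathCount n (content w) = ℓ ^ n * n.factorial := by
  induction n with
  | zero => simp [words, content, pathCount]
  | succ n ih =>
    rw [sum_words_succ]
    simp only [content_cons]
    rw [Finset.sum_congr rfl fun w hw => sum_addable_pathCount n (isShape_content hw),
      ← Finset.mul_sum, ih, Nat.factorial_succ, pow_succ]
    ring

open Classical in
/-- The number of pairs of lattice words of length `n` with the same content. -/
theorem card_pairs_le (n : ℕ) :
    ((words (ℓ := ℓ) n ×ˢ words n).filter fun p => content p.2 = content p.1).card ≤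
      ℓ ^ n * n.factorial := by
  rw [← sum_words_pathCount, Finset.card_filter, Finset.sum_product]
  refine Finset.sum_le_sum fun w _ => ?_
  rw [← Finset.card_filter]
  exact card_words_content_le n (content w)

end LatticeWord

/-! ### The lattice word of a standard tableau -/

namespace Multipartition

open LatticeWord

variable {ℓ r : ℕ} {lam : Multipartition ℓ r}

/-- The component and the row of a box. -/
def Box.line (b : Box lam) : Fin ℓ × ℕ := (b.comp, b.row)

/-- The rows of the entries `m - 1, …, 0` of a tableau. -/
def lineWord (t : Tableau lam) : ℕ → List (Fin ℓ × ℕ)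
  | 0 => []
  | m + 1 => if h : m < r then (t.symm ⟨m, h⟩).line :: lineWord t m else lineWord t m

lemma lineWord_succ (t : Tableau lam) {m : ℕ} (h : m < r) :
    lineWord t (m + 1) = (t.symm ⟨m, h⟩).line :: lineWord t m := by
  rw [lineWord, dif_pos h]

lemma content_lineWord (t : Tableau lam) {m : ℕ} (hm : m ≤ r) (a : Fin ℓ × ℕ) :
    content (lineWord t m) a =
      (Finset.univ.filter fun b : Box lam => b.line = a ∧ (t b).val < m).card := by
  induction m with
  | zero => simp [lineWord, content]
  | succ m ih =>
    rw [lineWord_succ t hm, content_cons, Finsupp.add_apply, ih (by omega), single_apply_pair]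
    have hmem : ∀ b : Box lam, (t b).val = m ↔ b = t.symm ⟨m, hm⟩ := by
      intro b
      rw [Equiv.eq_symm_apply, Fin.ext_iff]
    split_ifs with h
    · have hset : (Finset.univ.filter fun b : Box lam => b.line = a ∧ (t b).val < m + 1) =
          insert (t.symm ⟨m, hm⟩)
            (Finset.univ.filter fun b : Box lam => b.line = a ∧ (t b).val < m) := by
        ext b
        simp only [Finset.mem_filter, Finset.mem_univ, true_and, Finset.mem_insert, ← hmem b]
        constructor
        · rintro ⟨h1, h2⟩
          rcases Nat.lt_succ_iff_lt_or_eq.1 h2 with h3 | h3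
          · exact .inr ⟨h1, h3⟩
          · exact .inl h3
        · rintro (h1 | ⟨h1, h2⟩)
          · exact ⟨by rw [(hmem b).1 h1, h], by omega⟩
          · exact ⟨h1, by omega⟩
      rw [hset, Finset.card_insert_of_notMem (by simp)]
    · rw [add_zero]
      congr 1
      ext b
      simp only [Finset.mem_filter, Finset.mem_univ, true_and]
      refine and_congr_right fun h1 => ?_
      have : (t b).val ≠ m := fun h2 => h (by rw [← (hmem b).1 h2, h1])
      omega

/-- In a standard tableau the entries below any bound form a shape. For a box outside the top row of
its component, this requires the row above to be strictly longer at that moment. -/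
lemma lineWord_mem_words {t : Tableau lam} (ht : t.IsStandard) {m : ℕ} (hm : m ≤ r) :
    lineWord t m ∈ words m := by
  induction m with
  | zero => simp [lineWord, words]
  | succ m ih =>
    rw [lineWord_succ t hm, cons_mem_words]
    refine ⟨ih (by omega), ?_⟩
    set b₀ := t.symm ⟨m, hm⟩ with hb₀
    have htb : t b₀ = ⟨m, hm⟩ := t.apply_symm_apply _
    clear_value b₀
    obtain ⟨s, i, j, hmem⟩ := b₀
    cases i with
    | zero => exact zero_mem_addable
    | succ i =>
      refine succ_mem_addable.2 ?_
      rw [content_lineWord t (by omega), content_lineWord t (by omega)]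
      have hup : ∀ b : Box lam, b.comp = s → b.row = i + 1 →
          (i, b.col) ∈ lam.comp s := by
        rintro ⟨s', i', j', h'⟩ rfl rfl
        exact YoungDiagram.up_left_mem _ (Nat.le_succ i) le_rfl h'
      refine lt_of_lt_of_le (Finset.card_lt_card (t := Finset.univ.filter fun b : Box lam =>
        b.line = (s, i + 1) ∧ (t b).val < m + 1) ?_) ?_
      · refine (Finset.ssubset_iff_of_subset ?_).2 ⟨⟨s, i + 1, j, hmem⟩, ?_, ?_⟩
        · intro b hb
          simp only [Finset.mem_filter, Finset.mem_univ, true_and] at hb ⊢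
          exact ⟨hb.1, by omega⟩
        · simp [Box.line, htb]
        · simp [htb]
      · classical
        -- Each box goes to the box above it, whose entry is smaller. The `else` branch is never
        -- reached.
        refine Finset.card_le_card_of_injOn
          (fun b => if h : (i, b.col) ∈ lam.comp s then ⟨s, i, b.col, h⟩ else b) ?_ ?_
        · intro b hb
          simp only [Finset.coe_filter, Finset.mem_univ, true_and, Set.mem_ofPred_eq, Box.line,
            Prod.mk.injEq] at hb
          have h := hup b hb.1.1 hb.1.2
          have h2 := ht.2 ⟨s, i, b.col, h⟩ b hb.1.1.symm rfl (by rw [hb.1.2]; exact Nat.lt_succ_self i)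
          rw [Fin.lt_def] at h2
          simp only [dif_pos h, Finset.mem_coe, Finset.mem_filter, Finset.mem_univ, true_and]
          exact ⟨rfl, by omega⟩
        · intro b hb b' hb' e
          simp only [Finset.coe_filter, Finset.mem_univ, true_and, Set.mem_ofPred_eq, Box.line,
            Prod.mk.injEq] at hb hb'
          simp only [dif_pos (hup b hb.1.1 hb.1.2), dif_pos (hup b' hb'.1.1 hb'.1.2),
            Box.mk.injEq, true_and] at e
          obtain ⟨⟨⟨⟩, h2⟩, h3⟩ := hb
          obtain ⟨s, i, j, h⟩ := b
          obtain ⟨s', i', j', h'⟩ := b'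
          simp_all

/-- Rows increase, so the smaller entries in the row of a box are exactly those to its left. -/
lemma content_lineWord_self {t : Tableau lam} (ht : t.IsStandard) (b : Box lam) :
    content (lineWord t (t b)) b.line = b.col := by
  rw [content_lineWord t (t b).2.le, ← Finset.card_range b.col]
  refine Finset.card_nbij (fun b => b.col) ?_ ?_ ?_
  · intro b' hb'
    simp only [Finset.mem_coe, Finset.mem_filter, Finset.mem_univ, true_and, Box.line,
      Prod.mk.injEq, Fin.val_fin_lt] at hb'
    simp only [Finset.mem_coe, Finset.mem_range]
    by_contra h
    rcases (not_lt.1 h).eq_or_lt with h1 | h1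
    · obtain ⟨s, i, j, h⟩ := b
      obtain ⟨s', i', j', h'⟩ := b'
      simp only at hb' h1
      obtain ⟨⟨rfl, rfl⟩, h2⟩ := hb'
      subst h1
      exact lt_irrefl _ h2
    · exact lt_asymm hb'.2 (ht.1 b b' hb'.1.1.symm hb'.1.2.symm h1)
  · rintro ⟨s, i, j, h⟩ hb ⟨s', i', j', h'⟩ hb' e
    simp only [Finset.coe_filter, Finset.mem_univ, true_and, Set.mem_ofPred_eq, Box.line,
      Prod.mk.injEq] at hb hb' e
    obtain ⟨⟨h1, h2⟩, -⟩ := hb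
    obtain ⟨⟨h3, h4⟩, -⟩ := hb'
    rw [← h3] at h1
    rw [← h4] at h2
    subst h1 h2 e
    rfl
  · intro j hj
    simp only [Finset.coe_range, Set.mem_Iio] at hj
    have h : (b.row, j) ∈ lam.comp b.comp := YoungDiagram.up_left_mem _ le_rfl hj.le b.mem
    refine ⟨⟨b.comp, b.row, j, h⟩, ?_, rfl⟩
    have := ht.1 ⟨b.comp, b.row, j, h⟩ b rfl rfl hj
    simpa [Box.line] using this

/-- A letter gives the row of an entry, and the tail of the word below it gives the column, so the
tableau can be read off. -/
lemma lineWord_injective {t t' : Tableau lam} (ht : t.IsStandard) (ht' : t'.IsStandard)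
    (h : lineWord t r = lineWord t' r) : t = t' := by
  have key : ∀ m, m ≤ r → lineWord t m = lineWord t' m := by
    intro m hm
    induction hm using Nat.decreasingInduction with
    | self => exact h
    | of_succ m hm ih =>
      rw [lineWord_succ t hm, lineWord_succ t' hm] at ih
      exact (List.cons.inj ih).2
  have hsymm : t.symm = t'.symm := by
    refine Equiv.ext fun k => ?_
    have h1 := key (k + 1) k.2
    rw [lineWord_succ t k.2, lineWord_succ t' k.2] at h1
    obtain ⟨h2, h3⟩ := List.cons.inj h1
    have h4 := content_lineWord_self ht (t.symm k)
    have h5 := content_lineWord_self ht' (t'.symm k)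
    rw [Equiv.apply_symm_apply] at h4 h5
    simp only [Fin.eta] at h2
    rw [← h2, ← h3, h4] at h5
    generalize t.symm k = b at *
    generalize t'.symm k = b' at *
    obtain ⟨s, i, j, h⟩ := b
    obtain ⟨s', i', j', h'⟩ := b'
    simp only [Box.line, Prod.mk.injEq] at h2 h5
    obtain ⟨rfl, rfl⟩ := h2
    subst h5
    rfl
  rw [← t.symm_symm, hsymm, t'.symm_symm]

lemma content_lineWord_top (t : Tableau lam) (s : Fin ℓ) (i : ℕ) :
    content (lineWord t r) (s, i) = (lam.comp s).rowLen i := by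
  rw [content_lineWord t le_rfl, ← Finset.card_range ((lam.comp s).rowLen i)]
  refine Finset.card_nbij (fun b => b.col) ?_ ?_ ?_
  · rintro ⟨s', i', j', h'⟩ hb
    simp only [Finset.mem_coe, Finset.mem_filter, Finset.mem_univ, true_and, Box.line,
      Prod.mk.injEq] at hb
    obtain ⟨⟨rfl, rfl⟩, -⟩ := hb
    exact Finset.mem_range.2 (YoungDiagram.mem_iff_lt_rowLen.1 h')
  · rintro ⟨s, i, j, h⟩ hb ⟨s', i', j', h'⟩ hb' e
    simp only [Finset.coe_filter, Finset.mem_univ, true_and, Set.mem_ofPred_eq, Box.line,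
      Prod.mk.injEq] at hb hb' e
    obtain ⟨⟨h1, h2⟩, -⟩ := hb
    obtain ⟨⟨h3, h4⟩, -⟩ := hb'
    rw [← h3] at h1
    rw [← h4] at h2
    subst h1 h2 e
    rfl
  · intro j hj
    simp only [Finset.coe_range, Set.mem_Iio] at hj
    exact ⟨⟨s, i, j, YoungDiagram.mem_iff_lt_rowLen.2 hj⟩, by simp [Box.line], rfl⟩

lemma eq_of_rowLen {lam mu : Multipartition ℓ r}
    (h : ∀ s i, (lam.comp s).rowLen i = (mu.comp s).rowLen i) : lam = mu := by
  ext1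
  funext s
  refine SetLike.ext fun ⟨i, j⟩ => ?_
  rw [YoungDiagram.mem_iff_lt_rowLen, YoungDiagram.mem_iff_lt_rowLen, h]

/-- A pair of standard tableaux of equal shape is determined by its two lattice words. These have
equal content, and the content determines the shape. -/
theorem card_std_sq_le (ℓ r : ℕ) :
    Nat.card (Σ lam : Multipartition ℓ r, lam.Std × lam.Std) ≤ ℓ ^ r * r.factorial := by
  classical
  refine le_trans ?_ (card_pairs_le (ℓ := ℓ) r)
  set F := (words (ℓ := ℓ) r ×ˢ words r).filter fun p => content p.2 = content p.1 with hF
  have hmem : ∀ q : Σ lam : Multipartition ℓ r, lam.Std × lam.Std,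
      (lineWord q.2.1.1 r, lineWord q.2.2.1 r) ∈ F := by
    rintro ⟨lam, t, t'⟩
    refine Finset.mem_filter.2 ⟨Finset.mem_product.2
      ⟨lineWord_mem_words t.2 le_rfl, lineWord_mem_words t'.2 le_rfl⟩, Finsupp.ext ?_⟩
    rintro ⟨s, i⟩
    rw [content_lineWord_top, content_lineWord_top]
  rw [← Fintype.card_coe, ← Nat.card_eq_fintype_card]
  refine Nat.card_le_card_of_injective (fun q => (⟨_, hmem q⟩ : F)) ?_
  rintro ⟨lam, t, t'⟩ ⟨mu, u, u'⟩ h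
  have h1 : lineWord t.1 r = lineWord u.1 r := congrArg (fun p : F => p.1.1) h
  have h2 : lineWord t'.1 r = lineWord u'.1 r := congrArg (fun p : F => p.1.2) h
  obtain rfl : lam = mu := eq_of_rowLen fun s i => by
    rw [← content_lineWord_top t.1, ← content_lineWord_top u.1, h1]
  obtain rfl : t = u := Subtype.ext (lineWord_injective t.2 u.2 h1)
  obtain rfl : t' = u' := Subtype.ext (lineWord_injective t'.2 u'.2 h2)
  rfl

end Multipartition

end

/-! ### Reduction of the four families to one. -/

namespace DegCycHecke

variable {ℓ r : ℕ} [NeZero r] (ω : Fin ℓ → ℂ)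

lemma yElt_eq_xElt (c : Fin ℓ → Fin 2) (lam : Multipartition ℓ r) :
    yElt ω c lam = xElt ω (fun i => 1 - c i) lam := by
  rw [yElt, xElt]
  congr 2
  funext i
  generalize c i = d
  fin_cases d <;> rfl

/-- Reversing the parameters turns `π` into `π̃`, and complementing `c` exchanges symmetrizers and
antisymmetrizers. -/
lemma nElt_eq (u : Fin ℓ → ℂ) (c : Fin ℓ → Fin 2) :
    nElt (r := r) ω u c = (data ω).mElt (fun i => u i.rev) (fun i => 1 - c i) := by
  funext lam s t
  rw [nElt, yElt_eq_xElt]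
  rfl

theorem card_le_finrank [NeZero ℓ] :
    Nat.card (Σ lam : Multipartition ℓ r, lam.Std × lam.Std) ≤
      Module.finrank ℂ (DegCycHecke r ω) :=
  (Multipartition.card_std_sq_le ℓ r).trans (pow_mul_factorial_le_finrank ω)

end DegCycHecke

theorem mainTheorem9 (ℓ r : ℕ) [NeZero ℓ] [NeZero r] (ω : Fin ℓ → ℂ) :
    (∃! σ : DegCycHecke r ω ≃ₐ[ℂ] (DegCycHecke r ω)ᵐᵒᵖ, DegCycHecke.FixesGenerators ω σ) ∧
    ∀ σ : DegCycHecke r ω ≃ₐ[ℂ] (DegCycHecke r ω)ᵐᵒᵖ, DegCycHecke.FixesGenerators ω σ →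
      ∀ (c : Fin ℓ → Fin 2) (ξ : Equiv.Perm (Fin ℓ)),
        DegCycHecke.IsTableauCellularBasis ω (DegCycHecke.mC ω c) σ ∧
        DegCycHecke.IsTableauCellularBasis ω (DegCycHecke.nC ω c) σ ∧
        DegCycHecke.IsTableauCellularBasis ω (DegCycHecke.mXi ω ξ) σ ∧
        DegCycHecke.IsTableauCellularBasis ω (DegCycHecke.nXi ω ξ) σ := by
  refine ⟨DegCycHecke.existsUnique_fixesGenerators ω, fun σ hσ c ξ => ?_⟩
  -- The four families correspond to `ξ` being the identity, the reversal, `ξ`, and the reversal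
  -- followed by `ξ`, with matching choices of `c`.
  have key : ∀ (ξ : Equiv.Perm (Fin ℓ)) (c : Fin ℓ → Fin 2),
      DegCycHecke.IsTableauCellularBasis ω
        ((DegCycHecke.data ω).mElt (fun i => ω (ξ i)) c) σ := fun ξ c =>
    (DegCycHecke.data ω).isCellularBasis hσ.isAnti ξ c (DegCycHecke.card_le_finrank ω)
  refine ⟨key 1 c, ?_, key ξ 0, ?_⟩
  · have h : DegCycHecke.nC (r := r) ω c = _ := DegCycHecke.nElt_eq ω ω c
    rw [h]
    exact key Fin.revPerm fun i => 1 - c i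
  · have h : DegCycHecke.nXi (r := r) ω ξ = _ := DegCycHecke.nElt_eq ω (fun i => ω (ξ i)) 0
    rw [h]
    exact key (Fin.revPerm.trans ξ) fun i => 1 - (0 : Fin ℓ → Fin 2) i
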